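/- **Setting.** Let $n\ge 3$ and let $\mathbb G$ be a simple graph on the vertices $1,\dots,n$ with edges $1,\dots,m$, each edge $k$ being oriented, with head $i_k$ and tail $j_k$. For a multi-point $x=(x_1,\dots,x_n)\in(\mathbb R^2)^n$ put $z_k(x)=x_{i_k}-x_{j_k}$ and $z(x)=(z_1(x),\dots,z_m(x))$. Let $R(x)$ be the $m\times 2n$ rigidity matrix, whose $k$th row has the block $z_k(x)'$ at $i_k$, the block $-z_k(x)'$ at $j_k$ and zeros elsewhere; let $S(x)$ be the $m\times 2n$ matrix whose $k$th row has the block $z_k(x)'$ at $j_k$ and zeros elsewhere. A formation $\{\mathbb G,x\}$ is infinitesimally rigid if $\operatorname{rank}R(x)=2n-3$, and minimally so if this is lost when any edge is removed. Let $\{\mathbb G,y\}$ be a target formation: $d_k=\|z_k(y)\|>0$ for all $k$, and every $\{\mathbb G,x\}$ with $\|z_k(x)\|=d_k$ for all $k$ is infinitesimally rigid. Put $e_k(x)=\|z_k(x)\|^2-d_k^2$. For a mismatch error $\mu\in\mathbb R^m$ the overall system is $$\dot x=-R'(x)e(x)+S'(x)\mu .$$ Let $\tilde{\mathbb G}$ be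 a spanning subgraph of $\mathbb G$ for which $\{\tilde{\mathbb G},y\}$ is minimally infinitesimally rigid, let $\tilde e$ and $\hat e$ be the subvectors of $e$ belonging to the edges in, respectively not in, $\tilde{\mathbb G}$, and let $\tilde R$ be the corresponding rows of $R$. An *ambient set* is an open set $\mathcal A\subset\mathbb R^{2n}$ containing $y$, invariant under translations and rotations, such that for $x\in\mathcal A$ the formation $\{\tilde{\mathbb G},x\}$ is minimally infinitesimally rigid, the value $\tilde e(x)$ determines $x\in\mathcal A$ up to a translation and a rotation, and all inner products $(x_i-x_j)'(x_k-x_l)$ are smooth functions of $\tilde e(x)$ on $\tilde e(\mathcal A)$. On it $\hat e=\psi(\tilde e)$ for a function $\psi$ on $\tilde e(\mathcal A)$; write $F=\partial\psi/\partial\tilde e$. The error system is $\dot\epsilon=g(\epsilon,\mu)$ on $\tilde e(\mathcal A)$, where $$g(\tilde e,\mu)=-2\tilde R\tilde R'\tilde e-2\tilde R\tilde R'F'(\tilde e)\psi(\tilde e)+2\tilde RS'\mu ,\qquad \tilde e=\tilde e(x),\ x\in\mathcal A .$$ **Theorem.** Ambient sets exist. For every ambient set $\mathcal A$ there are an open neighborhood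 $\mathcal M\subset\mathbb R^m$ of $0$ and a smooth map $\mu\mapsto\epsilon_\mu$ on $\mathcal M$ with $\epsilon_0=0$ such that for every $\mu\in\mathcal M$ the point $\epsilon_\mu\in\tilde e(\mathcal A)$ is a locally exponentially stable equilibrium of $\dot\epsilon=g(\epsilon,\mu)$, and the following holds. Let $\mathfrak e_\mu\in\mathbb R^m$ be the vector with $\tilde{\mathbb G}$-part $\epsilon_\mu$ and remaining part $\psi(\epsilon_\mu)$. An equilibrium solution is a solution $\bar x$ on $[0,\infty)$ of the overall system with $\bar x(t)\in\mathcal A$ and $e(\bar x(t))=\mathfrak e_\mu$ for all $t\ge0$; write $\bar z=z(\bar x)$. Fix $\mu\in\mathcal M$. From every state $x(0)\in\mathcal A$ for which $\tilde e(x(0))$ is in the domain of attraction of $\epsilon_\mu$ there is a solution $x$ of the overall system for all $t\ge0$. For every such solution, $\{\mathbb G,x(t)\}$ is infinitesimally rigid for all $t\ge 0$, and there is an equilibrium solution $\bar x$ to which $x(t)$ converges exponentially fast. Moreover: 1. If $\bar z$ is constant then, depending on the value of $\mu$ only, either all the points $x_i(t)$ converge exponentially fast to constant values, or all of them drift off to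 infinity ($\|x_i(t)\|\to\infty$). 2. If $\bar z$ is nonconstant, then $\bar x$, to which $x$ converges exponentially fast, rotates rigidly, clockwise or counterclockwise, at a constant angular speed $\omega>0$ about a fixed point $q$ of the plane, so that each point $\bar x_i$ moves on a circle centered at $q$ (of radius $0$ if $\bar x_i=q$). Finally, suppose that $\{\mathbb G,y\}$ is unaligned, i.e. for all four distinct vertices $i,j,k,l$ the vectors $y_i-y_j$ and $y_k-y_l$ are linearly independent. Then there is an open neighborhood $\mathcal M_0\subset\mathcal M$ of $0$ and a subset of $\mathcal M_0$ that is open and dense in $\mathcal M_0$ and has a complement in $\mathcal M_0$ of Lebesgue measure zero, such that for every $\mu$ in that subset every solution $x$ as above converges exponentially fast to an equilibrium solution as in 2. -/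

import Mathlib

open scoped ContDiff

noncomputable section

namespace Formation

/-- The plane with its Euclidean norm. -/
abbrev Plane : Type := EuclideanSpace ℝ (Fin 2)

/-- Multi-points `x = (x₁, …, xₙ)` in the plane. -/
abbrev Config (n : ℕ) : Type := Fin n → Plane

/-- The wedge product `det [u v]`. -/
def wedge (u v : Plane) : ℝ := u 0 * v 1 - u 1 * v 0

/-- Rotation of the plane about the origin by the angle `θ`. -/
def rot (θ : ℝ) (v : Plane) : Plane :=
  !₂[Real.cos θ * v 0 - Real.sin θ * v 1, Real.sin θ * v 0 + Real.cos θ * v 1]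

/-- The action of a rotation followed by a translation on multi-points. -/
def rigidMotion {n : ℕ} (θ : ℝ) (b : Plane) (x : Config n) : Config n :=
  fun i => rot θ (x i) + b

/-- No line through two of the points is parallel to a line through two other ones. -/
def Unaligned {n : ℕ} (x : Config n) : Prop :=
  ∀ i j k l : Fin n, i ≠ j → i ≠ k → i ≠ l → j ≠ k → j ≠ l → k ≠ l →
    wedge (x i - x j) (x k - x l) ≠ 0

/-- `x` is a solution on `[0, ∞)` of the autonomous system with right-hand side `v`. -/
def IsSolution {V : Type*} [NormedAddCommGroup V] [NormedSpace ℝ V]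
    (v : V → V) (x : ℝ → V) : Prop :=
  ∀ t : ℝ, 0 ≤ t → HasDerivWithinAt x (v (x t)) (Set.Ici 0) t

/-- `x` is a solution on `[0, ∞)`, inside `Ω`, of the autonomous system whose right-hand side
`v` is meaningful on `Ω` only. -/
def IsSolutionIn {V : Type*} [NormedAddCommGroup V] [NormedSpace ℝ V]
    (v : V → V) (Ω : Set V) (x : ℝ → V) : Prop :=
  IsSolution v x ∧ ∀ t : ℝ, 0 ≤ t → x t ∈ Ω

/-- `x - x'` tends to zero exponentially fast. -/
def ExpConverges {V : Type*} [NormedAddCommGroup V] (x x' : ℝ → V) : Prop :=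
  ∃ c > 0, ∃ r > 0, ∀ t : ℝ, 0 ≤ t → ‖x t - x' t‖ ≤ c * Real.exp (-r * t)

/-- `p` is a (locally) exponentially stable equilibrium of the system `v` on `Ω`. -/
def IsExpStableEquilibrium {V : Type*} [NormedAddCommGroup V] [NormedSpace ℝ V]
    (v : V → V) (Ω : Set V) (p : V) : Prop :=
  p ∈ Ω ∧ v p = 0 ∧ ∃ δ > 0,
    (∀ p₀ ∈ Metric.ball p δ, ∃ u, IsSolutionIn v Ω u ∧ u 0 = p₀) ∧
    ∃ c > 0, ∃ r > 0, ∀ u, IsSolutionIn v Ω u → u 0 ∈ Metric.ball p δ →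
      ∀ t : ℝ, 0 ≤ t → ‖u t - p‖ ≤ c * ‖u 0 - p‖ * Real.exp (-r * t)

/-- The domain of attraction of `p` for the system `v` on `Ω`. -/
def domainOfAttraction {V : Type*} [NormedAddCommGroup V] [NormedSpace ℝ V]
    (v : V → V) (Ω : Set V) (p : V) : Set V :=
  {p₀ | ∃ u, IsSolutionIn v Ω u ∧ u 0 = p₀ ∧ Filter.Tendsto u Filter.atTop (nhds p)}

/-- The multi-point `x` rotates rigidly, clockwise or counterclockwise, with a constant angular
speed `w > 0` about a fixed point `q`: each point moves on a circle centered at `q`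
(of radius `0` if that point sits at `q`). -/
def IsRotating {n : ℕ} (x : ℝ → Config n) : Prop :=
  ∃ w > 0, ∃ σ : ℝ, (σ = 1 ∨ σ = -1) ∧ ∃ q : Plane,
    ∀ t : ℝ, 0 ≤ t → ∀ i, x t i = q + rot (σ * w * t) (x 0 i - q)

/-- A simple graph on `n` labelled vertices with `m` labelled, oriented edges. -/
structure OrientedGraph (n m : ℕ) where
  head : Fin m → Fin n
  tail : Fin m → Fin n
  head_ne_tail : ∀ k, head k ≠ tail k
  edge_injective : Function.Injective fun k => s(head k, tail k)

namespace OrientedGraph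

variable {n m : ℕ} (G : OrientedGraph n m)

/-- The relative position `z_k = x_i - x_j`, where `i` is the head and `j` the tail of edge `k`. -/
def z (x : Config n) (k : Fin m) : Plane := x (G.head k) - x (G.tail k)

/-- The matrix `H`: transposed incidence matrix. -/
def H (k : Fin m) (i : Fin n) : ℝ :=
  if i = G.head k then 1 else if i = G.tail k then -1 else 0

/-- The matrix `J`: the negative entries of `-H` are replaced by zeros. -/
def J (k : Fin m) (i : Fin n) : ℝ := max (-G.H k i) 0

/-- The rigidity matrix `R = D' (H ⊗ I)` at `x`. -/
def R (x : Config n) : Matrix (Fin m) (Fin n × Fin 2) ℝ :=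
  Matrix.of fun k p => G.z x k p.2 * G.H k p.1

/-- The matrix `S = D' (J ⊗ I)` at `x`. -/
def S (x : Config n) : Matrix (Fin m) (Fin n × Fin 2) ℝ :=
  Matrix.of fun k p => G.z x k p.2 * G.J k p.1

/-- The rigidity matrix of the formation whose edges are those in `E`. -/
def Rred (E : Finset (Fin m)) (x : Config n) : Matrix E (Fin n × Fin 2) ℝ :=
  (G.R x).submatrix Subtype.val id

/-- The formation with edges `E` at `x` is infinitesimally rigid. -/
def InfRigidOn (E : Finset (Fin m)) (x : Config n) : Prop := (G.Rred E x).rank = 2 * n - 3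

/-- The formation `{G, x}` is infinitesimally rigid. -/
def InfRigid (x : Config n) : Prop := (G.R x).rank = 2 * n - 3

/-- The formation with edges `E` at `x` is minimally infinitesimally rigid. -/
def MinInfRigidOn (E : Finset (Fin m)) (x : Config n) : Prop :=
  G.InfRigidOn E x ∧ ∀ k ∈ E, ¬ G.InfRigidOn (E.erase k) x

/-- `{G, y}` is a target formation: neighbors have positive target distances, and all formations
with the same edge lengths (in particular `{G, y}`) are infinitesimally rigid. -/
def IsTarget (y : Config n) : Prop :=
  (∀ k, 0 < ‖G.z y k‖) ∧ ∀ x : Config n, (∀ k, ‖G.z x k‖ = ‖G.z y k‖) → G.InfRigid x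

/-- The error `e_k = ‖z_k‖² - d_k²`, with the target distances `d_k` realized by `y`. -/
def err (y x : Config n) (k : Fin m) : ℝ := ‖G.z x k‖ ^ 2 - ‖G.z y k‖ ^ 2

/-- The right-hand side `-R' e + S' μ` of the overall system. -/
def overall (y : Config n) (μ : Fin m → ℝ) (x : Config n) : Config n := fun i =>
  WithLp.toLp 2 fun a =>
    (-((G.R x).transpose.mulVec (G.err y x)) + (G.S x).transpose.mulVec μ) (i, a)

/-- The reduced error: the entries of the error that belong to the edges in `E`. -/
def redErr (y : Config n) (E : Finset (Fin m)) (x : Config n) : E → ℝ := fun k => G.err y x k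

/-- `A` is an ambient set for the target formation `{G, y}` and its reduction to the edges `E`:
an open set containing `y`, invariant under translations and rotations, at whose points the
reduced formation is minimally infinitesimally rigid, and on which the reduced error determines
the multi-point up to a translation and a rotation, with all inner products of differences of
points being smooth functions of the reduced error. -/
structure IsAmbient (y : Config n) (E : Finset (Fin m)) (A : Set (Config n)) : Prop where
  isOpen : IsOpen A
  mem : y ∈ A
  invariant : ∀ (θ : ℝ) (b : Plane), ∀ x ∈ A, rigidMotion θ b x ∈ A
  rigid : ∀ x ∈ A, G.MinInfRigidOn E x
  orbit : ∀ x ∈ A, ∀ x' ∈ A, G.redErr y E x = G.redErr y E x' →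
    ∃ (θ : ℝ) (b : Plane), x' = rigidMotion θ b x
  smooth : ∀ i j k l : Fin n, ∃ η : (E → ℝ) → ℝ, ContDiffOn ℝ ∞ η (G.redErr y E '' A) ∧
    ∀ x ∈ A, inner ℝ (x i - x j) (x k - x l) = η (G.redErr y E x)

/-- A multi-point in `A` with reduced error `ε` (arbitrary if there is none). -/
def lift (y : Config n) (E : Finset (Fin m)) (A : Set (Config n)) (ε : E → ℝ) : Config n :=
  Function.invFunOn (G.redErr y E) A ε

/-- The remaining entries of the error, as a function `ψ` of the reduced error on `A`. -/
def psi (y : Config n) (E : Finset (Fin m)) (A : Set (Config n)) (ε : E → ℝ) :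
    {k : Fin m // k ∉ E} → ℝ :=
  fun k => G.err y (G.lift y E A ε) k

/-- The Jacobian matrix `F` of `ψ`. -/
def F (y : Config n) (E : Finset (Fin m)) (A : Set (Config n)) (ε : E → ℝ) :
    Matrix {k : Fin m // k ∉ E} E ℝ :=
  LinearMap.toMatrix' (fderiv ℝ (G.psi y E A) ε : (E → ℝ) →ₗ[ℝ] ({k : Fin m // k ∉ E} → ℝ))

/-- The right-hand side `g(ε, μ) = -2 R̃ R̃' ε - 2 R̃ R̃' F'(ε) ψ(ε) + 2 R̃ S' μ` of the error
system, where `R̃` and `S` are taken at any `x ∈ A` with reduced error `ε`. -/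
def errSys (y : Config n) (E : Finset (Fin m)) (A : Set (Config n)) (μ : Fin m → ℝ)
    (ε : E → ℝ) : E → ℝ :=
  let x := G.lift y E A ε
  let Rt := G.Rred E x
  (-2 : ℝ) • (Rt * Rt.transpose).mulVec ε
    - (2 : ℝ) • (Rt * Rt.transpose * (G.F y E A ε).transpose).mulVec (G.psi y E A ε)
    + (2 : ℝ) • (Rt * (G.S x).transpose).mulVec μ

/-- The output `P̃' ε + P̂' ψ(ε)` of the error system in the state `ε`. -/
def output (y : Config n) (E : Finset (Fin m)) (A : Set (Config n)) (ε : E → ℝ) : Fin m → ℝ :=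
  fun k => if h : k ∈ E then ε ⟨k, h⟩ else G.psi y E A ε ⟨k, h⟩

/-- `x` solves the overall system, starts in `A`, and its initial reduced error is in the domain
of attraction of the equilibrium `p` of the error system. -/
def IsAttracted (y : Config n) (E : Finset (Fin m)) (A : Set (Config n)) (μ : Fin m → ℝ)
    (p : E → ℝ) (x : ℝ → Config n) : Prop :=
  IsSolution (G.overall y μ) x ∧ x 0 ∈ A ∧
    G.redErr y E (x 0) ∈ domainOfAttraction (G.errSys y E A μ) (G.redErr y E '' A) p

/-- `x` solves the overall system, stays in `A`, and its error is constantly equal to the output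
of the error system in the state `p`. -/
def IsEquilibriumSolution (y : Config n) (E : Finset (Fin m)) (A : Set (Config n))
    (μ : Fin m → ℝ) (p : E → ℝ) (x : ℝ → Config n) : Prop :=
  IsSolution (G.overall y μ) x ∧
    ∀ t : ℝ, 0 ≤ t → x t ∈ A ∧ G.err y (x t) = G.output y E A p

/-- The relative positions are constant along `x`. -/
def ZConstant (x : ℝ → Config n) : Prop := ∀ t : ℝ, 0 ≤ t → G.z (x t) = G.z (x 0)

end OrientedGraph

end Formation

end

/-! The overall system is equivariant under rigid motions. On an ambient set the reduced error
therefore obeys its own equation, namely the error system, which is the image $2\tilde R\dot x$ of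
the overall vector field (`errSys_lift`). Since $\tilde e$ is a submersion with smooth local
sections, every smooth rigid invariant becomes a smooth function of the reduced error
(`contDiffAt_comp_lift`). Ambient sets come from the inverse function theorem: $\tilde e$ and three
gauge coordinates are local coordinates at $y$ (`exists_isAmbient`).

For $\mu=0$ let $T$ be the derivative at $0$ of the full error as a function of the reduced one.
Along the linearized error system the form $|Th|^2$ is dissipated by a multiple of $|R'Th|^2$, and
$R'$ is injective on the image of $T$, because that image lies in the range of $R$
(`exists_dissipative_form`). The implicit function theorem and the same quadratic form then yield a
smooth family of exponentially stable equilibria for small $\mu$ (`exists_expStable_family`).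

To return from errors to motions, identify the plane with $\mathbb C$ and measure in units of one
edge $k$. Relative positions and velocities in these units are functions of the reduced error, so
the edge solves a scalar linear equation with known coefficient, and the remaining motion is a
quadrature (`IsAmbient.exists_solution`). Over an equilibrium $\tilde R\dot x=0$, so the velocity is
an infinitesimal rigid motion, whose angular speed $s$ depends on $\mu$ only
(`IsAmbient.exists_hasSpin`). Equilibrium solutions are rotations if $s\neq0$ and uniform
translations if $s=0$. For other solutions, the edge $k$ seen in a frame rotating with speed $s$ has
exponentially decaying velocity, hence a limit; so does its tail once the asymptotic motion is
subtracted (`IsAmbient.exists_expConverges`).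

For the generic case take moments about the centroid. If $s=0$ all velocities agree and the total
moment is zero. The errors act along the edges in opposite pairs and contribute no moment, so
$\sum_k\mu_k\tau_k=0$ (`sum_mul_torque_eq_zero`). The differential of this equation at $\mu=0$
consists of the torques $\tau_k(y)$, which cannot all vanish for a rigid formation
(`MinInfRigidOn.exists_torque_ne_zero`). Its solutions near $0$ thus form a relatively closed null
set. -/

noncomputable section

namespace Formation

open Set Filter Topology Metric

/-! ### Autonomous systems and quadratic Lyapunov functions. -/

section ODE

variable {V : Type*} [NormedAddCommGroup V] [NormedSpace ℝ V]

theorem IsSolution.continuousOn {v : V → V} {x : ℝ → V} (h : IsSolution v x) :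
    ContinuousOn x (Ici 0) :=
  fun t ht => (h t ht).continuousWithinAt

/-- Solutions of an autonomous system with a locally Lipschitz right-hand side are determined by
their initial values. -/
theorem IsSolutionIn.eq_of_locallyLipschitzOn {v : V → V} {Ω : Set V}
    (hv : LocallyLipschitzOn Ω v) {u w : ℝ → V} (hu : IsSolutionIn v Ω u)
    (hw : IsSolutionIn v Ω w) (h0 : u 0 = w 0) {t : ℝ} (ht : 0 ≤ t) : u t = w t := by
  have hcu : ContinuousOn u (Icc 0 t) := hu.1.continuousOn.mono Icc_subset_Ici_self
  have hcw : ContinuousOn w (Icc 0 t) := hw.1.continuousOn.mono Icc_subset_Ici_self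
  have hK : IsCompact (u '' Icc 0 t ∪ w '' Icc 0 t) :=
    (isCompact_Icc.image_of_continuousOn hcu).union (isCompact_Icc.image_of_continuousOn hcw)
  have hsub : u '' Icc 0 t ∪ w '' Icc 0 t ⊆ Ω := by
    rintro _ (⟨s, hs, rfl⟩ | ⟨s, hs, rfl⟩)
    exacts [hu.2 s hs.1, hw.2 s hs.1]
  obtain ⟨K, hLip⟩ := (hv.mono hsub).exists_lipschitzOnWith_of_compact hK
  refine ODE_solution_unique_of_mem_Icc_right (v := fun _ => v)
    (s := fun _ => u '' Icc 0 t ∪ w '' Icc 0 t) (K := K) (fun _ _ => hLip) hcu ?_ ?_ hcw ?_ ?_ h0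
    (right_mem_Icc.2 ht)
  · exact fun s hs => (hu.1 s hs.1).mono (Ici_subset_Ici.2 hs.1)
  · exact fun s hs => Or.inl ⟨s, Ico_subset_Icc_self hs, rfl⟩
  · exact fun s hs => (hw.1 s hs.1).mono (Ici_subset_Ici.2 hs.1)
  · exact fun s hs => Or.inr ⟨s, Ico_subset_Icc_self hs, rfl⟩

theorem ContDiffAt.locallyLipschitzOn {v : V → V} {Ω : Set V}
    (hv : ∀ x ∈ Ω, ContDiffAt ℝ 1 v x) : LocallyLipschitzOn Ω v := by
  intro x hx
  obtain ⟨K, s, hs, hl⟩ := (hv x hx).exists_lipschitzOnWith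
  exact ⟨K, s, mem_nhdsWithin_of_mem_nhds hs, hl⟩

/-- A bounded Lipschitz vector field has solutions on `[0, ∞)` from all initial values. -/
theorem exists_isSolution_of_lipschitz_of_bounded [CompleteSpace V] {v : V → V} {K L : NNReal}
    (hK : LipschitzWith K v) (hL : ∀ x, ‖v x‖ ≤ L) (p : V) :
    ∃ u, IsSolution v u ∧ u 0 = p := by
  have hex : ∀ N : ℕ, ∃ α : ℝ → V, α 0 = p ∧
      ∀ t ∈ Icc (0 : ℝ) N, HasDerivWithinAt α (v (α t)) (Icc (0 : ℝ) N) t := by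
    intro N
    have hN : (0 : ℝ) ∈ Icc (0 : ℝ) N := ⟨le_rfl, N.cast_nonneg⟩
    -- Up to time `N` a curve of speed at most `L` stays within `L * N` of `p`, so a ball of that
    -- radius suffices on the whole interval.
    have hpl : IsPicardLindelof (fun _ => v) (⟨0, hN⟩ : Icc (0 : ℝ) N) p (L * N) 0 L K := by
      refine IsPicardLindelof.of_time_independent (fun x _ => hL x) hK.lipschitzOnWith ?_
      simp
    simpa using hpl.exists_eq_forall_mem_Icc_hasDerivWithinAt₀
  choose α hα0 hα using hex
  have hright : ∀ N : ℕ, ∀ t ∈ Ico (0 : ℝ) N, HasDerivWithinAt (α N) (v (α N t)) (Ici t) t := by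
    intro N t ht
    exact (hα N t (Ico_subset_Icc_self ht)).mono_of_mem_nhdsWithin
      (mem_of_superset (Icc_mem_nhdsGE ht.2) (Icc_subset_Icc_left ht.1))
  have hagree : ∀ N M : ℕ, N ≤ M → ∀ t ∈ Icc (0 : ℝ) N, α N t = α M t := by
    intro N M hNM t ht
    have hNM' : (N : ℝ) ≤ M := by exact_mod_cast hNM
    refine ODE_solution_unique_of_mem_Icc_right (v := fun _ => v) (s := fun _ => univ) (K := K)
      (fun _ _ => hK.lipschitzOnWith) (fun s hs => (hα N s hs).continuousWithinAt)
      (hright N) (fun _ _ => mem_univ _)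
      (fun s hs => ((hα M s ⟨hs.1, hs.2.trans hNM'⟩).continuousWithinAt).mono
        (Icc_subset_Icc_right hNM'))
      (fun s hs => hright M s ⟨hs.1, hs.2.trans_le hNM'⟩) (fun _ _ => mem_univ _)
      ((hα0 N).trans (hα0 M).symm) ht
  -- The `+ 1` keeps `t` strictly below the right end of the interval, so that a derivative within
  -- the interval is one within `Ici 0`.
  let u : ℝ → V := fun t => α (⌈t⌉₊ + 1) t
  have hu : ∀ N : ℕ, ∀ t ∈ Icc (0 : ℝ) N, u t = α N t := by
    intro N t ht
    rcases le_total (⌈t⌉₊ + 1) N with h | h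
    · exact hagree _ _ h t ⟨ht.1, (Nat.le_ceil t).trans (by push_cast; linarith)⟩
    · exact (hagree _ _ h t ht).symm
  refine ⟨u, fun t ht => ?_, (hu 0 0 (by simp)).trans (hα0 0)⟩
  have hlt : t < (⌈t⌉₊ + 1 : ℕ) := (Nat.le_ceil t).trans_lt (by push_cast; linarith)
  have htm : t ∈ Icc (0 : ℝ) (⌈t⌉₊ + 1 : ℕ) := ⟨ht, hlt.le⟩
  have h1 := ((hα _ t htm).congr (fun s hs => hu _ s hs) (hu _ t htm))
  rw [← hu _ t htm] at h1
  refine h1.mono_of_mem_nhdsWithin ?_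
  rw [mem_nhdsWithin]
  exact ⟨Iio _, isOpen_Iio, hlt, fun s hs => ⟨hs.2, (mem_Iio.1 hs.1).le⟩⟩

/-- Decay of a quadratic Lyapunov function along a curve which follows, as long as it stays in a
ball, a vector field that is dissipative on the ball. -/
theorem lyapunov_decay {B : V →L[ℝ] V →L[ℝ] ℝ} (hsymm : ∀ x y, B x y = B y x) {c : ℝ}
    (hc : 0 < c) (hpos : ∀ x, c * ‖x‖ ^ 2 ≤ B x x) {v : V → V} {p : V} {ρ κ : ℝ} (hρ : 0 < ρ)
    (hκ : 0 < κ)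
    (hv : ∀ w ∈ closedBall p ρ, B (w - p) (v w) ≤ -κ * B (w - p) (w - p)) {u u' : ℝ → V}
    (hu : ∀ t, 0 ≤ t → HasDerivWithinAt u (u' t) (Ici 0) t)
    (huv : ∀ t, 0 ≤ t → u t ∈ closedBall p ρ → u' t = v (u t))
    (h0 : B (u 0 - p) (u 0 - p) < c * ρ ^ 2) {t : ℝ} (ht : 0 ≤ t) :
    u t ∈ closedBall p ρ ∧
      B (u t - p) (u t - p) ≤ B (u 0 - p) (u 0 - p) * Real.exp (-κ * t) := by
  set f : ℝ → ℝ := fun s => B (u s - p) (u s - p) with hf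
  have hball : ∀ s, f s ≤ c * ρ ^ 2 → u s ∈ closedBall p ρ := by
    intro s hs
    rw [mem_closedBall, dist_eq_norm]
    have h1 : c * ‖u s - p‖ ^ 2 ≤ c * ρ ^ 2 := (hpos _).trans hs
    exact le_of_sq_le_sq (le_of_mul_le_mul_left h1 hc) hρ.le
  have hfd : ∀ s, 0 ≤ s → HasDerivWithinAt f (2 * B (u s - p) (u' s)) (Ici 0) s := by
    intro s hs
    have h1 := (hu s hs).sub_const p
    have h2 := (B.hasFDerivAt.comp_hasDerivWithinAt s h1).clm_apply h1
    refine h2.congr_deriv ?_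
    change B (u' s) (u s - p) + B (u s - p) (u' s) = 2 * B (u s - p) (u' s)
    rw [hsymm (u' s)]
    ring
  have hf0 : 0 ≤ f 0 := le_trans (by positivity) (hpos _)
  -- The form has logarithmic decay rate at least $2\kappa$, while only $\kappa$ is claimed; this
  -- slack gives the strict inequality of slopes needed at a contact with the barrier $be^{-\kappa
  -- t}$. The bound on `b` ensures that a contact takes place inside the ball, where dissipativity
  -- is known.
  have key : ∀ b, f 0 < b → b < c * ρ ^ 2 → f t ≤ b * Real.exp (-κ * t) := by
    intro b hb0 hb1
    have hb : 0 < b := hf0.trans_lt hb0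
    refine image_le_of_deriv_right_lt_deriv_boundary (a := 0) (b := t)
      (B := fun s => b * Real.exp (-κ * s)) (B' := fun s => b * (Real.exp (-κ * s) * (-κ)))
      (f' := fun s => 2 * B (u s - p) (u' s)) ?_ ?_ ?_ ?_ ?_ (right_mem_Icc.2 ht)
    · exact fun s hs => (hfd s hs.1).continuousWithinAt.mono Icc_subset_Ici_self
    · exact fun s hs => (hfd s hs.1).mono (Ici_subset_Ici.2 hs.1)
    · simpa using hb0.le
    · intro s
      have h1 : HasDerivAt (fun s : ℝ => -κ * s) (-κ) s := by
        simpa using (hasDerivAt_id s).const_mul (-κ)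
      exact h1.exp.const_mul b
    · intro s hs hfs
      have hE : Real.exp (-κ * s) ≤ 1 := Real.exp_le_one_iff.2 (by nlinarith [hs.1])
      have hEp := Real.exp_pos (-κ * s)
      have hmem := hball s (by rw [hfs]; nlinarith)
      have h2 := hv _ hmem
      rw [huv s hs.1 hmem]
      change B (u s - p) (v (u s)) ≤ -κ * f s at h2
      rw [hfs] at h2
      have : 0 < κ * (b * Real.exp (-κ * s)) := by positivity
      have h3 : B (u s - p) (v (u s)) ≤ -(κ * (b * Real.exp (-κ * s))) := by linarith
      change 2 * B (u s - p) (v (u s)) < b * (Real.exp (-κ * s) * -κ)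
      linarith
  have hE : Real.exp (-κ * t) ≤ 1 := Real.exp_le_one_iff.2 (by nlinarith)
  have hEp := Real.exp_pos (-κ * t)
  have hfin : f t ≤ f 0 * Real.exp (-κ * t) := by
    rw [← div_le_iff₀ hEp]
    refine le_of_forall_gt_imp_ge_of_dense fun b hb => ?_
    obtain ⟨b', hb'0, hb'1⟩ := exists_between (lt_min hb h0)
    rw [div_le_iff₀ hEp]
    exact (key b' hb'0 (hb'1.trans_le (min_le_right _ _))).trans
      (by gcongr; exact (hb'1.trans_le (min_le_left _ _)).le)
  refine ⟨hball t (hfin.trans ?_), hfin⟩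
  change f 0 < _ at h0
  nlinarith

end ODE

/-- A quadratic Lyapunov function shows exponential stability. -/
theorem isExpStableEquilibrium_of_lyapunov {ι : Type*} [Fintype ι]
    {B : (ι → ℝ) →L[ℝ] (ι → ℝ) →L[ℝ] ℝ} (hsymm : ∀ x y, B x y = B y x) {c : ℝ} (hc : 0 < c)
    (hpos : ∀ x, c * ‖x‖ ^ 2 ≤ B x x) {v : (ι → ℝ) → (ι → ℝ)} {Ω : Set (ι → ℝ)} {p : ι → ℝ}
    {ρ κ : ℝ} (hρ : 0 < ρ) (hκ : 0 < κ) (hΩ : closedBall p ρ ⊆ Ω)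
    (hLip : LocallyLipschitzOn Ω v) (hvp : v p = 0)
    (hv : ∀ w ∈ closedBall p ρ, B (w - p) (v w) ≤ -κ * B (w - p) (w - p)) :
    IsExpStableEquilibrium v Ω p := by
  obtain ⟨K, hK⟩ := (hLip.mono hΩ).exists_lipschitzOnWith_of_compact (isCompact_closedBall p ρ)
  -- Coordinatewise truncation is a 1-Lipschitz retraction onto the ball because the norm is the sup
  -- norm. It makes the field globally Lipschitz and bounded; the Lyapunov estimate then shows that
  -- the solutions considered never leave the ball and do not feel the truncation.
  let clamp : (ι → ℝ) → (ι → ℝ) := fun w k => max (p k - ρ) (min (p k + ρ) (w k))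
  have hclamp : LipschitzWith 1 clamp := by
    refine LipschitzWith.of_dist_le_mul fun x y => ?_
    rw [NNReal.coe_one, one_mul, dist_pi_le_iff dist_nonneg]
    intro k
    refine le_trans ?_ (dist_le_pi_dist x y k)
    simp only [Real.dist_eq, clamp]
    refine (abs_max_sub_max_le_max _ _ _ _).trans ?_
    simp only [sub_self, abs_zero]
    refine max_le (abs_nonneg _) ((abs_min_sub_min_le_max _ _ _ _).trans ?_)
    simp
  have hclamp_mem : ∀ w, clamp w ∈ closedBall p ρ := by
    intro w
    rw [mem_closedBall, dist_pi_le_iff hρ.le]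
    intro k
    rw [Real.dist_eq, abs_le]
    simp only [clamp]
    refine ⟨by linarith [le_max_left (p k - ρ) (min (p k + ρ) (w k))], ?_⟩
    have : max (p k - ρ) (min (p k + ρ) (w k)) ≤ p k + ρ :=
      max_le (by linarith) (min_le_left _ _)
    linarith
  have hclamp_eq : ∀ w ∈ closedBall p ρ, clamp w = w := by
    intro w hw
    rw [mem_closedBall, dist_pi_le_iff hρ.le] at hw
    funext k
    have := hw k
    rw [Real.dist_eq, abs_le] at this
    simp only [clamp]
    rw [min_eq_right (by linarith), max_eq_right (by linarith)]
  have hv'Lip : LipschitzWith (K * 1) (v ∘ clamp) :=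
    lipschitzOnWith_univ.1
      (hK.comp hclamp.lipschitzOnWith (fun w _ => hclamp_mem w))
  have hdiam : ∃ L : NNReal, ∀ w, ‖(v ∘ clamp) w‖ ≤ L := by
    obtain ⟨L, hL⟩ := (isCompact_closedBall p ρ).exists_bound_of_continuousOn hK.continuousOn
    exact ⟨L.toNNReal, fun w => (hL _ (hclamp_mem w)).trans (Real.le_coe_toNNReal L)⟩
  obtain ⟨L, hL⟩ := hdiam
  have hB0 : 0 < ‖B‖ + 1 := by positivity
  have hBle : ∀ x, B x x ≤ (‖B‖ + 1) * ‖x‖ ^ 2 := by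
    intro x
    have h1 := B.le_opNorm₂ x x
    have h2 := le_abs_self (B x x)
    rw [← Real.norm_eq_abs] at h2
    nlinarith [sq_nonneg ‖x‖]
  -- Chosen such that $(\|B\|+1)\delta^2=c\rho^2$: the `δ`-ball then lies in the sublevel set that
  -- `lyapunov_decay` starts from.
  let δ := ρ * Real.sqrt (c / (‖B‖ + 1))
  have hδ : 0 < δ := by positivity
  have hδ2 : (‖B‖ + 1) * δ ^ 2 = c * ρ ^ 2 := by
    simp only [δ]
    rw [mul_pow, Real.sq_sqrt (by positivity)]
    field_simp
  have hstart : ∀ x ∈ ball p δ, B (x - p) (x - p) < c * ρ ^ 2 := by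
    intro x hx
    rw [mem_ball, dist_eq_norm] at hx
    refine (hBle _).trans_lt ?_
    rw [← hδ2]
    have : ‖x - p‖ ^ 2 < δ ^ 2 := by
      have := norm_nonneg (x - p)
      nlinarith
    nlinarith
  -- The form decays at rate `κ` and is comparable to the squared norm, whence the rate `κ / 2` and
  -- the square root of the ratio of the two comparison constants.
  refine ⟨hΩ (mem_closedBall_self hρ.le), hvp, δ, hδ, ?_, Real.sqrt ((‖B‖ + 1) / c), by positivity,
    κ / 2, by positivity, ?_⟩
  · intro p₀ hp₀
    obtain ⟨u, hu, hu0⟩ := exists_isSolution_of_lipschitz_of_bounded hv'Lip hL p₀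
    have hdec : ∀ t, 0 ≤ t → u t ∈ closedBall p ρ := fun t ht =>
      (lyapunov_decay hsymm hc hpos hρ hκ hv hu
        (fun s _ hs => by simp [hclamp_eq _ hs]) (by rw [hu0]; exact hstart _ hp₀) ht).1
    refine ⟨u, ⟨fun t ht => ?_, fun t ht => hΩ (hdec t ht)⟩, hu0⟩
    have := hu t ht
    rwa [Function.comp_apply, hclamp_eq _ (hdec t ht)] at this
  · intro u hu hu0 t ht
    have h1 := (lyapunov_decay hsymm hc hpos hρ hκ hv hu.1 (fun _ _ _ => rfl)
      (hstart _ hu0) ht).2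
    have h2 : c * ‖u t - p‖ ^ 2 ≤ (‖B‖ + 1) * ‖u 0 - p‖ ^ 2 * Real.exp (-κ * t) :=
      ((hpos _).trans h1).trans (by gcongr; exact hBle _)
    refine abs_le_of_sq_le_sq' ?_ (by positivity) |>.2
    rw [mul_pow, mul_pow, Real.sq_sqrt (by positivity), ← Real.exp_nat_mul]
    have h3 : ((2 : ℕ) : ℝ) * (-(κ / 2) * t) = -κ * t := by push_cast; ring
    rw [h3]
    rw [mul_comm, ← le_div_iff₀ hc] at h2
    refine h2.trans_eq ?_
    ring

end Formation

/-! ### Calculus of exponential convergence. -/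

namespace Formation

open Set Filter Topology Metric

section ExpConverges

variable {V : Type*} [NormedAddCommGroup V]

theorem ExpConverges.of_norm_le {W : Type*} [NormedAddCommGroup W] {x x' : ℝ → V} {y y' : ℝ → W}
    (h : ExpConverges x x') {C : ℝ}
    (hle : ∀ t, 0 ≤ t → ‖y t - y' t‖ ≤ C * ‖x t - x' t‖) : ExpConverges y y' := by
  obtain ⟨c, hc, r, hr, hb⟩ := h
  refine ⟨(|C| + 1) * c, by positivity, r, hr, fun t ht => (hle t ht).trans ?_⟩
  rw [mul_assoc]
  have h1 : C ≤ |C| + 1 := (le_abs_self C).trans (by linarith)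
  exact mul_le_mul h1 (hb t ht) (norm_nonneg _) (by positivity)

theorem ExpConverges.add {x x' y y' : ℝ → V} (hx : ExpConverges x x') (hy : ExpConverges y y') :
    ExpConverges (fun t => x t + y t) (fun t => x' t + y' t) := by
  obtain ⟨c, hc, r, hr, hb⟩ := hx
  obtain ⟨d, hd, s, hs, hb'⟩ := hy
  refine ⟨c + d, by positivity, min r s, lt_min hr hs, fun t ht => ?_⟩
  have h1 : Real.exp (-r * t) ≤ Real.exp (-min r s * t) :=
    Real.exp_le_exp.2 (by nlinarith [min_le_left r s])
  have h2 : Real.exp (-s * t) ≤ Real.exp (-min r s * t) :=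
    Real.exp_le_exp.2 (by nlinarith [min_le_right r s])
  calc ‖x t + y t - (x' t + y' t)‖ = ‖(x t - x' t) + (y t - y' t)‖ := by congr 1; abel
    _ ≤ ‖x t - x' t‖ + ‖y t - y' t‖ := norm_add_le _ _
    _ ≤ c * Real.exp (-min r s * t) + d * Real.exp (-min r s * t) :=
        add_le_add ((hb t ht).trans (by gcongr)) ((hb' t ht).trans (by gcongr))
    _ = _ := by ring

theorem ExpConverges.refl (x : ℝ → V) : ExpConverges x x :=
  ⟨1, one_pos, 1, one_pos, fun t _ => by rw [sub_self, norm_zero]; positivity⟩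

theorem ExpConverges.mul {f f' g g' : ℝ → ℂ} (hf : ExpConverges f f') (hg : ExpConverges g g')
    {C D : ℝ} (hf' : ∀ t, 0 ≤ t → ‖f' t‖ ≤ C) (hgb : ∀ t, 0 ≤ t → ‖g t‖ ≤ D) :
    ExpConverges (fun t => f t * g t) (fun t => f' t * g' t) := by
  have h1 : ExpConverges (fun t => (f t - f' t) * g t) (fun _ => 0) :=
    hf.of_norm_le (C := D) fun t ht => by
      rw [sub_zero, norm_mul, mul_comm]
      exact mul_le_mul_of_nonneg_right (hgb t ht) (norm_nonneg _)
  have h2 : ExpConverges (fun t => f' t * (g t - g' t)) (fun _ => 0) :=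
    hg.of_norm_le (C := C) fun t ht => by
      rw [sub_zero, norm_mul]
      exact mul_le_mul_of_nonneg_right (hf' t ht) (norm_nonneg _)
  refine (h1.add h2).of_norm_le (C := 1) fun t _ => ?_
  rw [one_mul]
  refine le_of_eq (congrArg _ ?_)
  ring

theorem ExpConverges.pi {ι : Type*} [Fintype ι] {x x' : ℝ → ι → V}
    (h : ∀ i, ExpConverges (fun t => x t i) (fun t => x' t i)) : ExpConverges x x' := by
  choose c hc r hr hb using h
  rcases isEmpty_or_nonempty ι with hι | hι
  · exact ⟨1, one_pos, 1, one_pos, fun t _ => by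
      rw [Subsingleton.elim (x t - x' t) 0, norm_zero]; positivity⟩
  obtain ⟨i₀, hi₀⟩ := Finite.exists_min r
  refine ⟨∑ i, c i, Finset.sum_pos (fun i _ => hc i) Finset.univ_nonempty, r i₀, hr i₀,
    fun t ht => ?_⟩
  have hs : 0 ≤ ∑ i, c i := Finset.sum_nonneg fun i _ => (hc i).le
  rw [pi_norm_le_iff_of_nonneg (by positivity)]
  intro i
  refine (hb i t ht).trans ?_
  have h1 : c i ≤ ∑ i, c i := Finset.single_le_sum (fun i _ => (hc i).le) (Finset.mem_univ i)
  have h2 : Real.exp (-r i * t) ≤ Real.exp (-r i₀ * t) :=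
    Real.exp_le_exp.2 (by nlinarith [hi₀ i])
  exact mul_le_mul h1 h2 (Real.exp_pos _).le hs

theorem ExpConverges.apply {ι : Type*} [Fintype ι] {x x' : ℝ → ι → V} (h : ExpConverges x x')
    (i : ι) : ExpConverges (fun t => x t i) (fun t => x' t i) :=
  h.of_norm_le (C := 1) fun t _ => by
    rw [one_mul]
    exact norm_le_pi_norm (x t - x' t) i

/-- Before time `T` the curve is bounded by compactness, and there $e^{rT}e^{-rt}\ge1$, so a larger
constant absorbs that stretch. -/
theorem ExpConverges.of_eventually {x : ℝ → V} {p : V} (hx : ContinuousOn x (Ici 0)) {c r T : ℝ}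
    (hr : 0 < r) (hb : ∀ t, T ≤ t → ‖x t - p‖ ≤ c * Real.exp (-r * t)) :
    ExpConverges x (fun _ => p) := by
  obtain ⟨D, hD⟩ := (isCompact_Icc (a := (0 : ℝ)) (b := T)).exists_bound_of_continuousOn
    (f := fun t => x t - p) ((hx.mono Icc_subset_Ici_self).sub continuousOn_const)
  refine ⟨|c| + |D| * Real.exp (r * T) + 1, by positivity, r, hr, fun t ht => ?_⟩
  have hE := Real.exp_pos (-r * t)
  rcases le_total T t with h | h
  · refine (hb t h).trans ?_
    gcongr
    have := le_abs_self c
    have : 0 ≤ |D| * Real.exp (r * T) := by positivity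
    linarith
  · have h1 : 1 ≤ Real.exp (r * T) * Real.exp (-r * t) := by
      rw [← Real.exp_add]
      exact Real.one_le_exp (by nlinarith)
    calc ‖x t - p‖ ≤ |D| := (hD t ⟨ht, h⟩).trans (le_abs_self D)
      _ ≤ |D| * (Real.exp (r * T) * Real.exp (-r * t)) :=
          le_mul_of_one_le_right (abs_nonneg _) h1
      _ = (|D| * Real.exp (r * T)) * Real.exp (-r * t) := by ring
      _ ≤ _ := by
          gcongr
          have := abs_nonneg c
          linarith

theorem tendsto_const_mul_exp_neg {c r : ℝ} (hr : 0 < r) :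
    Tendsto (fun t : ℝ => c * Real.exp (-r * t)) atTop (𝓝 0) := by
  have h1 : Tendsto (fun t : ℝ => -r * t) atTop atBot :=
    tendsto_id.const_mul_atTop_of_neg (neg_neg_of_pos hr)
  simpa using (Real.tendsto_exp_atBot.comp h1).const_mul c

theorem ExpConverges.tendsto {x : ℝ → V} {p : V} (h : ExpConverges x fun _ => p) :
    Tendsto x atTop (𝓝 p) := by
  obtain ⟨c, hc, r, hr, hb⟩ := h
  rw [tendsto_iff_norm_sub_tendsto_zero]
  exact squeeze_zero' (Eventually.of_forall fun _ => norm_nonneg _)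
    (eventually_ge_atTop 0 |>.mono hb) (tendsto_const_mul_exp_neg hr)

theorem ExpConverges.bounded {x : ℝ → V} {p : V} (h : ExpConverges x fun _ => p) :
    ∃ C, ∀ t, 0 ≤ t → ‖x t‖ ≤ C := by
  obtain ⟨c, hc, r, hr, hb⟩ := h
  refine ⟨c + ‖p‖, fun t ht => ?_⟩
  have h1 : Real.exp (-r * t) ≤ 1 := Real.exp_le_one_iff.2 (by nlinarith)
  have h2 := hb t ht
  have h3 := norm_le_norm_sub_add (x t) p
  nlinarith

variable [NormedSpace ℝ V]

/-- A $C^1$ map is Lipschitz near `p`, where the curve stays from some time on; the earlier stretch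
needs only continuity. -/
theorem ExpConverges.comp_contDiffAt {W : Type*} [NormedAddCommGroup W] [NormedSpace ℝ W]
    {u : ℝ → V} {p : V} (h : ExpConverges u fun _ => p) {φ : V → W} (hφ : ContDiffAt ℝ 1 φ p)
    (hc : ContinuousOn (fun t => φ (u t)) (Ici 0)) :
    ExpConverges (fun t => φ (u t)) fun _ => φ p := by
  obtain ⟨K, s, hs, hl⟩ := hφ.exists_lipschitzOnWith
  obtain ⟨T, hT⟩ := eventually_atTop.1 (h.tendsto.eventually hs)
  obtain ⟨c, -, r, hr, hb⟩ := h
  refine ExpConverges.of_eventually hc (T := max T 0) (c := K * c) hr fun t ht => ?_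
  rw [mul_assoc]
  exact (hl.norm_sub_le (hT t (le_of_max_le_left ht)) (mem_of_mem_nhds hs)).trans
    (by gcongr; exact hb t (le_of_max_le_right ht))

/-- A solution that tends to an exponentially stable equilibrium does so exponentially fast. -/
theorem IsExpStableEquilibrium.expConverges {v : V → V} {Ω : Set V} {p : V}
    (hp : IsExpStableEquilibrium v Ω p) {u : ℝ → V} (hu : IsSolutionIn v Ω u)
    (hup : Tendsto u atTop (𝓝 p)) : ExpConverges u fun _ => p := by
  obtain ⟨-, -, δ, hδ, -, c, hc, r, hr, hb⟩ := hp
  obtain ⟨T, hT⟩ := eventually_atTop.1 (hup.eventually (ball_mem_nhds p hδ))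
  set T' := max T 0
  have hT' : 0 ≤ T' := le_max_right _ _
  have hsol : IsSolutionIn v Ω (fun t => u (T' + t)) := by
    refine ⟨fun t ht => ?_, fun t ht => hu.2 _ (by positivity)⟩
    have h1 : HasDerivWithinAt (fun t : ℝ => T' + t) 1 (Ici 0) t :=
      ((hasDerivAt_id t).const_add T').hasDerivWithinAt
    have h2 := (hu.1 (T' + t) (by positivity)).scomp t h1
      (fun s (hs : 0 ≤ s) => by simp only [mem_Ici]; positivity)
    rw [one_smul] at h2
    exact h2
  have hfin := hb _ hsol (by simpa using hT T' (le_max_left _ _))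
  refine ExpConverges.of_eventually hu.1.continuousOn (T := T')
    (c := c * ‖u T' - p‖ * Real.exp (r * T')) hr fun t ht => ?_
  have h3 := hfin (t - T') (by linarith)
  simp only [add_sub_cancel, add_zero] at h3
  refine h3.trans_eq ?_
  rw [mul_assoc _ (Real.exp _), ← Real.exp_add]
  congr 2
  ring

/-- A curve with exponentially decaying velocity converges exponentially fast. -/
theorem exists_expConverges_of_deriv [CompleteSpace V] {h h' : ℝ → V}
    (hd : ∀ t, 0 ≤ t → HasDerivWithinAt h (h' t) (Ici 0) t)
    (hb : ExpConverges h' fun _ => 0) : ∃ l, ExpConverges h fun _ => l := by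
  obtain ⟨c, hc, r, hr, hb⟩ := hb
  have hE : ∀ s : ℝ, HasDerivAt (fun s : ℝ => Real.exp (-r * s)) (Real.exp (-r * s) * (-r)) s := by
    intro s
    have h1 : HasDerivAt (fun s : ℝ => -r * s) (-r) s := by
      simpa using (hasDerivAt_id s).const_mul (-r)
    exact h1.exp
  -- This is the integral of the velocity bound $ce^{-r\tau}$ over $[s,\infty)$. It serves both for
  -- the Cauchy property and, on letting `t` tend to infinity, for the final estimate.
  have key : ∀ s t : ℝ, 0 ≤ s → s ≤ t → ‖h t - h s‖ ≤ c / r * Real.exp (-r * s) := by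
    intro s t hs hst
    have h1 : ‖h t - h s‖ ≤ c / r * (Real.exp (-r * s) - Real.exp (-r * t)) := by
      refine image_norm_le_of_norm_deriv_right_le_deriv_boundary (a := s) (b := t)
        (f := fun τ => h τ - h s) (f' := h')
        (B := fun τ => c / r * (Real.exp (-r * s) - Real.exp (-r * τ)))
        (B' := fun τ => c / r * (-(Real.exp (-r * τ) * (-r)))) ?_ ?_ ?_ ?_ ?_ (right_mem_Icc.2 hst)
      · exact fun τ hτ => ((hd τ (hs.trans hτ.1)).continuousWithinAt.mono
          (fun a ha => hs.trans ha.1)).sub continuousWithinAt_const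
      · exact fun τ hτ => ((hd τ (hs.trans hτ.1)).sub_const _).mono
          (Ici_subset_Ici.2 (hs.trans hτ.1))
      · simp
      · exact fun τ => ((hE τ).const_sub _).const_mul _
      · intro τ hτ
        have := hb τ (hs.trans hτ.1)
        rw [sub_zero] at this
        refine this.trans_eq ?_
        field_simp
    have h2 : 0 < c / r * Real.exp (-r * t) := by positivity
    linarith
  have hcauchy : Cauchy (map h atTop) := by
    rw [Metric.cauchy_iff]
    refine ⟨inferInstance, fun ε hε => ?_⟩
    obtain ⟨T, hT⟩ := eventually_atTop.1
      ((tendsto_const_mul_exp_neg (c := c / r) hr).eventually (gt_mem_nhds (half_pos hε)))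
    refine ⟨h '' Ici (max T 0), image_mem_map (Ici_mem_atTop _), ?_⟩
    rintro _ ⟨s, hs, rfl⟩ _ ⟨t, ht, rfl⟩
    have h0 : 0 ≤ max T 0 := le_max_right _ _
    have h1 := key _ s h0 hs
    have h2 := key _ t h0 ht
    have h3 := hT (max T 0) (le_max_left _ _)
    rw [dist_eq_norm]
    calc ‖h s - h t‖ = ‖(h s - h (max T 0)) - (h t - h (max T 0))‖ := by congr 1; abel
      _ ≤ ‖h s - h (max T 0)‖ + ‖h t - h (max T 0)‖ := norm_sub_le _ _
      _ < ε := by linarith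
  obtain ⟨l, hl⟩ := CompleteSpace.complete hcauchy
  refine ⟨l, c / r, by positivity, r, hr, fun s hs => ?_⟩
  have hl' : Tendsto (fun t => ‖h t - h s‖) atTop (𝓝 ‖l - h s‖) :=
    ((show Tendsto h atTop (𝓝 l) from hl).sub_const _).norm
  rw [norm_sub_rev]
  exact le_of_tendsto hl' ((eventually_ge_atTop s).mono fun t ht => key s t hs ht)

end ExpConverges

end Formation

/-! ### Complex coordinates, the rigidity matrix and infinitesimal motions. -/

namespace Formation

open Set Filter Topology Metric
open scoped ComplexConjugate

/-- The plane as the complex numbers. -/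
def toC : Plane ≃ₗᵢ[ℝ] ℂ := Complex.orthonormalBasisOneI.repr.symm

theorem toC_apply (v : Plane) : toC v = v 0 + v 1 * Complex.I := rfl

theorem toC_rot (θ : ℝ) (v : Plane) : toC (rot θ v) = Complex.exp (θ * Complex.I) * toC v := by
  rw [Complex.exp_mul_I, ← Complex.ofReal_cos, ← Complex.ofReal_sin]
  apply Complex.ext <;> simp [toC_apply, rot]
  ring

theorem inner_eq_re (u v : Plane) : inner ℝ u v = (conj (toC u) * toC v).re := by
  simp [toC_apply, PiLp.inner_apply, Fin.sum_univ_two]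
  ring

theorem norm_exp_mul_I (θ : ℝ) : ‖Complex.exp (θ * Complex.I)‖ = 1 :=
  Complex.norm_exp_ofReal_mul_I θ

variable {n : ℕ}

theorem toC_rigidMotion (θ : ℝ) (b : Plane) (x : Config n) (i : Fin n) :
    toC (rigidMotion θ b x i) = Complex.exp (θ * Complex.I) * toC (x i) + toC b := by
  rw [rigidMotion, map_add, toC_rot]

theorem config_ext {x x' : Config n} (h : ∀ i, toC (x i) = toC (x' i)) : x = x' :=
  funext fun i => toC.injective (h i)

theorem exists_eq_rigidMotion {x x' : Config n} {w b : ℂ} (hw : ‖w‖ = 1)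
    (h : ∀ i, toC (x' i) = w * toC (x i) + b) : ∃ θ b', x' = rigidMotion θ b' x := by
  obtain ⟨θ, rfl⟩ := (Complex.norm_eq_one_iff w).1 hw
  refine ⟨θ, toC.symm b, config_ext fun i => ?_⟩
  rw [toC_rigidMotion, h, LinearIsometryEquiv.apply_symm_apply]

namespace OrientedGraph

variable {m : ℕ} (G : OrientedGraph n m)

theorem H_eq (k : Fin m) (i : Fin n) :
    G.H k i = (if i = G.head k then 1 else 0) - (if i = G.tail k then 1 else 0) := by
  have := G.head_ne_tail k
  unfold H
  split_ifs with h1 h2 h2 <;> simp_all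

theorem J_eq (k : Fin m) (i : Fin n) : G.J k i = if i = G.tail k then 1 else 0 := by
  have := G.head_ne_tail k
  unfold J H
  split_ifs with h1 h2 h2 <;> simp_all

theorem toC_z (x : Config n) (k : Fin m) :
    toC (G.z x k) = toC (x (G.head k)) - toC (x (G.tail k)) := by
  rw [z, map_sub]

theorem toC_z_rigidMotion (θ : ℝ) (b : Plane) (x : Config n) (k : Fin m) :
    toC (G.z (rigidMotion θ b x) k) = Complex.exp (θ * Complex.I) * toC (G.z x k) := by
  rw [toC_z, toC_z, toC_rigidMotion, toC_rigidMotion]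
  ring

theorem norm_z_rigidMotion (θ : ℝ) (b : Plane) (x : Config n) (k : Fin m) :
    ‖G.z (rigidMotion θ b x) k‖ = ‖G.z x k‖ := by
  rw [← toC.norm_map, toC_z_rigidMotion, norm_mul, norm_exp_mul_I, one_mul, toC.norm_map]

theorem err_rigidMotion (y : Config n) (θ : ℝ) (b : Plane) (x : Config n) :
    G.err y (rigidMotion θ b x) = G.err y x := by
  funext k
  rw [err, err, norm_z_rigidMotion]

theorem redErr_rigidMotion (y : Config n) (E : Finset (Fin m)) (θ : ℝ) (b : Plane)
    (x : Config n) : G.redErr y E (rigidMotion θ b x) = G.redErr y E x := by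
  funext k
  rw [redErr, redErr, err_rigidMotion]

/-- The total velocity that forces of strength `c k i` along the edges `k` give the vertex `i`. -/
theorem overall_eq (y : Config n) (μ : Fin m → ℝ) (x : Config n) (i : Fin n) :
    G.overall y μ x i = ∑ k, (-(G.H k i * G.err y x k) + G.J k i * μ k) • G.z x k := by
  ext a
  simp only [overall, Pi.add_apply, Pi.neg_apply, Matrix.mulVec, dotProduct, Matrix.transpose_apply,
    R, S, Matrix.of_apply, ← Finset.sum_neg_distrib, ← Finset.sum_add_distrib]
  rw [WithLp.ofLp_sum, Finset.sum_apply]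
  refine Finset.sum_congr rfl fun k _ => ?_
  simp only [PiLp.smul_apply, smul_eq_mul]
  ring

theorem toC_overall (y : Config n) (μ : Fin m → ℝ) (x : Config n) (i : Fin n) :
    toC (G.overall y μ x i) =
      ∑ k, ((-(G.H k i * G.err y x k) + G.J k i * μ k : ℝ) : ℂ) * toC (G.z x k) := by
  rw [overall_eq, map_sum]
  refine Finset.sum_congr rfl fun k _ => ?_
  rw [map_smul, Complex.real_smul]

/-- The coefficients of the edge vectors in the velocities are rigid invariants, and the edge
vectors themselves only turn. This equivariance makes the overall system descend to the errors. -/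
theorem toC_overall_rigidMotion (y : Config n) (μ : Fin m → ℝ) (θ : ℝ) (b : Plane) (x : Config n)
    (i : Fin n) : toC (G.overall y μ (rigidMotion θ b x) i) =
      Complex.exp (θ * Complex.I) * toC (G.overall y μ x i) := by
  rw [toC_overall, toC_overall, Finset.mul_sum, err_rigidMotion]
  refine Finset.sum_congr rfl fun k _ => ?_
  rw [toC_z_rigidMotion]
  ring

/-- The relative position of the ends of an edge, as a linear map. -/
def zL (k : Fin m) : Config n →L[ℝ] Plane :=
  ContinuousLinearMap.proj (R := ℝ) (φ := fun _ => Plane) (G.head k) -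
    ContinuousLinearMap.proj (R := ℝ) (φ := fun _ => Plane) (G.tail k)

/-- The rigidity matrix as a linear map on velocities. -/
def rigidity (x : Config n) : Config n →L[ℝ] (Fin m → ℝ) :=
  ContinuousLinearMap.pi fun k => (innerSL ℝ (G.z x k)).comp (G.zL k)

/-- The reduced rigidity matrix as a linear map on velocities. -/
def redRigidity (E : Finset (Fin m)) (x : Config n) : Config n →L[ℝ] (E → ℝ) :=
  ContinuousLinearMap.pi fun k : E => (innerSL ℝ (G.z x k)).comp (G.zL k)

theorem rigidity_apply (x v : Config n) (k : Fin m) :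
    G.rigidity x v k = inner ℝ (G.z x k) (G.z v k) := rfl

theorem redRigidity_apply (E : Finset (Fin m)) (x v : Config n) (k : E) :
    G.redRigidity E x v k = inner ℝ (G.z x k) (G.z v k) := rfl

theorem contDiff_z (k : Fin m) : ContDiff ℝ ∞ fun x : Config n => G.z x k :=
  (G.zL k).contDiff

theorem contDiff_err (y : Config n) : ContDiff ℝ ∞ (G.err y) :=
  contDiff_pi.2 fun k => ((G.contDiff_z k).norm_sq ℝ).sub contDiff_const

theorem contDiff_redErr (y : Config n) (E : Finset (Fin m)) : ContDiff ℝ ∞ (G.redErr y E) :=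
  contDiff_pi.2 fun k => ((G.contDiff_z k).norm_sq ℝ).sub contDiff_const

theorem contDiff_overall (y : Config n) :
    ContDiff ℝ ∞ fun q : Config n × (Fin m → ℝ) => G.overall y q.2 q.1 := by
  refine contDiff_pi.2 fun i => ?_
  simp only [overall_eq]
  refine ContDiff.sum fun k _ => ?_
  have hz : ContDiff ℝ ∞ fun q : Config n × (Fin m → ℝ) => G.z q.1 k :=
    (G.contDiff_z k).comp contDiff_fst
  refine ContDiff.fun_smul ?_ hz
  refine ContDiff.add (ContDiff.neg (contDiff_const.mul ?_)) (contDiff_const.mul ?_)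
  · exact (contDiff_pi.1 (G.contDiff_err y) k).comp contDiff_fst
  · exact (contDiff_apply ℝ ℝ k).comp contDiff_snd

theorem hasFDerivAt_err_apply (y x : Config n) (k : Fin m) :
    HasFDerivAt (fun x => G.err y x k) ((2 : ℝ) • (innerSL ℝ (G.z x k)).comp (G.zL k)) x := by
  have h1 : HasFDerivAt (fun x : Config n => G.z x k) (G.zL k) x := (G.zL k).hasFDerivAt
  refine (h1.norm_sq.sub_const _).congr_fderiv ?_
  ext v
  simp

theorem hasFDerivAt_err (y x : Config n) :
    HasFDerivAt (G.err y) ((2 : ℝ) • G.rigidity x) x := by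
  rw [hasFDerivAt_pi']
  exact fun k => G.hasFDerivAt_err_apply y x k

theorem hasFDerivAt_redErr (y : Config n) (E : Finset (Fin m)) (x : Config n) :
    HasFDerivAt (G.redErr y E) ((2 : ℝ) • G.redRigidity E x) x := by
  rw [hasFDerivAt_pi']
  exact fun k => G.hasFDerivAt_err_apply y x k

/-- Multi-points as vectors with real entries. -/
def flat : Config n ≃ₗ[ℝ] (Fin n × Fin 2 → ℝ) where
  toFun v p := v p.1 p.2
  map_add' _ _ := rfl
  map_smul' _ _ := rfl
  invFun f i := WithLp.toLp 2 fun a => f (i, a)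
  left_inv _ := rfl
  right_inv _ := rfl

theorem flat_apply (v : Config n) (p : Fin n × Fin 2) : flat v p = v p.1 p.2 := rfl

theorem R_mulVec_flat (x v : Config n) : (G.R x).mulVec (flat v) = G.rigidity x v := by
  funext k
  simp only [Matrix.mulVec, dotProduct, R, Matrix.of_apply, flat_apply, rigidity_apply,
    Fintype.sum_prod_type, H_eq]
  rw [Finset.sum_comm, PiLp.inner_apply]
  refine Finset.sum_congr rfl fun a _ => ?_
  simp only [mul_sub, sub_mul, mul_ite, ite_mul, mul_one, mul_zero, zero_mul,
    Finset.sum_sub_distrib, Finset.sum_ite_eq', Finset.mem_univ, if_true]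
  simp [z]
  ring

theorem Rred_mulVec_flat (E : Finset (Fin m)) (x v : Config n) :
    (G.Rred E x).mulVec (flat v) = G.redRigidity E x v := by
  funext k
  exact congrFun (G.R_mulVec_flat x v) k

theorem rank_R (x : Config n) :
    (G.R x).rank = Module.finrank ℝ (LinearMap.range (G.rigidity x).toLinearMap) := by
  have h : (G.rigidity x).toLinearMap =
      (G.R x).mulVecLin ∘ₗ (flat : Config n ≃ₗ[ℝ] _).toLinearMap :=
    LinearMap.ext fun v => (G.R_mulVec_flat x v).symm
  rw [h, LinearMap.range_comp_of_range_eq_top _ (LinearEquiv.range _)]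
  rfl

theorem rank_Rred (E : Finset (Fin m)) (x : Config n) :
    (G.Rred E x).rank =
      Module.finrank ℝ (LinearMap.range (G.redRigidity E x).toLinearMap) := by
  have h : (G.redRigidity E x).toLinearMap =
      (G.Rred E x).mulVecLin ∘ₗ (flat : Config n ≃ₗ[ℝ] _).toLinearMap :=
    LinearMap.ext fun v => (G.Rred_mulVec_flat E x v).symm
  rw [h, LinearMap.range_comp_of_range_eq_top _ (LinearEquiv.range _)]
  rfl

theorem rank_Rred_eq_span (E : Finset (Fin m)) (x : Config n) :
    (G.Rred E x).rank = Module.finrank ℝ (Submodule.span ℝ ((G.R x).row '' (E : Set (Fin m)))) := by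
  have h : Set.range (G.Rred E x).row = (G.R x).row '' (E : Set (Fin m)) := by
    ext r
    constructor
    · rintro ⟨k, rfl⟩
      exact ⟨k, k.2, rfl⟩
    · rintro ⟨k, hk, rfl⟩
      exact ⟨⟨k, hk⟩, rfl⟩
  rw [Matrix.rank_eq_finrank_span_row, h]

/-- Minimal infinitesimal rigidity means independence of the right number of rows. -/
theorem minInfRigidOn_iff {E : Finset (Fin m)} {x : Config n} :
    G.MinInfRigidOn E x ↔ E.card = 2 * n - 3 ∧ Function.Surjective (G.redRigidity E x) := by
  have hsurj : Function.Surjective (G.redRigidity E x) ↔ (G.Rred E x).rank = E.card := by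
    rw [rank_Rred]
    change Function.Surjective (G.redRigidity E x).toLinearMap ↔ _
    rw [← LinearMap.range_eq_top]
    constructor
    · intro h
      rw [h, finrank_top]
      simp
    · intro h
      apply Submodule.eq_top_of_finrank_eq
      rw [h]
      simp
  rw [hsurj]
  constructor
  · rintro ⟨h1, h2⟩
    -- A row in the span of the others could be removed without changing the rank, against
    -- minimality.
    have hind : LinearIndepOn ℝ (G.R x).row (E : Set (Fin m)) := by
      rw [linearIndepOn_iff_notMem_span]
      intro k hk hmem
      refine h2 k hk ?_
      have hspan : Submodule.span ℝ ((G.R x).row '' ((E.erase k : Finset (Fin m)) : Set (Fin m))) =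
          Submodule.span ℝ ((G.R x).row '' (E : Set (Fin m))) := by
        rw [Finset.coe_erase]
        apply le_antisymm
        · exact Submodule.span_mono (image_mono sdiff_subset)
        · apply Submodule.span_le.2
          rintro _ ⟨l, hl, rfl⟩
          by_cases hlk : l = k
          · rw [hlk]
            exact hmem
          · exact Submodule.subset_span ⟨l, ⟨hl, hlk⟩, rfl⟩
      rw [InfRigidOn, rank_Rred_eq_span, hspan, ← rank_Rred_eq_span]
      exact h1
    have hind' : LinearIndependent ℝ (G.Rred E x).row := hind
    have := hind'.rank_matrix
    rw [Fintype.card_coe] at this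
    exact ⟨this ▸ h1, this⟩
  · rintro ⟨h1, h2⟩
    -- After removing an edge there are too few rows left for the rank $2n-3$.
    refine ⟨h2.trans h1, fun k hk h => ?_⟩
    have h3 := (G.Rred (E.erase k) x).rank_le_card_height
    rw [Fintype.card_coe, Finset.card_erase_of_mem hk] at h3
    rw [InfRigidOn] at h
    have := Finset.card_pos.2 ⟨k, hk⟩
    omega

/-- Turning velocities back by the same angle preserves their inner products with the edge vectors,
so surjectivity is carried over. -/
theorem MinInfRigidOn.rigidMotion {E : Finset (Fin m)} {x : Config n} {θ : ℝ} {b : Plane}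
    (h : G.MinInfRigidOn E (rigidMotion θ b x)) : G.MinInfRigidOn E x := by
  rw [minInfRigidOn_iff] at h ⊢
  refine ⟨h.1, fun ε => ?_⟩
  obtain ⟨v, rfl⟩ := h.2 ε
  refine ⟨fun i => toC.symm (Complex.exp (-(θ * Complex.I)) * toC (v i)), ?_⟩
  funext k
  rw [redRigidity_apply, redRigidity_apply, inner_eq_re, inner_eq_re, toC_z_rigidMotion, G.toC_z v,
    G.toC_z fun i => toC.symm (Complex.exp (-(θ * Complex.I)) * toC (v i))]
  simp only [LinearIsometryEquiv.apply_symm_apply, map_mul, ← Complex.exp_conj, Complex.conj_I,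
    Complex.conj_ofReal]
  congr 1
  rw [mul_neg]
  ring

/-- The infinitesimal rigid motions of a multi-point. -/
def infMotion (x : Config n) : (ℂ × ℝ) →ₗ[ℝ] Config n where
  toFun q i := toC.symm (q.1 + q.2 * Complex.I * toC (x i))
  map_add' q r := by
    funext i
    rw [Pi.add_apply, ← map_add]
    congr 1
    simp only [Prod.fst_add, Prod.snd_add, Complex.ofReal_add]
    ring
  map_smul' c q := by
    funext i
    rw [Pi.smul_apply, ← map_smul]
    congr 1
    simp only [Prod.smul_fst, Prod.smul_snd, smul_eq_mul, Complex.ofReal_mul, RingHom.id_apply,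
      Complex.real_smul]
    ring

theorem toC_infMotion (x : Config n) (q : ℂ × ℝ) (i : Fin n) :
    toC (infMotion x q i) = q.1 + q.2 * Complex.I * toC (x i) :=
  toC.apply_symm_apply _

theorem rigidity_infMotion (x : Config n) (q : ℂ × ℝ) : G.rigidity x (infMotion x q) = 0 := by
  funext k
  rw [rigidity_apply, inner_eq_re, G.toC_z (infMotion x q), toC_infMotion, toC_infMotion]
  have h : conj (toC (G.z x k)) * (q.1 + q.2 * Complex.I * toC (x (G.head k)) -
      (q.1 + q.2 * Complex.I * toC (x (G.tail k)))) =
      q.2 * (Complex.I * (toC (G.z x k) * conj (toC (G.z x k)))) := by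
    rw [toC_z]
    ring
  rw [h, Complex.mul_conj, Complex.re_ofReal_mul, Complex.I_mul_re, Complex.ofReal_im]
  simp

theorem redRigidity_infMotion (E : Finset (Fin m)) (x : Config n) (q : ℂ × ℝ) :
    G.redRigidity E x (infMotion x q) = 0 := by
  funext k
  exact congrFun (G.rigidity_infMotion x q) k

theorem z_ne_zero_of_surjective {E : Finset (Fin m)} {x : Config n}
    (h : Function.Surjective (G.redRigidity E x)) {k : Fin m} (hk : k ∈ E) : G.z x k ≠ 0 := by
  intro h0
  obtain ⟨v, hv⟩ := h (fun _ => 1)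
  have := congrFun hv ⟨k, hk⟩
  rw [redRigidity_apply, h0, inner_zero_left] at this
  exact zero_ne_one this

theorem infMotion_injective {x : Config n} {i j : Fin n} (h : x i ≠ x j) :
    Function.Injective (infMotion x) := by
  rw [← LinearMap.ker_eq_bot, LinearMap.ker_eq_bot']
  rintro ⟨β, s⟩ hq
  have hi := toC_infMotion x (β, s) i
  have hj := toC_infMotion x (β, s) j
  rw [hq] at hi hj
  simp only [Pi.zero_apply, map_zero] at hi hj
  have h1 : (s : ℂ) * Complex.I * (toC (x i) - toC (x j)) = 0 := by linear_combination hj - hi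
  have h2 : toC (x i) - toC (x j) ≠ 0 := sub_ne_zero.2 fun h' => h (toC.injective h')
  have h3 : (s : ℂ) = 0 := by simpa [h2] using h1
  rw [h3] at hi
  have h4 : β = 0 := by simpa using hi.symm
  rw [h4, Complex.ofReal_eq_zero.1 h3]
  rfl

theorem MinInfRigidOn.nonempty (hn : 3 ≤ n) {E : Finset (Fin m)} {x : Config n}
    (h : G.MinInfRigidOn E x) : E.Nonempty := by
  rw [← Finset.card_pos, (G.minInfRigidOn_iff.1 h).1]
  omega

theorem finrank_config : Module.finrank ℝ (Config n) = 2 * n := by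
  rw [LinearEquiv.finrank_eq flat]
  simp [mul_comm]

theorem finrank_infMotion_range {x : Config n} {i j : Fin n} (h : x i ≠ x j) :
    Module.finrank ℝ (LinearMap.range (infMotion x)) = 3 := by
  rw [LinearMap.finrank_range_of_inj (infMotion_injective h)]
  simp [Module.finrank_prod]

/-- The kernel of the reduced rigidity matrix consists of the infinitesimal rigid motions. -/
theorem MinInfRigidOn.exists_infMotion (hn : 3 ≤ n) {E : Finset (Fin m)} {x : Config n}
    (h : G.MinInfRigidOn E x) {v : Config n} (hv : G.redRigidity E x v = 0) :
    ∃ (β : ℂ) (s : ℝ), ∀ i, toC (v i) = β + s * Complex.I * toC (x i) := by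
  obtain ⟨k, hk⟩ := MinInfRigidOn.nonempty G hn h
  obtain ⟨hcard, hsurj⟩ := G.minInfRigidOn_iff.1 h
  have hz := sub_ne_zero.1 (G.z_ne_zero_of_surjective hsurj hk)
  have hle : LinearMap.range (infMotion x) ≤
      LinearMap.ker (G.redRigidity E x).toLinearMap := by
    rintro _ ⟨q, rfl⟩
    exact G.redRigidity_infMotion E x q
  have hrn := LinearMap.finrank_range_add_finrank_ker (G.redRigidity E x).toLinearMap
  rw [LinearMap.range_eq_top.2 hsurj, finrank_top, finrank_config] at hrn
  simp only [Module.finrank_fintype_fun_eq_card, Fintype.card_coe, hcard] at hrn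
  -- The kernel has dimension $2n-(2n-3)=3$, which is already the dimension of the space of
  -- infinitesimal rigid motions inside it.
  have heq := Submodule.eq_of_le_of_finrank_eq hle
    ((finrank_infMotion_range hz).trans (by omega))
  have hmem : v ∈ LinearMap.range (infMotion x) := by
    rw [heq]
    exact hv
  obtain ⟨q, rfl⟩ := hmem
  exact ⟨q.1, q.2, toC_infMotion x q⟩

/-- The rank is at least that of the submatrix, and at most $2n-3$ because the three-dimensional
space of infinitesimal rigid motions lies in the kernel. -/
theorem MinInfRigidOn.infRigid (hn : 3 ≤ n) {E : Finset (Fin m)} {x : Config n}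
    (h : G.MinInfRigidOn E x) : G.InfRigid x := by
  obtain ⟨k, hk⟩ := MinInfRigidOn.nonempty G hn h
  obtain ⟨hcard, hsurj⟩ := G.minInfRigidOn_iff.1 h
  have hz := sub_ne_zero.1 (G.z_ne_zero_of_surjective hsurj hk)
  have hle : LinearMap.range (infMotion x) ≤
      LinearMap.ker (G.rigidity x).toLinearMap := by
    rintro _ ⟨q, rfl⟩
    exact G.rigidity_infMotion x q
  have h1 := Submodule.finrank_mono hle
  rw [finrank_infMotion_range hz] at h1
  have hrn := LinearMap.finrank_range_add_finrank_ker (G.rigidity x).toLinearMap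
  rw [finrank_config, ← rank_R] at hrn
  have h2 : (G.Rred E x).rank ≤ (G.R x).rank := Matrix.rank_submatrix_le _ _ _
  have h3 : (G.Rred E x).rank = 2 * n - 3 := h.1
  rw [InfRigid]
  omega

end OrientedGraph

end Formation

/-! ### Descent of rigid invariants to functions of the reduced error. -/

namespace Formation

open Set Filter Topology Metric
open scoped ComplexConjugate

namespace OrientedGraph

variable {n m : ℕ} (G : OrientedGraph n m)

/-- Where the rows of the reduced rigidity matrix are independent, the reduced error has a smooth
local section. -/
theorem exists_local_section (y : Config n) {E : Finset (Fin m)} {x : Config n}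
    (hs : Function.Surjective (G.redRigidity E x)) :
    ∃ σ : (E → ℝ) → Config n, σ (G.redErr y E x) = x ∧ ContDiffAt ℝ ∞ σ (G.redErr y E x) ∧
      ∀ᶠ ε in 𝓝 (G.redErr y E x), G.redErr y E (σ ε) = ε := by
  obtain ⟨T, hT⟩ := (G.redRigidity E x).toLinearMap.exists_rightInverse_of_surjective
    (LinearMap.range_eq_top.2 hs)
  -- The factor `1 / 2` compensates for the derivative of a squared length being twice the row of
  -- the rigidity matrix; `f` below then has the identity as its derivative at the origin.
  let T' : (E → ℝ) →L[ℝ] Config n := LinearMap.toContinuousLinearMap ((1 / 2 : ℝ) • T)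
  have hT' : ((2 : ℝ) • G.redRigidity E x).comp T' = ContinuousLinearMap.id ℝ (E → ℝ) := by
    ext1 ε
    have h1 := LinearMap.congr_fun hT ε
    change (2 : ℝ) • G.redRigidity E x ((1 / 2 : ℝ) • T ε) = ε
    rw [map_smul, smul_smul]
    norm_num
    exact h1
  let f : (E → ℝ) → (E → ℝ) := fun ε => G.redErr y E (x + T' ε)
  have hf : ContDiff ℝ ∞ f :=
    (G.contDiff_redErr y E).comp (contDiff_const.add T'.contDiff)
  have hf0 : f 0 = G.redErr y E x := by simp [f]
  have hfd : HasFDerivAt f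
      ((ContinuousLinearEquiv.refl ℝ (E → ℝ) : (E → ℝ) ≃L[ℝ] (E → ℝ)) : (E → ℝ) →L[ℝ] (E → ℝ))
      0 := by
    have h1 : HasFDerivAt (fun ε => x + T' ε) T' 0 := T'.hasFDerivAt.const_add x
    have h2 : HasFDerivAt (G.redErr y E) ((2 : ℝ) • G.redRigidity E x) (x + T' 0) := by
      rw [map_zero, add_zero]
      exact G.hasFDerivAt_redErr y E x
    exact (h2.comp 0 h1).congr_fderiv hT'
  have hn : (∞ : WithTop ℕ∞) ≠ 0 := by simp
  have hcd : ContDiffAt ℝ ∞ f 0 := hf.contDiffAt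
  refine ⟨fun ε => x + T' (hcd.localInverse hfd hn ε), ?_, ?_, ?_⟩
  · rw [← hf0]
    simp [ContDiffAt.localInverse_apply_image]
  · rw [← hf0]
    exact contDiffAt_const.add (T'.contDiff.contDiffAt.comp _ (hcd.to_localInverse hfd hn))
  · rw [← hf0]
    exact (hcd.hasStrictFDerivAt' hfd hn).eventually_right_inverse

/-- The properties of ambient sets from which the smoothness of the rigid invariants follows. -/
structure IsPreAmbient (y : Config n) (E : Finset (Fin m)) (A : Set (Config n)) : Prop where
  isOpen : IsOpen A
  surjective : ∀ x ∈ A, Function.Surjective (G.redRigidity E x)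
  orbit : ∀ x ∈ A, ∀ x' ∈ A, G.redErr y E x = G.redErr y E x' →
    ∃ (θ : ℝ) (b : Plane), x' = rigidMotion θ b x

variable {G} {y : Config n} {E : Finset (Fin m)} {A : Set (Config n)}

theorem IsAmbient.isPreAmbient (h : G.IsAmbient y E A) : G.IsPreAmbient y E A :=
  ⟨h.isOpen, fun x hx => (G.minInfRigidOn_iff.1 (h.rigid x hx)).2, h.orbit⟩

theorem lift_mem {ε : E → ℝ} (hε : ε ∈ G.redErr y E '' A) : G.lift y E A ε ∈ A :=
  Function.invFunOn_mem hε

theorem redErr_lift {ε : E → ℝ} (hε : ε ∈ G.redErr y E '' A) :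
    G.redErr y E (G.lift y E A ε) = ε :=
  Function.invFunOn_eq hε

namespace IsPreAmbient

theorem exists_section (hA : G.IsPreAmbient y E A) {x : Config n} (hx : x ∈ A) :
    ∃ σ : (E → ℝ) → Config n, σ (G.redErr y E x) = x ∧ ContDiffAt ℝ ∞ σ (G.redErr y E x) ∧
      ∀ᶠ ε in 𝓝 (G.redErr y E x), σ ε ∈ A ∧ G.redErr y E (σ ε) = ε := by
  obtain ⟨σ, h1, h2, h3⟩ := G.exists_local_section y (hA.surjective x hx)
  refine ⟨σ, h1, h2, ?_⟩
  have h4 : ∀ᶠ ε in 𝓝 (G.redErr y E x), σ ε ∈ A :=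
    h2.continuousAt.eventually_mem (by rw [h1]; exact hA.isOpen.mem_nhds hx)
  exact h4.and h3

theorem isOpen_image (hA : G.IsPreAmbient y E A) : IsOpen (G.redErr y E '' A) := by
  rw [isOpen_iff_mem_nhds]
  rintro _ ⟨x, hx, rfl⟩
  obtain ⟨σ, -, -, h⟩ := hA.exists_section hx
  exact h.mono fun ε hε => ⟨σ ε, hε⟩

theorem exists_lift_eq (hA : G.IsPreAmbient y E A) {x : Config n} (hx : x ∈ A) :
    ∃ (θ : ℝ) (b : Plane), G.lift y E A (G.redErr y E x) = rigidMotion θ b x :=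
  hA.orbit x hx _ (lift_mem ⟨x, hx, rfl⟩) (redErr_lift ⟨x, hx, rfl⟩).symm

theorem err_lift (hA : G.IsPreAmbient y E A) {x : Config n} (hx : x ∈ A) :
    G.err y (G.lift y E A (G.redErr y E x)) = G.err y x := by
  obtain ⟨θ, b, h⟩ := hA.exists_lift_eq hx
  rw [h, err_rigidMotion]

/-- Smooth functions that are constant on the fibers of the reduced error descend to smooth
functions of the reduced error. -/
theorem contDiffAt_comp_lift_param (hA : G.IsPreAmbient y E A) {P W : Type*}
    [NormedAddCommGroup P] [NormedSpace ℝ P] [NormedAddCommGroup W] [NormedSpace ℝ W]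
    {φ : Config n × P → W}
    (hφ : ∀ x ∈ A, ∀ p, ContDiffAt ℝ ∞ φ (x, p))
    (hinv : ∀ x ∈ A, ∀ x' ∈ A, G.redErr y E x = G.redErr y E x' → ∀ p, φ (x, p) = φ (x', p))
    {ε : E → ℝ} (hε : ε ∈ G.redErr y E '' A) (p : P) :
    ContDiffAt ℝ ∞ (fun q : (E → ℝ) × P => φ (G.lift y E A q.1, q.2)) (ε, p) := by
  obtain ⟨x, hx, rfl⟩ := hε
  obtain ⟨σ, h1, h2, h3⟩ := hA.exists_section hx
  have h4 : ContDiffAt ℝ ∞ (fun q : (E → ℝ) × P => φ (σ q.1, q.2)) (G.redErr y E x, p) := by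
    have h5 : ContDiffAt ℝ ∞ (fun q : (E → ℝ) × P => (σ q.1, q.2)) (G.redErr y E x, p) :=
      (ContDiffAt.comp (G.redErr y E x, p) (f := Prod.fst) h2 contDiffAt_fst).prodMk contDiffAt_snd
    refine ContDiffAt.comp (G.redErr y E x, p) (g := φ) ?_ h5
    rw [h1]
    exact hφ x hx p
  -- `lift` is an arbitrary choice and need not be continuous. As `φ` is constant on the fibers, the
  -- smooth section gives the same values.
  refine h4.congr_of_eventuallyEq ?_
  have h6 : ∀ᶠ q : (E → ℝ) × P in 𝓝 (G.redErr y E x, p),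
      σ q.1 ∈ A ∧ G.redErr y E (σ q.1) = q.1 :=
    continuousAt_fst.eventually (p := fun ε => σ ε ∈ A ∧ G.redErr y E (σ ε) = ε) h3
  filter_upwards [h6] with q hq
  have hmem : q.1 ∈ G.redErr y E '' A := ⟨_, hq⟩
  exact hinv _ (lift_mem hmem) _ hq.1 ((redErr_lift hmem).trans hq.2.symm) _

theorem contDiffAt_comp_lift (hA : G.IsPreAmbient y E A) {W : Type*}
    [NormedAddCommGroup W] [NormedSpace ℝ W] {φ : Config n → W} (hφ : ∀ x ∈ A, ContDiffAt ℝ ∞ φ x)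
    (hinv : ∀ x ∈ A, ∀ x' ∈ A, G.redErr y E x = G.redErr y E x' → φ x = φ x')
    {ε : E → ℝ} (hε : ε ∈ G.redErr y E '' A) :
    ContDiffAt ℝ ∞ (fun ε => φ (G.lift y E A ε)) ε := by
  have h1 := hA.contDiffAt_comp_lift_param (P := ℝ) (φ := fun q => φ q.1)
    (fun x hx p => (hφ x hx).comp (x, p) contDiffAt_fst)
    (fun x hx x' hx' h _ => hinv x hx x' hx' h) hε 0
  exact ContDiffAt.comp ε (f := fun ε => (ε, (0 : ℝ))) h1
    (contDiffAt_id.prodMk contDiffAt_const)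

theorem comp_lift_eq {W : Type*} {φ : Config n → W}
    (hinv : ∀ x ∈ A, ∀ x' ∈ A, G.redErr y E x = G.redErr y E x' → φ x = φ x')
    {x : Config n} (hx : x ∈ A) : φ (G.lift y E A (G.redErr y E x)) = φ x :=
  hinv _ (lift_mem ⟨x, hx, rfl⟩) _ hx (redErr_lift ⟨x, hx, rfl⟩)

theorem err_eq_of_redErr_eq (hA : G.IsPreAmbient y E A) :
    ∀ x ∈ A, ∀ x' ∈ A, G.redErr y E x = G.redErr y E x' → G.err y x = G.err y x' := by
  intro x hx x' hx' h
  obtain ⟨θ, b, rfl⟩ := hA.orbit x hx x' hx' h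
  rw [err_rigidMotion]

theorem output_redErr (hA : G.IsPreAmbient y E A) {x : Config n} (hx : x ∈ A) :
    G.output y E A (G.redErr y E x) = G.err y x := by
  funext k
  unfold output
  split_ifs with hk
  · rfl
  · exact congrFun (hA.err_lift hx) k

theorem output_eq (hA : G.IsPreAmbient y E A) {ε : E → ℝ} (hε : ε ∈ G.redErr y E '' A) :
    G.output y E A ε = G.err y (G.lift y E A ε) := by
  obtain ⟨x, hx, rfl⟩ := hε
  rw [hA.output_redErr hx, hA.err_lift hx]

/-- The derivative of a descended function along the derivative of the reduced error. -/
theorem fderiv_comp_lift (hA : G.IsPreAmbient y E A) {W : Type*}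
    [NormedAddCommGroup W] [NormedSpace ℝ W] {φ : Config n → W} (hφ : ∀ x ∈ A, ContDiffAt ℝ ∞ φ x)
    (hinv : ∀ x ∈ A, ∀ x' ∈ A, G.redErr y E x = G.redErr y E x' → φ x = φ x')
    {x : Config n} (hx : x ∈ A) {φ' : Config n →L[ℝ] W} (hd : HasFDerivAt φ φ' x) (v : Config n) :
    fderiv ℝ (fun ε => φ (G.lift y E A ε)) (G.redErr y E x) ((2 : ℝ) • G.redRigidity E x v) =
      φ' v := by
  have h1 := ((hA.contDiffAt_comp_lift hφ hinv ⟨x, hx, rfl⟩).differentiableAt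
    (by simp)).hasFDerivAt.comp x (G.hasFDerivAt_redErr y E x)
  have h2 : φ =ᶠ[𝓝 x] (fun ε => φ (G.lift y E A ε)) ∘ G.redErr y E :=
    mem_of_superset (hA.isOpen.mem_nhds hx) fun x' hx' => (comp_lift_eq hinv hx').symm
  have h3 := (h1.congr_of_eventuallyEq h2).unique hd
  rw [← h3]
  rfl

/-- This is the chain rule for $\psi(\tilde e(x))=\hat e(x)$, in the form $F\cdot2\tilde R=2\hat R$,
tested on one coordinate velocity at a time. -/
theorem F_mul_Rred (hA : G.IsPreAmbient y E A) {x : Config n} (hx : x ∈ A)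
    (k : {k : Fin m // k ∉ E}) (p : Fin n × Fin 2) :
    (G.F y E A (G.redErr y E x) * G.Rred E x) k p = G.R x k p := by
  have hcol : ∀ l, G.R x l p = G.rigidity x (flat.symm (Pi.single p 1)) l := by
    intro l
    rw [← R_mulVec_flat, LinearEquiv.apply_symm_apply, Matrix.mulVec_single_one]
    rfl
  have hd : HasFDerivAt (fun x (k : {k : Fin m // k ∉ E}) => G.err y x k)
      (ContinuousLinearMap.pi fun k : {k : Fin m // k ∉ E} =>
        (2 : ℝ) • (innerSL ℝ (G.z x k)).comp (G.zL k)) x := by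
    rw [hasFDerivAt_pi']
    exact fun k => G.hasFDerivAt_err_apply y x k
  have h1 := hA.fderiv_comp_lift (φ := fun x (k : {k : Fin m // k ∉ E}) => G.err y x k)
    (fun _ _ => contDiffAt_pi.2 fun k => (contDiff_pi.1 (G.contDiff_err y) k).contDiffAt)
    (fun x hx x' hx' h => by
      funext k
      exact congrFun (hA.err_eq_of_redErr_eq x hx x' hx' h) k) hx hd (flat.symm (Pi.single p 1))
  change fderiv ℝ (G.psi y E A) _ _ = _ at h1
  have h2 : (fun l : E => G.Rred E x l p) = G.redRigidity E x (flat.symm (Pi.single p 1)) := by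
    funext l
    exact hcol l
  have h3 : (G.F y E A (G.redErr y E x) * G.Rred E x) k p =
      (G.F y E A (G.redErr y E x)).mulVec (fun l : E => G.Rred E x l p) k := rfl
  rw [h3, h2, F, LinearMap.toMatrix'_mulVec]
  rw [map_smul] at h1
  have h4 := congrFun h1 k
  have h5 : (2 : ℝ) * fderiv ℝ (G.psi y E A) (G.redErr y E x)
      (G.redRigidity E x (flat.symm (Pi.single p 1))) k =
      2 * G.rigidity x (flat.symm (Pi.single p 1)) k := h4
  rw [hcol]
  exact mul_left_cancel₀ two_ne_zero h5

/-- The error system is the reduced error system of the overall system. -/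
theorem errSys_lift (hA : G.IsPreAmbient y E A) {ε : E → ℝ} (hε : ε ∈ G.redErr y E '' A)
    (μ : Fin m → ℝ) :
    G.errSys y E A μ ε =
      (2 : ℝ) • G.redRigidity E (G.lift y E A ε) (G.overall y μ (G.lift y E A ε)) := by
  have hx := lift_mem hε
  set x := G.lift y E A ε with hxdef
  have hxε : G.redErr y E x = ε := redErr_lift hε
  have hF := fun k p => hA.F_mul_Rred hx k p
  rw [hxε] at hF
  -- Splitting the edges gives $R'e=\tilde R'\epsilon+\hat R'\psi$, and $\hat R=F\tilde R$ turns the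
  -- second term into $\tilde R'F'\psi$, the form in which it enters the error system.
  have hsplit : (G.R x).transpose.mulVec (G.err y x) =
      (G.Rred E x).transpose.mulVec ε +
        (G.Rred E x).transpose.mulVec ((G.F y E A ε).transpose.mulVec (G.psi y E A ε)) := by
    funext p
    rw [Matrix.mulVec_mulVec, ← Matrix.transpose_mul]
    simp only [Pi.add_apply, Matrix.mulVec, dotProduct, Matrix.transpose_apply, hF]
    rw [← Fintype.sum_subtype_add_sum_subtype (fun k => k ∈ E)]
    congr 1
    refine Finset.sum_congr (by ext; simp) fun k _ => ?_
    rw [← hxε]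
    rfl
  have hover : flat (G.overall y μ x) =
      -((G.R x).transpose.mulVec (G.err y x)) + (G.S x).transpose.mulVec μ := rfl
  rw [← Rred_mulVec_flat, hover, hsplit]
  simp only [errSys, ← hxdef, Matrix.mulVec_add, Matrix.mulVec_neg, ← Matrix.mulVec_mulVec]
  module

end IsPreAmbient

end OrientedGraph

end Formation

/-! ### Existence of ambient sets. -/

namespace Formation

open Set Filter Topology Metric
open scoped ComplexConjugate

/-- Invertibility of the derivative of a smooth function is an open condition. -/
theorem eventually_exists_hasFDerivAt_equiv {V W : Type*} [NormedAddCommGroup V]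
    [NormedSpace ℝ V] [CompleteSpace V] [NormedAddCommGroup W] [NormedSpace ℝ W] {f : V → W} {a : V}
    (hf : ContDiffAt ℝ ∞ f a) {e : V ≃L[ℝ] W} (he : HasFDerivAt f (e : V →L[ℝ] W) a) :
    ∀ᶠ x in 𝓝 a, ∃ e' : V ≃L[ℝ] W, HasFDerivAt f (e' : V →L[ℝ] W) x := by
  have h1 : ContinuousAt (fderiv ℝ f) a :=
    (hf.fderiv_right (m := 0) (by simp)).continuousAt
  have h2 : ∀ᶠ x in 𝓝 a, fderiv ℝ f x ∈ range ((↑) : (V ≃L[ℝ] W) → V →L[ℝ] W) := by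
    apply h1.eventually_mem
    rw [he.fderiv]
    exact ContinuousLinearEquiv.nhds e
  have h3 : ∀ᶠ x in 𝓝 a, ContDiffAt ℝ 1 f x :=
    (hf.of_le (by simp : (1 : WithTop ℕ∞) ≤ ∞)).eventually (by simp)
  filter_upwards [h2, h3] with x hx hx'
  obtain ⟨e', he'⟩ := hx
  exact ⟨e', he' ▸ (hx'.differentiableAt (by simp)).hasFDerivAt⟩

namespace OrientedGraph

variable {n m : ℕ} (G : OrientedGraph n m)

/-- The congruent copy of `x` that agrees with `y` at the tail of the edge `k` and in the
direction of that edge. -/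
def normalize (y : Config n) (k : Fin m) (x : Config n) : Config n := fun i =>
  toC.symm (toC (y (G.tail k)) + (‖toC (G.z x k)‖ / toC (G.z x k)) *
    (toC (G.z y k) / ‖toC (G.z y k)‖) * (toC (x i) - toC (x (G.tail k))))

theorem toC_normalize (y : Config n) (k : Fin m) (x : Config n) (i : Fin n) :
    toC (G.normalize y k x i) = toC (y (G.tail k)) + (‖toC (G.z x k)‖ / toC (G.z x k)) *
      (toC (G.z y k) / ‖toC (G.z y k)‖) * (toC (x i) - toC (x (G.tail k))) :=
  toC.apply_symm_apply _

theorem toC_z_ne_zero {x : Config n} {k : Fin m} : toC (G.z x k) ≠ 0 ↔ G.z x k ≠ 0 :=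
  toC.toLinearEquiv.map_ne_zero_iff

theorem norm_div_self_mul_self_div_norm {a b : ℂ} (ha : a ≠ 0) (hb : b ≠ 0) :
    ‖(‖a‖ / a : ℂ) * (b / ‖b‖)‖ = 1 := by
  have h1 := norm_ne_zero_iff.2 ha
  have h2 := norm_ne_zero_iff.2 hb
  simp [h1, h2]

theorem exists_normalize_eq {y : Config n} {k : Fin m} {x : Config n} (hy : G.z y k ≠ 0)
    (hx : G.z x k ≠ 0) : ∃ θ b, G.normalize y k x = rigidMotion θ b x := by
  rw [← toC_z_ne_zero] at hx hy
  refine exists_eq_rigidMotion (norm_div_self_mul_self_div_norm hx hy) (b := toC (y (G.tail k)) -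
    (‖toC (G.z x k)‖ / toC (G.z x k)) * (toC (G.z y k) / ‖toC (G.z y k)‖) * toC (x (G.tail k)))
    fun i => ?_
  rw [toC_normalize]
  ring

theorem normalize_self {y : Config n} {k : Fin m} (hy : G.z y k ≠ 0) : G.normalize y k y = y := by
  rw [← toC_z_ne_zero] at hy
  refine config_ext fun i => ?_
  have h1 : (‖toC (G.z y k)‖ : ℂ) ≠ 0 := by simpa using hy
  rw [toC_normalize]
  field_simp
  ring

theorem normalize_rigidMotion {y : Config n} {k : Fin m} (x : Config n) (θ : ℝ) (b : Plane) :
    G.normalize y k (rigidMotion θ b x) = G.normalize y k x := by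
  refine config_ext fun i => ?_
  have h : Complex.exp (θ * Complex.I) ≠ 0 := Complex.exp_ne_zero _
  rw [toC_normalize, toC_normalize, toC_z_rigidMotion, norm_mul, norm_exp_mul_I, one_mul,
    toC_rigidMotion, toC_rigidMotion, add_sub_add_right_eq_sub, ← mul_sub, ← div_div]
  field_simp

theorem continuousAt_normalize (y : Config n) {k : Fin m} {x : Config n} (hx : G.z x k ≠ 0) :
    ContinuousAt (G.normalize y k) x := by
  rw [← toC_z_ne_zero] at hx
  refine continuousAt_pi.2 fun i => toC.symm.continuous.continuousAt.comp ?_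
  have hz : ContinuousAt (fun x => toC (G.z x k)) x :=
    (toC.continuous.comp (G.contDiff_z k).continuous).continuousAt
  have hp : ∀ i, ContinuousAt (fun x : Config n => toC (x i)) x := fun i =>
    (toC.continuous.comp (continuous_apply i)).continuousAt
  have hn : ContinuousAt (fun x => (‖toC (G.z x k)‖ : ℂ)) x :=
    Complex.continuous_ofReal.continuousAt.comp hz.norm
  exact continuousAt_const.add (((hn.div hz hx).mul continuousAt_const).mul ((hp i).sub (hp _)))

/-- The data fixed by `normalize`, as a linear map. -/
def gauge (y : Config n) (k : Fin m) : Config n →L[ℝ] ℂ × ℝ :=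
  ((toC.toContinuousLinearEquiv : Plane →L[ℝ] ℂ).comp
    (ContinuousLinearMap.proj (R := ℝ) (φ := fun _ : Fin n => Plane) (G.tail k))).prod
  (Complex.imCLM.comp ((ContinuousLinearMap.mul ℝ ℂ (conj (toC (G.z y k)))).comp
    ((toC.toContinuousLinearEquiv : Plane →L[ℝ] ℂ).comp (G.zL k))))

theorem gauge_apply (y : Config n) (k : Fin m) (x : Config n) : G.gauge y k x =
    (toC (x (G.tail k)), (conj (toC (G.z y k)) * toC (G.z x k)).im) := rfl

/-- After normalization the edge `k` is a positive multiple of the same edge of `y`, so the product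
with the conjugate is real. -/
theorem gauge_normalize {y : Config n} {k : Fin m} {x : Config n} (hx : G.z x k ≠ 0) :
    G.gauge y k (G.normalize y k x) = (toC (y (G.tail k)), 0) := by
  rw [← toC_z_ne_zero] at hx
  rw [gauge_apply, G.toC_z (G.normalize y k x), toC_normalize, toC_normalize, sub_self, mul_zero,
    add_zero, add_sub_cancel_left, ← G.toC_z x]
  congr 1
  have h : conj (toC (G.z y k)) * (‖toC (G.z x k)‖ / toC (G.z x k) *
      (toC (G.z y k) / ‖toC (G.z y k)‖) * toC (G.z x k)) =
      ((‖toC (G.z x k)‖ / ‖toC (G.z y k)‖ : ℝ) : ℂ) *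
        (toC (G.z y k) * conj (toC (G.z y k))) := by
    push_cast
    field_simp
  rw [h, Complex.mul_conj, ← Complex.ofReal_mul, Complex.ofReal_im]

/-- The reduced error and the gauge are local coordinates. -/
theorem exists_equiv_hasFDerivAt (hn : 3 ≤ n) {y : Config n} {E : Finset (Fin m)}
    (hE : G.MinInfRigidOn E y) {k : Fin m} (hk : G.z y k ≠ 0) :
    ∃ e : Config n ≃L[ℝ] (E → ℝ) × (ℂ × ℝ),
      HasFDerivAt (fun x => (G.redErr y E x, G.gauge y k x))
        (e : Config n →L[ℝ] (E → ℝ) × (ℂ × ℝ)) y := by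
  set D : Config n →L[ℝ] (E → ℝ) × (ℂ × ℝ) :=
    ((2 : ℝ) • G.redRigidity E y).prod (G.gauge y k) with hD
  have hd : HasFDerivAt (fun x => (G.redErr y E x, G.gauge y k x)) D y :=
    (G.hasFDerivAt_redErr y E y).prodMk (G.gauge y k).hasFDerivAt
  -- A velocity that keeps the reduced error is an infinitesimal rigid motion. The imaginary part in
  -- the gauge detects its angular speed, and then the position of the tail detects its translation.
  have hinj : LinearMap.ker D.toLinearMap = ⊥ := by
    rw [LinearMap.ker_eq_bot']
    intro v hv
    have h1 : (2 : ℝ) • G.redRigidity E y v = 0 := congrArg Prod.fst hv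
    have h2 : G.gauge y k v = 0 := congrArg Prod.snd hv
    obtain ⟨β, s, hs⟩ := MinInfRigidOn.exists_infMotion G hn hE
      ((smul_eq_zero.1 h1).resolve_left two_ne_zero)
    rw [gauge_apply, Prod.mk_eq_zero, toC_z G v, hs, hs] at h2
    have h3 : conj (toC (G.z y k)) * (β + s * Complex.I * toC (y (G.head k)) -
        (β + s * Complex.I * toC (y (G.tail k)))) =
        s * (Complex.I * (toC (G.z y k) * conj (toC (G.z y k)))) := by
      rw [toC_z]
      ring
    have h4 := h2.2
    rw [h3, Complex.mul_conj, Complex.im_ofReal_mul, Complex.I_mul_im, Complex.ofReal_re] at h4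
    have h5 : Complex.normSq (toC (G.z y k)) ≠ 0 := by
      rw [Ne, Complex.normSq_eq_zero]
      exact (G.toC_z_ne_zero).2 hk
    have h6 : s = 0 := (mul_eq_zero.1 h4).resolve_right h5
    have h7 := h2.1
    rw [h6] at h7 hs
    simp only [Complex.ofReal_zero, zero_mul, add_zero] at h7 hs
    refine config_ext fun i => ?_
    rw [hs, h7, Pi.zero_apply, map_zero]
  have hfin : Module.finrank ℝ (Config n) = Module.finrank ℝ ((E → ℝ) × (ℂ × ℝ)) := by
    rw [finrank_config]
    simp only [Module.finrank_prod, Module.finrank_fintype_fun_eq_card, Fintype.card_coe,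
      (G.minInfRigidOn_iff.1 hE).1, Complex.finrank_real_complex, Module.finrank_self]
    omega
  let e := (LinearEquiv.ofInjectiveOfFinrankEq D.toLinearMap
    (LinearMap.ker_eq_bot.1 hinj) hfin).toContinuousLinearEquiv
  exact ⟨e, hd⟩

/-- Reduced error and gauge are injective coordinates on a small neighborhood `U` of `y`. Take all
`x` whose normalized copy lies in `U`; this is a rigidly invariant set. If two of its members have
the same reduced error, their normalized copies have the same coordinates and coincide, so the two
are congruent. Inner products are rigid invariants and hence descend smoothly. -/
theorem exists_isAmbient (hn : 3 ≤ n) {y : Config n} {E : Finset (Fin m)}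
    (hE : G.MinInfRigidOn E y) : ∃ A : Set (Config n), G.IsAmbient y E A := by
  obtain ⟨hcard, hsurj⟩ := G.minInfRigidOn_iff.1 hE
  obtain ⟨k, hk⟩ := MinInfRigidOn.nonempty G hn hE
  have hyk := G.z_ne_zero_of_surjective hsurj hk
  obtain ⟨e, he⟩ := G.exists_equiv_hasFDerivAt hn hE hyk
  set Φ : Config n → (E → ℝ) × (ℂ × ℝ) := fun x => (G.redErr y E x, G.gauge y k x)
  have hΦ : ContDiff ℝ ∞ Φ := (G.contDiff_redErr y E).prodMk (G.gauge y k).contDiff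
  have hn0 : (∞ : WithTop ℕ∞) ≠ 0 := by simp
  have hcd : ContDiffAt ℝ ∞ Φ y := hΦ.contDiffAt
  let H := hcd.toOpenPartialHomeomorph Φ he hn0
  have hyH : y ∈ H.source := hcd.mem_toOpenPartialHomeomorph_source he hn0
  have hreg : ∀ᶠ x in 𝓝 y, Function.Surjective (G.redRigidity E x) := by
    filter_upwards [eventually_exists_hasFDerivAt_equiv hcd he] with x ⟨e', he'⟩ ε
    have h1 := ((G.hasFDerivAt_redErr y E x).prodMk (G.gauge y k).hasFDerivAt).unique he'
    obtain ⟨v, hv⟩ := e'.surjective (ε, 0)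
    refine ⟨(2 : ℝ) • v, ?_⟩
    have h2 := congrArg Prod.fst (DFunLike.congr_fun h1 v)
    have h3 : (2 : ℝ) • G.redRigidity E x v = (e' v).1 := h2
    rw [map_smul, h3, hv]
  obtain ⟨U, hUsub, hU, hyU⟩ := _root_.mem_nhds_iff.1 (hreg.and (H.open_source.mem_nhds hyH))
  set A : Set (Config n) := {x | G.z x k ≠ 0 ∧ G.normalize y k x ∈ U}
  have hrigid : ∀ x ∈ A, G.MinInfRigidOn E x := by
    intro x hx
    obtain ⟨θ, b, h⟩ := G.exists_normalize_eq hyk hx.1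
    refine MinInfRigidOn.rigidMotion G (θ := θ) (b := b) ?_
    rw [← h, minInfRigidOn_iff]
    exact ⟨hcard, (hUsub hx.2).1⟩
  have hpre : G.IsPreAmbient y E A := by
    refine ⟨?_, fun x hx => (G.minInfRigidOn_iff.1 (hrigid x hx)).2, ?_⟩
    · rw [isOpen_iff_mem_nhds]
      intro x hx
      exact (((G.contDiff_z k).continuous.continuousAt).eventually_ne hx.1).and
        ((G.continuousAt_normalize y hx.1).eventually_mem (hU.mem_nhds hx.2))
    · intro x hx x' hx' hxx'
      obtain ⟨θ, b, h⟩ := G.exists_normalize_eq hyk hx.1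
      obtain ⟨θ', b', h'⟩ := G.exists_normalize_eq hyk hx'.1
      have h1 : Φ (G.normalize y k x) = Φ (G.normalize y k x') := by
        refine Prod.ext ?_ ?_
        · simp only [Φ]
          rw [h, h', redErr_rigidMotion, redErr_rigidMotion, hxx']
        · simp only [Φ]
          rw [G.gauge_normalize hx.1, G.gauge_normalize hx'.1]
      have h2 := H.injOn (hUsub hx.2).2 (hUsub hx'.2).2 h1
      have hexp : Complex.exp (θ' * Complex.I) ≠ 0 := Complex.exp_ne_zero _
      refine exists_eq_rigidMotion (w := Complex.exp (θ * Complex.I) / Complex.exp (θ' * Complex.I))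
        (b := (toC b - toC b') / Complex.exp (θ' * Complex.I)) ?_ fun i => ?_
      · rw [norm_div, norm_exp_mul_I, norm_exp_mul_I, div_one]
      · have h3 := congrArg (fun x : Config n => toC (x i)) h2
        simp only [h, h', toC_rigidMotion] at h3
        rw [div_mul_eq_mul_div, ← add_div, eq_div_iff hexp]
        linear_combination -h3
  refine ⟨A, hpre.isOpen, ⟨hyk, by rw [G.normalize_self hyk]; exact hyU⟩, ?_, hrigid,
    hpre.orbit, ?_⟩
  · intro θ b x hx
    refine ⟨?_, by rw [G.normalize_rigidMotion]; exact hx.2⟩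
    rw [← toC_z_ne_zero, toC_z_rigidMotion]
    exact mul_ne_zero (Complex.exp_ne_zero _) (G.toC_z_ne_zero.2 hx.1)
  · intro i j i' j'
    have hinv : ∀ x ∈ A, ∀ x' ∈ A, G.redErr y E x = G.redErr y E x' →
        (inner ℝ (x i - x j) (x i' - x j') : ℝ) = inner ℝ (x' i - x' j) (x' i' - x' j') := by
      intro x hx x' hx' h
      obtain ⟨θ, b, rfl⟩ := hpre.orbit x hx x' hx' h
      simp only [inner_eq_re, map_sub, toC_rigidMotion, add_sub_add_right_eq_sub, ← mul_sub,
        map_mul, ← Complex.exp_conj, Complex.conj_ofReal, Complex.conj_I]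
      have h1 : Complex.exp (θ * -Complex.I) * Complex.exp (θ * Complex.I) = 1 := by
        rw [← Complex.exp_add]
        simp
      congr 1
      linear_combination (-(conj (toC (x i)) - conj (toC (x j))) * (toC (x i') - toC (x j'))) * h1
    refine ⟨fun ε => inner ℝ (G.lift y E A ε i - G.lift y E A ε j)
      (G.lift y E A ε i' - G.lift y E A ε j'), fun ε hε => ?_, fun x hx => ?_⟩
    · refine (hpre.contDiffAt_comp_lift (φ := fun x : Config n =>
        (inner ℝ (x i - x j) (x i' - x j') : ℝ)) (fun x _ => ?_) hinv hε).contDiffWithinAt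
      have hp : ∀ i, ContDiffAt ℝ ∞ (fun x : Config n => x i) x := fun i =>
        (contDiff_apply ℝ Plane i).contDiffAt
      exact ((hp i).sub (hp j)).inner ℝ ((hp i').sub (hp j'))
    · exact (IsPreAmbient.comp_lift_eq (φ := fun x : Config n =>
        (inner ℝ (x i - x j) (x i' - x j') : ℝ)) hinv hx).symm

end OrientedGraph

end Formation

/-! ### Exponentially stable equilibria for small mismatch errors. -/

namespace Formation

open Set Filter Topology Metric
open scoped ComplexConjugate

/-- A smooth family of vector fields whose linearization at the equilibrium `0` is dissipative
has a smooth family of exponentially stable equilibria. -/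
theorem exists_expStable_family {ι P : Type*} [Fintype ι] [NormedAddCommGroup P]
    [NormedSpace ℝ P] [FiniteDimensional ℝ P] {g : (ι → ℝ) × P → (ι → ℝ)} {Ω : Set (ι → ℝ)}
    (hΩ : IsOpen Ω) (h0 : (0 : ι → ℝ) ∈ Ω) (hg : ∀ ε ∈ Ω, ∀ μ, ContDiffAt ℝ ∞ g (ε, μ))
    (hg0 : g (0, 0) = 0) {B : (ι → ℝ) →L[ℝ] (ι → ℝ) →L[ℝ] ℝ} (hsymm : ∀ x y, B x y = B y x)
    (hpos : ∀ x, ‖x‖ ^ 2 ≤ B x x) {κ : ℝ} (hκ : 0 < κ)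
    (hdis : ∀ h, B h (fderiv ℝ g (0, 0) (h, 0)) ≤ -κ * ‖h‖ ^ 2) :
    ∃ (M : Set P) (p : P → (ι → ℝ)), IsOpen M ∧ 0 ∈ M ∧ ContDiffOn ℝ ∞ p M ∧ p 0 = 0 ∧
      ∀ μ ∈ M, IsExpStableEquilibrium (fun ε => g (ε, μ)) Ω (p μ) := by
  have hcg : ContDiffAt ℝ ∞ g (0, 0) := hg 0 h0 0
  have hn0 : (∞ : WithTop ℕ∞) ≠ 0 := by simp
  have hstrict : HasStrictFDerivAt g (fderiv ℝ g (0, 0)) (0, 0) := hcg.hasStrictFDerivAt hn0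
  set L := fderiv ℝ g (0, 0) with hL
  -- dissipativity near the origin
  have hB1 : 0 < ‖B‖ + 1 := by positivity
  -- With this tolerance the remainder of the linearization uses up at most half of $\kappa\|h\|^2$,
  -- and the other half still dominates this multiple of $B(h,h)$.
  have hη : 0 < κ / (2 * (‖B‖ + 1)) := by positivity
  -- Strict differentiability compares two arbitrary nearby points, so the estimate will apply at
  -- the displaced equilibria and not only at the origin.
  have hcontr : ∀ᶠ q : ((ι → ℝ) × P) × ((ι → ℝ) × P) in 𝓝 ((0, 0), (0, 0)),
      ‖g q.1 - g q.2 - L (q.1 - q.2)‖ ≤ κ / (2 * (‖B‖ + 1)) * ‖q.1 - q.2‖ :=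
    (hasStrictFDerivAt_iff_isLittleO.1 hstrict).def hη
  obtain ⟨δ₁, hδ₁, hball⟩ := Metric.eventually_nhds_iff_ball.1 hcontr
  obtain ⟨δ₂, hδ₂, hballΩ⟩ := Metric.isOpen_iff.1 hΩ 0 h0
  set δ := min δ₁ δ₂
  have hδ : 0 < δ := lt_min hδ₁ hδ₂
  have hκ' : 0 < κ / (2 * (‖B‖ + 1)) := hη
  have hdiss : ∀ ε ∈ ball (0 : ι → ℝ) δ, ∀ ε' ∈ ball (0 : ι → ℝ) δ, ∀ μ ∈ ball (0 : P) δ,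
      B (ε - ε') (g (ε, μ) - g (ε', μ)) ≤ -(κ / (2 * (‖B‖ + 1))) * B (ε - ε') (ε - ε') := by
    intro ε hε ε' hε' μ hμ
    set h := ε - ε'
    have h1 : ‖g (ε, μ) - g (ε', μ) - L (h, 0)‖ ≤ κ / (2 * (‖B‖ + 1)) * ‖h‖ := by
      have hmem : ((ε, μ), (ε', μ)) ∈
          ball (((0, 0), (0, 0)) : ((ι → ℝ) × P) × ((ι → ℝ) × P)) δ₁ := by
        rw [mem_ball, Prod.dist_eq, Prod.dist_eq, Prod.dist_eq]
        have := min_le_left δ₁ δ₂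
        rw [mem_ball] at hε hε' hμ
        simp only [max_lt_iff]
        exact ⟨⟨hε.trans_le this, hμ.trans_le this⟩, hε'.trans_le this, hμ.trans_le this⟩
      have h2 := hball _ hmem
      have h3 : (ε, μ) - (ε', μ) = (h, 0) := by simp [h]
      simp only [h3] at h2
      refine h2.trans_eq ?_
      congr 1
      simp [Prod.norm_def]
    have h2 : B h (g (ε, μ) - g (ε', μ)) =
        B h (L (h, 0)) + B h (g (ε, μ) - g (ε', μ) - L (h, 0)) := by
      rw [← map_add]
      congr 1
      abel
    have h3 : B h (g (ε, μ) - g (ε', μ) - L (h, 0)) ≤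
        ‖B‖ * ‖h‖ * (κ / (2 * (‖B‖ + 1)) * ‖h‖) :=
      (le_abs_self _).trans ((B.le_opNorm₂ _ _).trans (by gcongr))
    have h4 : ‖B‖ * ‖h‖ * (κ / (2 * (‖B‖ + 1)) * ‖h‖) ≤ κ / 2 * ‖h‖ ^ 2 := by
      have h5 : ‖B‖ * (κ / (2 * (‖B‖ + 1))) ≤ κ / 2 := by
        rw [mul_div_assoc', div_le_div_iff₀ (by positivity) two_pos]
        nlinarith [norm_nonneg B]
      nlinarith [sq_nonneg ‖h‖]
    have h6 : B h h ≤ (‖B‖ + 1) * ‖h‖ ^ 2 := by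
      have h7 := (le_abs_self _).trans (B.le_opNorm₂ h h)
      nlinarith [sq_nonneg ‖h‖]
    have h8 : κ / (2 * (‖B‖ + 1)) * B h h ≤ κ / 2 * ‖h‖ ^ 2 := by
      refine (mul_le_mul_of_nonneg_left h6 hκ'.le).trans_eq ?_
      field_simp
    rw [h2]
    linarith [hdis h]
  -- the implicit function
  set Φ : (ι → ℝ) × P → (ι → ℝ) × P := fun q => (g q, q.2)
  have hΦ : ∀ ε ∈ Ω, ∀ μ, ContDiffAt ℝ ∞ Φ (ε, μ) := fun ε hε μ =>
    (hg ε hε μ).prodMk contDiffAt_snd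
  have hΦd : HasFDerivAt Φ (L.prod (ContinuousLinearMap.snd ℝ (ι → ℝ) P)) (0, 0) :=
    hstrict.hasFDerivAt.prodMk hasFDerivAt_snd
  -- Dissipativity forbids a kernel of the partial derivative in `ε`, which is what the implicit
  -- function theorem needs.
  have hinj : Function.Injective (L.prod (ContinuousLinearMap.snd ℝ (ι → ℝ) P)).toLinearMap := by
    rw [← LinearMap.ker_eq_bot, LinearMap.ker_eq_bot']
    rintro ⟨h, k⟩ hhk
    have h1 : L (h, k) = 0 := congrArg Prod.fst hhk
    have h2 : k = 0 := congrArg Prod.snd hhk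
    subst h2
    have h3 := hdis h
    rw [h1, map_zero] at h3
    have h4 : ‖h‖ = 0 := by
      by_contra hne
      have : 0 < ‖h‖ := lt_of_le_of_ne (norm_nonneg h) (Ne.symm hne)
      nlinarith [mul_pos hκ (pow_pos this 2)]
    rw [norm_eq_zero.1 h4]
    rfl
  obtain ⟨e, he⟩ : ∃ e : ((ι → ℝ) × P) ≃L[ℝ] ((ι → ℝ) × P),
      HasFDerivAt Φ (e : ((ι → ℝ) × P) →L[ℝ] ((ι → ℝ) × P)) (0, 0) :=
    ⟨(LinearEquiv.ofInjectiveEndo _ hinj).toContinuousLinearEquiv, hΦd⟩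
  have hcΦ := hΦ 0 h0 0
  let H := hcΦ.toOpenPartialHomeomorph Φ he hn0
  have hHsrc : (0, 0) ∈ H.source := hcΦ.mem_toOpenPartialHomeomorph_source he hn0
  have hHΦ : ∀ q, H q = Φ q := fun _ => rfl
  have hΦ0 : Φ (0, 0) = (0, 0) := by simp [Φ, hg0]
  have hHsymm0 : H.symm (0, 0) = (0, 0) := by
    have h1 := H.left_inv hHsrc
    rwa [hHΦ, hΦ0] at h1
  -- Equilibria are kept within `δ / 2` of the origin so that closed balls of radius `δ / 2` about
  -- them stay where `hdiss` holds.
  obtain ⟨U, hUsub, hU, hU0⟩ := _root_.mem_nhds_iff.1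
    ((eventually_exists_hasFDerivAt_equiv hcΦ he).and (ball_mem_nhds _ (half_pos hδ)))
  refine ⟨{μ | ((0 : ι → ℝ), μ) ∈ H.target ∩ H.symm ⁻¹' U}, fun μ => (H.symm (0, μ)).1,
    ?_, ?_, ?_, ?_, ?_⟩
  · exact (H.isOpen_inter_preimage_symm hU).preimage (by fun_prop)
  · refine ⟨?_, ?_⟩
    · have := H.map_source hHsrc
      rwa [hHΦ, hΦ0] at this
    · rw [mem_preimage, hHsymm0]
      exact hU0
  · intro μ hμ
    obtain ⟨⟨e', he'⟩, hq⟩ := hUsub hμ.2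
    have hqΩ : (H.symm (0, μ)).1 ∈ Ω := by
      refine hballΩ ?_
      rw [Prod.dist_eq] at hq
      rw [mem_ball]
      exact (((le_max_left _ _).trans_lt hq).trans (half_lt_self hδ)).trans_le (min_le_right _ _)
    have h1 : ContDiffAt ℝ ∞ H.symm (0, μ) :=
      H.contDiffAt_symm hμ.1 he' (hΦ _ hqΩ _)
    have h2 : ContDiffAt ℝ ∞ (fun μ : P => ((0 : ι → ℝ), μ)) μ :=
      contDiffAt_const.prodMk contDiffAt_id
    exact (contDiffAt_fst.comp μ (h1.comp μ h2)).contDiffWithinAt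
  · simp [hHsymm0]
  · intro μ hμ
    obtain ⟨-, hq⟩ := hUsub hμ.2
    have hinv : Φ (H.symm (0, μ)) = (0, μ) := H.right_inv hμ.1
    have hq2 : (H.symm (0, μ)).2 = μ := congrArg Prod.snd hinv
    have hq1 : g (H.symm (0, μ)) = 0 := congrArg Prod.fst hinv
    set p := (H.symm (0, μ)).1 with hp
    have hpμ : H.symm (0, μ) = (p, μ) := Prod.ext rfl hq2
    rw [hpμ] at hq1 hq
    rw [Prod.dist_eq] at hq
    have hpδ : dist p 0 < δ / 2 := (le_max_left _ _).trans_lt hq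
    have hμδ : μ ∈ ball (0 : P) δ := by
      rw [mem_ball]
      exact ((le_max_right _ _).trans_lt hq).trans (half_lt_self hδ)
    have hsub : closedBall p (δ / 2) ⊆ ball 0 δ := fun w hw => by
      rw [mem_closedBall] at hw
      rw [mem_ball]
      linarith [dist_triangle w p 0]
    have hsubΩ : ball (0 : ι → ℝ) δ ⊆ Ω := (ball_subset_ball (min_le_right _ _)).trans hballΩ
    refine isExpStableEquilibrium_of_lyapunov hsymm one_pos (by simpa using hpos)
      (half_pos hδ) hκ' (hsub.trans hsubΩ) ?_ hq1 ?_
    · refine ContDiffAt.locallyLipschitzOn fun ε hε => ?_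
      exact ((hg ε hε μ).comp ε (f := fun ε => (ε, μ))
        (contDiffAt_id.prodMk contDiffAt_const)).of_le (by simp)
    · intro w hw
      have h1 := hdiss w (hsub hw) p (hsub (mem_closedBall_self (half_pos hδ).le)) μ hμδ
      rwa [hq1, sub_zero] at h1

namespace OrientedGraph

variable {n m : ℕ} (G : OrientedGraph n m)

theorem err_self (y : Config n) : G.err y y = 0 := by
  funext k
  simp [err]

theorem redErr_self (y : Config n) (E : Finset (Fin m)) : G.redErr y E y = 0 := by
  funext k
  exact congrFun (G.err_self y) k

/-- The transposed rigidity matrix as a linear map: the forces exerted by a stress. -/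
def stress (x : Config n) : (Fin m → ℝ) →ₗ[ℝ] Config n where
  toFun e i := ∑ k, (G.H k i * e k) • G.z x k
  map_add' e e' := by
    funext i
    simp only [Pi.add_apply, mul_add, add_smul, Finset.sum_add_distrib]
  map_smul' c e := by
    funext i
    simp only [Pi.smul_apply, smul_eq_mul, RingHom.id_apply, Finset.smul_sum, smul_smul]
    exact Finset.sum_congr rfl fun k _ => by congr 1; ring

theorem stress_apply (x : Config n) (e : Fin m → ℝ) (i : Fin n) :
    G.stress x e i = ∑ k, (G.H k i * e k) • G.z x k := rfl

theorem sum_H_smul {W : Type*} [AddCommGroup W] [Module ℝ W] (k : Fin m) (v : Fin n → W) :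
    ∑ i, G.H k i • v i = v (G.head k) - v (G.tail k) := by
  simp only [H_eq, sub_smul, ite_smul, one_smul, zero_smul, Finset.sum_sub_distrib,
    Finset.sum_ite_eq', Finset.mem_univ, if_true]

/-- Exchanging the sums over vertices and edges exhibits `stress` as the transpose of `rigidity`.
The identity $|R'e|^2=e'RR'e$ used for dissipation comes from here. -/
theorem sum_inner_stress (x v : Config n) (e : Fin m → ℝ) :
    ∑ i, (inner ℝ (G.stress x e i) (v i) : ℝ) = ∑ k, e k * G.rigidity x v k := by
  simp only [stress_apply, sum_inner, inner_smul_left, RCLike.conj_to_real]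
  rw [Finset.sum_comm]
  refine Finset.sum_congr rfl fun k _ => ?_
  have h := congrArg (fun w => e k * (inner ℝ (G.z x k) w : ℝ)) (G.sum_H_smul k v)
  simp only [inner_sum, inner_smul_right] at h
  rw [Finset.mul_sum] at h
  rw [rigidity_apply]
  refine Eq.trans (Finset.sum_congr rfl fun i _ => ?_) h
  ring

theorem overall_zero (y x : Config n) : G.overall y 0 x = -G.stress x (G.err y x) := by
  funext i
  rw [overall_eq, Pi.neg_apply, stress_apply, ← Finset.sum_neg_distrib]
  refine Finset.sum_congr rfl fun k _ => ?_
  simp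

theorem redRigidity_overall_rigidMotion (y : Config n) (E : Finset (Fin m)) (μ : Fin m → ℝ)
    (θ : ℝ) (b : Plane) (x : Config n) :
    G.redRigidity E (rigidMotion θ b x) (G.overall y μ (rigidMotion θ b x)) =
      G.redRigidity E x (G.overall y μ x) := by
  funext k
  rw [redRigidity_apply, redRigidity_apply, inner_eq_re, inner_eq_re, toC_z_rigidMotion,
    G.toC_z (G.overall y μ (Formation.rigidMotion θ b x)), toC_overall_rigidMotion,
    toC_overall_rigidMotion, G.toC_z (G.overall y μ x), map_mul,
    ← Complex.exp_conj, map_mul, Complex.conj_ofReal, Complex.conj_I]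
  have h1 : Complex.exp (θ * -Complex.I) * Complex.exp (θ * Complex.I) = 1 := by
    rw [← Complex.exp_add]
    simp
  congr 1
  linear_combination (conj (toC (G.z x k)) *
    (toC (G.overall y μ x (G.head k)) - toC (G.overall y μ x (G.tail k)))) * h1

theorem contDiff_redRigidity_overall (y : Config n) (E : Finset (Fin m)) :
    ContDiff ℝ ∞ fun q : Config n × (Fin m → ℝ) =>
      (2 : ℝ) • G.redRigidity E q.1 (G.overall y q.2 q.1) := by
  refine ContDiff.const_smul _ (contDiff_pi.2 fun k => ?_)
  simp only [redRigidity_apply]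
  exact ((G.contDiff_z k).comp contDiff_fst).inner ℝ ((G.contDiff_z k).comp (G.contDiff_overall y))

/-- The linearization of the overall system with zero mismatch at the target. -/
theorem hasFDerivAt_overall_zero (y : Config n) :
    HasFDerivAt (G.overall y 0)
      (-((G.stress y).toContinuousLinearMap.comp ((2 : ℝ) • G.rigidity y))) y := by
  rw [hasFDerivAt_pi']
  intro i
  have h1 : (fun x => G.overall y 0 x i) =
      fun x => -∑ k, (G.H k i * G.err y x k) • G.z x k := by
    funext x
    rw [overall_zero]
    rfl
  rw [h1]
  -- The error vanishes at `y`, so the term of the product rule that differentiates the edge vector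
  -- drops out.
  have h2 : ∀ k, HasFDerivAt (fun x => (G.H k i * G.err y x k) • G.z x k)
      ((G.H k i • ((2 : ℝ) • (innerSL ℝ (G.z y k)).comp (G.zL k))).smulRight (G.z y k)) y := by
    intro k
    refine (((G.hasFDerivAt_err_apply y y k).const_mul (G.H k i)).smul
      (G.zL k).hasFDerivAt).congr_fderiv ?_
    ext1 w
    rw [add_apply, smul_apply, err_self, Pi.zero_apply,
      mul_zero, zero_smul, zero_add]
    rfl
  refine (HasFDerivAt.fun_sum fun k _ => h2 k).neg.congr_fderiv ?_
  ext1 w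
  change -((∑ k, (G.H k i • ((2 : ℝ) •
    (innerSL ℝ (G.z y k)).comp (G.zL k))).smulRight (G.z y k) : Config n →L[ℝ] Plane) w) =
      -(G.stress y ((2 : ℝ) • G.rigidity y w) i)
  rw [stress_apply, sum_apply]
  rfl

theorem contDiff_redRigidity_overall_zero (y : Config n) (E : Finset (Fin m)) :
    ContDiff ℝ ∞ fun x : Config n => (2 : ℝ) • G.redRigidity E x (G.overall y 0 x) := by
  have h : ContDiff ℝ ∞ fun x : Config n => G.overall y 0 x :=
    (G.contDiff_overall y).comp (f := fun x : Config n => (x, (0 : Fin m → ℝ)))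
      (contDiff_id.prodMk contDiff_const)
  refine ContDiff.const_smul (2 : ℝ) (contDiff_pi.2 fun k => ?_)
  simp only [redRigidity_apply]
  exact (G.contDiff_z k).inner ℝ ((G.contDiff_z k).comp h)

/-- For zero mismatch the overall velocity vanishes at `y`, so only its derivative contributes and
not that of the rigidity matrix in front of it. -/
theorem hasFDerivAt_redRigidity_overall_zero (y : Config n) (E : Finset (Fin m)) :
    HasFDerivAt (fun x => (2 : ℝ) • G.redRigidity E x (G.overall y 0 x))
      ((2 : ℝ) • (G.redRigidity E y).comp (-((G.stress y).toContinuousLinearMap.comp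
        ((2 : ℝ) • G.rigidity y)))) y := by
  have h1 : HasFDerivAt (fun x => G.redRigidity E x (G.overall y 0 x))
      ((G.redRigidity E y).comp (-((G.stress y).toContinuousLinearMap.comp
        ((2 : ℝ) • G.rigidity y)))) y := by
    rw [hasFDerivAt_pi']
    intro k
    have h2 : HasFDerivAt (fun x => G.z x k) (G.zL k) y := (G.zL k).hasFDerivAt
    have h3 := h2.inner ℝ ((G.zL k).hasFDerivAt.comp y (G.hasFDerivAt_overall_zero y))
    refine h3.congr_fderiv ?_
    have h4 : G.overall y 0 y = 0 := by
      rw [overall_zero, err_self, map_zero, neg_zero]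
    ext1 w
    change (inner ℝ (G.z y k) (G.zL k (-(G.stress y ((2 : ℝ) • G.rigidity y w)))) : ℝ) +
      inner ℝ (G.zL k w) (G.zL k (G.overall y 0 y)) = _
    rw [h4, map_zero, inner_zero_right, add_zero]
    rfl
  exact h1.const_smul (2 : ℝ)

variable {G} {y : Config n} {E : Finset (Fin m)} {A : Set (Config n)}

namespace IsPreAmbient

theorem redRigidity_overall_eq (hA : G.IsPreAmbient y E A) (μ : Fin m → ℝ) :
    ∀ x ∈ A, ∀ x' ∈ A, G.redErr y E x = G.redErr y E x' →
      (2 : ℝ) • G.redRigidity E x (G.overall y μ x) =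
        (2 : ℝ) • G.redRigidity E x' (G.overall y μ x') := by
  intro x hx x' hx' h
  obtain ⟨θ, b, rfl⟩ := hA.orbit x hx x' hx' h
  rw [redRigidity_overall_rigidMotion]

theorem errSys_redErr (hA : G.IsPreAmbient y E A) {x : Config n} (hx : x ∈ A) (μ : Fin m → ℝ) :
    G.errSys y E A μ (G.redErr y E x) = (2 : ℝ) • G.redRigidity E x (G.overall y μ x) := by
  rw [hA.errSys_lift ⟨x, hx, rfl⟩]
  exact hA.redRigidity_overall_eq μ _ (lift_mem ⟨x, hx, rfl⟩) _ hx (redErr_lift ⟨x, hx, rfl⟩)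

theorem contDiffAt_errSys (hA : G.IsPreAmbient y E A) {ε : E → ℝ}
    (hε : ε ∈ G.redErr y E '' A) (μ : Fin m → ℝ) :
    ContDiffAt ℝ ∞ (fun q : (E → ℝ) × (Fin m → ℝ) => G.errSys y E A q.2 q.1) (ε, μ) := by
  refine (hA.contDiffAt_comp_lift_param (P := Fin m → ℝ) (φ := fun q =>
    (2 : ℝ) • G.redRigidity E q.1 (G.overall y q.2 q.1))
    (fun _ _ _ => (G.contDiff_redRigidity_overall y E).contDiffAt)
    (fun x hx x' hx' h μ => hA.redRigidity_overall_eq μ x hx x' hx' h) hε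
    μ).congr_of_eventuallyEq ?_
  have h1 : ∀ᶠ q : (E → ℝ) × (Fin m → ℝ) in 𝓝 (ε, μ), q.1 ∈ G.redErr y E '' A :=
    continuousAt_fst.eventually_mem (hA.isOpen_image.mem_nhds hε)
  filter_upwards [h1] with q hq
  exact hA.errSys_lift hq q.2

/-- Chain rule for the full error written as `output` of the reduced error. In particular, the
derivative of `output` maps into the range of the full rigidity matrix. -/
theorem fderiv_output (hA : G.IsPreAmbient y E A) {x : Config n} (hx : x ∈ A) (v : Config n) :
    fderiv ℝ (G.output y E A) (G.redErr y E x) ((2 : ℝ) • G.redRigidity E x v) =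
      (2 : ℝ) • G.rigidity x v := by
  have h1 : G.output y E A =ᶠ[𝓝 (G.redErr y E x)] fun ε => G.err y (G.lift y E A ε) :=
    mem_of_superset (hA.isOpen_image.mem_nhds ⟨x, hx, rfl⟩) fun ε hε => hA.output_eq hε
  rw [h1.fderiv_eq]
  exact hA.fderiv_comp_lift (fun _ _ => (G.contDiff_err y).contDiffAt) hA.err_eq_of_redErr_eq hx
    (G.hasFDerivAt_err y x) v

/-- The linearization of the error system with zero mismatch. -/
theorem fderiv_errSys (hA : G.IsPreAmbient y E A) (hy : y ∈ A) (h : E → ℝ) :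
    fderiv ℝ (fun q : (E → ℝ) × (Fin m → ℝ) => G.errSys y E A q.2 q.1) (0, 0) (h, 0) =
      -((2 : ℝ) • G.redRigidity E y (G.stress y (fderiv ℝ (G.output y E A) 0 h))) := by
  have hy0 : G.redErr y E y = 0 := G.redErr_self y E
  have h0 : (0 : E → ℝ) ∈ G.redErr y E '' A := ⟨y, hy, hy0⟩
  obtain ⟨v, hv⟩ := hA.surjective y hy ((1 / 2 : ℝ) • h)
  have hv2 : (2 : ℝ) • G.redRigidity E y v = h := by
    rw [hv, smul_smul]
    norm_num
  have hT := hA.fderiv_output hy v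
  rw [hy0, hv2] at hT
  rw [hT]
  have h1 : fderiv ℝ (fun ε : E → ℝ => G.errSys y E A 0 ε) 0 h =
      fderiv ℝ (fun q : (E → ℝ) × (Fin m → ℝ) => G.errSys y E A q.2 q.1) (0, 0) (h, 0) := by
    have h2 := ((hA.contDiffAt_errSys h0 0).differentiableAt (by simp)).hasFDerivAt
    have h3 := h2.comp (0 : E → ℝ) (hasFDerivAt_prodMk_left (𝕜 := ℝ) (0 : E → ℝ) (0 : Fin m → ℝ))
    exact DFunLike.congr_fun h3.fderiv h
  have h4 : G.errSys y E A 0 =ᶠ[𝓝 0] fun ε =>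
      (fun x => (2 : ℝ) • G.redRigidity E x (G.overall y 0 x)) (G.lift y E A ε) :=
    mem_of_superset (hA.isOpen_image.mem_nhds h0) fun ε hε => hA.errSys_lift hε 0
  have h5 := hA.fderiv_comp_lift (fun _ _ => (G.contDiff_redRigidity_overall_zero y E).contDiffAt)
    (hA.redRigidity_overall_eq 0) hy (G.hasFDerivAt_redRigidity_overall_zero y E) v
  rw [hy0, hv2] at h5
  rw [← h1, h4.fderiv_eq, h5, ← smul_neg, ← map_neg]
  rfl

/-- Take $B(h,h')=Th\cdot Th'$ with $T$ the derivative of `output` at $0$. It dominates $\|h\|^2$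
because the `E`-entries of $Th$ are those of $h$. The linearization is $Lh=-2\tilde RR'Th$, and $T$
turns $2\tilde R$ into $2R$, so $B(h,Lh)=-2|R'Th|^2$. -/
theorem exists_dissipative_form (hA : G.IsPreAmbient y E A) (hy : y ∈ A) :
    ∃ B : (E → ℝ) →L[ℝ] (E → ℝ) →L[ℝ] ℝ, (∀ h h', B h h' = B h' h) ∧ (∀ h, ‖h‖ ^ 2 ≤ B h h) ∧
      ∃ κ > 0, ∀ h, B h (fderiv ℝ (fun q : (E → ℝ) × (Fin m → ℝ) => G.errSys y E A q.2 q.1)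
        (0, 0) (h, 0)) ≤ -κ * ‖h‖ ^ 2 := by
  have hy0 : G.redErr y E y = 0 := G.redErr_self y E
  set T := fderiv ℝ (G.output y E A) 0 with hTdef
  have hT : ∀ v, T ((2 : ℝ) • G.redRigidity E y v) = (2 : ℝ) • G.rigidity y v := by
    intro v
    rw [hTdef, ← hy0]
    exact hA.fderiv_output hy v
  have hsurj : ∀ h : E → ℝ, ∃ v, (2 : ℝ) • G.redRigidity E y v = h := by
    intro h
    obtain ⟨v, hv⟩ := hA.surjective y hy ((1 / 2 : ℝ) • h)
    refine ⟨v, ?_⟩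
    rw [hv, smul_smul]
    norm_num
  have hTE : ∀ h (k : E), T h k = h k := by
    intro h k
    obtain ⟨v, rfl⟩ := hsurj h
    rw [hT]
    rfl
  let t : Fin m → ((E → ℝ) →L[ℝ] ℝ) := fun k =>
    (ContinuousLinearMap.proj (R := ℝ) (φ := fun _ => ℝ) k).comp T
  let B : (E → ℝ) →L[ℝ] (E → ℝ) →L[ℝ] ℝ := ∑ k, (t k).smulRight (t k)
  have hB : ∀ h h', B h h' = ∑ k, T h k * T h' k := by
    intro h h'
    simp only [B, sum_apply]
    rfl
  refine ⟨B, fun h h' => ?_, fun h => ?_, ?_⟩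
  · rw [hB, hB]
    exact Finset.sum_congr rfl fun k _ => mul_comm _ _
  · rw [hB]
    have h1 : ‖h‖ ≤ Real.sqrt (∑ k, T h k * T h k) := by
      rw [pi_norm_le_iff_of_nonneg (Real.sqrt_nonneg _)]
      intro k
      refine Real.le_sqrt_of_sq_le ?_
      rw [Real.norm_eq_abs, sq_abs, ← hTE h k, sq]
      exact Finset.single_le_sum (f := fun k => T h k * T h k)
        (fun _ _ => mul_self_nonneg _) (Finset.mem_univ (k : Fin m))
    calc ‖h‖ ^ 2 ≤ Real.sqrt (∑ k, T h k * T h k) ^ 2 := by gcongr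
      _ = _ := Real.sq_sqrt (Finset.sum_nonneg fun _ _ => mul_self_nonneg _)
  · let Q : (E → ℝ) →ₗ[ℝ] Config n := G.stress y ∘ₗ T.toLinearMap
    have hQ : ∀ h, Q h = G.stress y (T h) := fun _ => rfl
    -- Here $Th=2Rv$ for some $v$, so $|Th|^2=2\,(R'Th)\cdot v$, which is zero as soon as $R'Th$ is.
    have hQinj : LinearMap.ker Q = ⊥ := by
      rw [LinearMap.ker_eq_bot']
      intro h hh
      obtain ⟨v, hv⟩ := hsurj h
      have h1 := G.sum_inner_stress y v (T h)
      rw [← hQ, hh] at h1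
      simp only [Pi.zero_apply, inner_zero_left, Finset.sum_const_zero] at h1
      have h2 : ∑ k, T h k * T h k = 0 := by
        have h3 : ∀ k, T h k = 2 * G.rigidity y v k := by
          intro k
          rw [← hv, hT]
          rfl
        calc ∑ k, T h k * T h k = 2 * ∑ k, T h k * G.rigidity y v k := by
              rw [Finset.mul_sum]
              refine Finset.sum_congr rfl fun k _ => ?_
              rw [h3 k]
              ring
          _ = 0 := by rw [← h1, mul_zero]
      funext k
      have h4 := (Finset.sum_eq_zero_iff_of_nonneg fun k _ => mul_self_nonneg (T h k)).1 h2 k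
        (Finset.mem_univ _)
      rw [← hTE h k, mul_self_eq_zero.1 h4]
      rfl
    obtain ⟨K, hK, hKQ⟩ := Q.exists_antilipschitzWith hQinj
    have hK' : (0 : ℝ) < K := hK
    refine ⟨2 / K ^ 2, by positivity, fun h => ?_⟩
    have h1 : T (fderiv ℝ (fun q : (E → ℝ) × (Fin m → ℝ) => G.errSys y E A q.2 q.1) (0, 0) (h, 0)) =
        -((2 : ℝ) • G.rigidity y (Q h)) := by
      rw [hA.fderiv_errSys hy, map_neg, hT]
      rfl
    have h2 : ∑ i, ‖Q h i‖ ^ 2 = ∑ k, T h k * G.rigidity y (Q h) k := by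
      rw [← G.sum_inner_stress y (Q h) (T h)]
      exact Finset.sum_congr rfl fun i _ => (real_inner_self_eq_norm_sq _).symm
    have h3 : ‖Q h‖ ^ 2 ≤ ∑ i, ‖Q h i‖ ^ 2 := by
      have hs : 0 ≤ ∑ i, ‖Q h i‖ ^ 2 := Finset.sum_nonneg fun _ _ => sq_nonneg _
      have h4 : ‖Q h‖ ≤ Real.sqrt (∑ i, ‖Q h i‖ ^ 2) := by
        rw [pi_norm_le_iff_of_nonneg (Real.sqrt_nonneg _)]
        intro i
        exact Real.le_sqrt_of_sq_le (Finset.single_le_sum (f := fun i => ‖Q h i‖ ^ 2)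
          (fun _ _ => sq_nonneg _) (Finset.mem_univ i))
      calc ‖Q h‖ ^ 2 ≤ Real.sqrt (∑ i, ‖Q h i‖ ^ 2) ^ 2 := by gcongr
        _ = _ := Real.sq_sqrt hs
    have h5 : ‖h‖ ≤ K * ‖Q h‖ := by
      have := hKQ.le_mul_dist h 0
      simpa using this
    have h6 : ‖h‖ ^ 2 / K ^ 2 ≤ ‖Q h‖ ^ 2 := by
      rw [div_le_iff₀ (by positivity), mul_comm, ← mul_pow]
      gcongr
    rw [hB, h1]
    have h7 : ∑ k, T h k * (-((2 : ℝ) • G.rigidity y (Q h))) k = -2 * ∑ i, ‖Q h i‖ ^ 2 := by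
      rw [h2, Finset.mul_sum]
      refine Finset.sum_congr rfl fun k _ => ?_
      simp only [Pi.neg_apply, Pi.smul_apply, smul_eq_mul]
      ring
    rw [h7]
    have h8 : -(2 / (K : ℝ) ^ 2) * ‖h‖ ^ 2 = -2 * (‖h‖ ^ 2 / K ^ 2) := by ring
    rw [h8]
    linarith

theorem exists_equilibria (hA : G.IsPreAmbient y E A) (hy : y ∈ A) :
    ∃ (M : Set (Fin m → ℝ)) (p : (Fin m → ℝ) → (E → ℝ)), IsOpen M ∧ 0 ∈ M ∧ ContDiffOn ℝ ∞ p M ∧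
      p 0 = 0 ∧ ∀ μ ∈ M, IsExpStableEquilibrium (G.errSys y E A μ) (G.redErr y E '' A) (p μ) := by
  have h0 : (0 : E → ℝ) ∈ G.redErr y E '' A := ⟨y, hy, G.redErr_self y E⟩
  obtain ⟨B, hsymm, hpos, κ, hκ, hdis⟩ := hA.exists_dissipative_form hy
  refine exists_expStable_family (g := fun q : (E → ℝ) × (Fin m → ℝ) => G.errSys y E A q.2 q.1)
    hA.isOpen_image h0 (fun ε hε μ => hA.contDiffAt_errSys hε μ) ?_ hsymm hpos hκ hdis
  have h1 := hA.errSys_redErr hy 0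
  rw [G.redErr_self] at h1
  change G.errSys y E A 0 0 = 0
  rw [h1, overall_zero, err_self, map_zero, neg_zero, map_zero, smul_zero]

end IsPreAmbient

end OrientedGraph

end Formation

/-! ### Reconstruction of motions from solutions of the error system. -/

namespace Formation

open Set Filter Topology Metric
open scoped ComplexConjugate

theorem exists_primitive {f : ℝ → ℂ} (hf : ContinuousOn f (Ici 0)) :
    ∃ F : ℝ → ℂ, F 0 = 0 ∧ ∀ t, 0 ≤ t → HasDerivWithinAt F (f t) (Ici 0) t := by
  -- Freezing the function at its initial value for negative times makes it continuous on the line,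
  -- so that the fundamental theorem of calculus applies at the endpoint too.
  have hc : Continuous fun t => f (max t 0) :=
    hf.comp_continuous (by fun_prop) fun t => le_max_right t 0
  refine ⟨fun t => ∫ s in (0 : ℝ)..t, f (max s 0), by simp, fun t ht => ?_⟩
  have h := (intervalIntegral.integral_hasDerivAt_right (hc.intervalIntegrable 0 t)
    (hc.stronglyMeasurableAtFilter _ _) hc.continuousAt).hasDerivWithinAt (s := Ici 0)
  rwa [max_eq_left ht] at h

theorem eq_of_hasDerivWithinAt_zero {V : Type*} [NormedAddCommGroup V] [NormedSpace ℝ V]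
    {f : ℝ → V} (hf : ∀ t, 0 ≤ t → HasDerivWithinAt f 0 (Ici 0) t) {t : ℝ} (ht : 0 ≤ t) :
    f t = f 0 :=
  constant_of_has_deriv_right_zero (a := 0) (b := t)
    (fun s hs => (hf s hs.1).continuousWithinAt.mono Icc_subset_Ici_self)
    (fun s hs => (hf s hs.1).mono (Ici_subset_Ici.2 hs.1)) t (right_mem_Icc.2 ht)

variable {n : ℕ}

theorem hasDerivWithinAt_config {x : ℝ → Config n} {v : Config n} {s : Set ℝ} {t : ℝ} :
    HasDerivWithinAt x v s t ↔
      ∀ i, HasDerivWithinAt (fun t => toC (x t i)) (toC (v i)) s t := by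
  rw [hasDerivWithinAt_pi]
  refine forall_congr' fun i => ⟨fun h => ?_, fun h => ?_⟩
  · exact toC.toContinuousLinearEquiv.hasFDerivAt.comp_hasDerivWithinAt t h
  · have := toC.symm.toContinuousLinearEquiv.hasFDerivAt.comp_hasDerivWithinAt t h
    simpa [Function.comp_def] using this

namespace OrientedGraph

variable {m : ℕ} (G : OrientedGraph n m)

theorem locallyLipschitzOn_overall (y : Config n) (μ : Fin m → ℝ) :
    LocallyLipschitzOn univ (G.overall y μ) :=
  ContDiffAt.locallyLipschitzOn fun x _ => ((G.contDiff_overall y).contDiffAt.comp x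
    (f := fun x : Config n => (x, μ)) (contDiffAt_id.prodMk contDiffAt_const)).of_le (by simp)

theorem isSolution_overall_unique {y : Config n} {μ : Fin m → ℝ} {x x' : ℝ → Config n}
    (hx : IsSolution (G.overall y μ) x) (hx' : IsSolution (G.overall y μ) x') (h : x 0 = x' 0)
    {t : ℝ} (ht : 0 ≤ t) : x t = x' t :=
  IsSolutionIn.eq_of_locallyLipschitzOn (G.locallyLipschitzOn_overall y μ)
    ⟨hx, fun _ _ => mem_univ _⟩ ⟨hx', fun _ _ => mem_univ _⟩ h ht

/-- Positions relative to the edge `k`, in units of that edge. -/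
def relPos (k : Fin m) (i : Fin n) (x : Config n) : ℂ :=
  (toC (x i) - toC (x (G.tail k))) / toC (G.z x k)

/-- Velocities in the overall system, in units of the edge `k`. -/
def relVel (y : Config n) (μ : Fin m → ℝ) (k : Fin m) (i : Fin n) (x : Config n) : ℂ :=
  toC (G.overall y μ x i) / toC (G.z x k)

variable {G} {y : Config n} {E : Finset (Fin m)} {A : Set (Config n)} {μ : Fin m → ℝ} {k : Fin m}

theorem contDiff_toC_apply (i : Fin n) : ContDiff ℝ ∞ fun x : Config n => toC (x i) :=
  toC.contDiff.comp (contDiff_apply ℝ Plane i)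

theorem contDiffAt_inv_toC_z {x : Config n} (hx : G.z x k ≠ 0) :
    ContDiffAt ℝ ∞ (fun x => (toC (G.z x k))⁻¹) x :=
  ContDiffAt.inv (f := fun x => toC (G.z x k)) (toC.contDiff.comp (G.contDiff_z k)).contDiffAt
    (G.toC_z_ne_zero.2 hx)

theorem contDiffAt_relPos {x : Config n} (hx : G.z x k ≠ 0) (i : Fin n) :
    ContDiffAt ℝ ∞ (G.relPos k i) x := by
  unfold relPos
  simp only [div_eq_mul_inv]
  exact ((contDiff_toC_apply i).contDiffAt.sub (contDiff_toC_apply _).contDiffAt).mul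
    (contDiffAt_inv_toC_z hx)

theorem contDiffAt_relVel {x : Config n} (hx : G.z x k ≠ 0) (i : Fin n) :
    ContDiffAt ℝ ∞ (G.relVel y μ k i) x := by
  have h : ContDiffAt ℝ ∞ (fun x : Config n => toC (G.overall y μ x i)) x :=
    (contDiff_toC_apply i).contDiffAt.comp x ((G.contDiff_overall y).contDiffAt.comp x
      (f := fun x : Config n => (x, μ)) (contDiffAt_id.prodMk contDiffAt_const))
  unfold relVel
  simp only [div_eq_mul_inv]
  exact h.mul (contDiffAt_inv_toC_z hx)

theorem relPos_rigidMotion (θ : ℝ) (b : Plane) (x : Config n) (i : Fin n) :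
    G.relPos k i (rigidMotion θ b x) = G.relPos k i x := by
  rw [relPos, relPos, toC_z_rigidMotion, toC_rigidMotion, toC_rigidMotion,
    add_sub_add_right_eq_sub, ← mul_sub, mul_div_mul_left _ _ (Complex.exp_ne_zero _)]

theorem relVel_rigidMotion (θ : ℝ) (b : Plane) (x : Config n) (i : Fin n) :
    G.relVel y μ k i (rigidMotion θ b x) = G.relVel y μ k i x := by
  rw [relVel, relVel, toC_z_rigidMotion, toC_overall_rigidMotion,
    mul_div_mul_left _ _ (Complex.exp_ne_zero _)]

namespace IsPreAmbient

theorem z_ne_zero (hA : G.IsPreAmbient y E A) (hk : k ∈ E) {x : Config n} (hx : x ∈ A) :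
    G.z x k ≠ 0 :=
  G.z_ne_zero_of_surjective (hA.surjective x hx) hk

theorem relPos_eq (hA : G.IsPreAmbient y E A) (k : Fin m) (i : Fin n) :
    ∀ x ∈ A, ∀ x' ∈ A, G.redErr y E x = G.redErr y E x' → G.relPos k i x = G.relPos k i x' := by
  intro x hx x' hx' h
  obtain ⟨θ, b, rfl⟩ := hA.orbit x hx x' hx' h
  rw [relPos_rigidMotion]

theorem relVel_eq (hA : G.IsPreAmbient y E A) (μ : Fin m → ℝ) (k : Fin m) (i : Fin n) :
    ∀ x ∈ A, ∀ x' ∈ A, G.redErr y E x = G.redErr y E x' →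
      G.relVel y μ k i x = G.relVel y μ k i x' := by
  intro x hx x' hx' h
  obtain ⟨θ, b, rfl⟩ := hA.orbit x hx x' hx' h
  rw [relVel_rigidMotion]

theorem contDiffAt_relPos_lift (hA : G.IsPreAmbient y E A) (hk : k ∈ E) (i : Fin n) {ε : E → ℝ}
    (hε : ε ∈ G.redErr y E '' A) : ContDiffAt ℝ ∞ (fun ε => G.relPos k i (G.lift y E A ε)) ε :=
  hA.contDiffAt_comp_lift (fun _ hx => contDiffAt_relPos (hA.z_ne_zero hk hx) i)
    (hA.relPos_eq k i) hε

theorem contDiffAt_relVel_lift (hA : G.IsPreAmbient y E A) (μ : Fin m → ℝ) (hk : k ∈ E) (i : Fin n)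
    {ε : E → ℝ} (hε : ε ∈ G.redErr y E '' A) :
    ContDiffAt ℝ ∞ (fun ε => G.relVel y μ k i (G.lift y E A ε)) ε :=
  hA.contDiffAt_comp_lift (fun _ hx => contDiffAt_relVel (hA.z_ne_zero hk hx) i)
    (hA.relVel_eq μ k i) hε

/-- The error field is the image of the overall velocity at the lift, so the left side is the
derivative of a relative position along that velocity; it follows from the quotient rule on a
straight line through the lift. -/
theorem fderiv_relPos_lift (hA : G.IsPreAmbient y E A) (μ : Fin m → ℝ) (hk : k ∈ E) (i : Fin n)
    {ε : E → ℝ} (hε : ε ∈ G.redErr y E '' A) :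
    fderiv ℝ (fun ε => G.relPos k i (G.lift y E A ε)) ε (G.errSys y E A μ ε) =
      G.relVel y μ k i (G.lift y E A ε) - G.relVel y μ k (G.tail k) (G.lift y E A ε) -
        G.relPos k i (G.lift y E A ε) * (G.relVel y μ k (G.head k) (G.lift y E A ε) -
          G.relVel y μ k (G.tail k) (G.lift y E A ε)) := by
  have hx := lift_mem hε
  have hxε : G.redErr y E (G.lift y E A ε) = ε := redErr_lift hε
  rw [hA.errSys_lift hε]
  set x := G.lift y E A ε
  set v := G.overall y μ x with hv
  have hz := hA.z_ne_zero hk hx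
  have hz' := G.toC_z_ne_zero.2 hz
  have hd := ((contDiffAt_relPos hz i).differentiableAt (by simp)).hasFDerivAt
  have h1 := hA.fderiv_comp_lift (fun _ hx => contDiffAt_relPos (hA.z_ne_zero hk hx) i)
    (hA.relPos_eq k i) hx hd v
  rw [hxε] at h1
  rw [h1]
  have hline : HasDerivAt (fun t : ℝ => x + t • v) v 0 := by
    simpa using ((hasDerivAt_id (0 : ℝ)).smul_const v).const_add x
  have hd' : HasFDerivAt (G.relPos k i) (fderiv ℝ (G.relPos k i) x) (x + (0 : ℝ) • v) := by
    rwa [zero_smul, add_zero]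
  have h2 := hd'.comp_hasDerivAt (0 : ℝ) hline
  have hc : ∀ j, HasDerivAt (fun t : ℝ => toC ((x + t • v) j)) (toC (v j)) 0 := by
    intro j
    exact toC.toContinuousLinearEquiv.hasFDerivAt.comp_hasDerivAt (0 : ℝ)
      (hasDerivAt_pi.1 hline j)
  have hcz : HasDerivAt (fun t : ℝ => toC (G.z (x + t • v) k)) (toC (G.z v k)) 0 := by
    simp only [toC_z]
    exact (hc _).sub (hc _)
  have h3 := ((hc i).sub (hc (G.tail k))).div hcz (by rwa [zero_smul, add_zero])
  rw [h2.unique h3]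
  simp only [zero_smul, add_zero, Pi.sub_apply]
  rw [relVel, relVel, relVel, relPos, ← hv, toC_z G v]
  field_simp

/-- The squared length of an edge of the reduced formation, in terms of the reduced error. -/
theorem norm_z_sq (k : E) (x : Config n) :
    ‖G.z x k‖ ^ 2 = G.redErr y E x k + ‖G.z y k‖ ^ 2 := by
  simp [redErr, err]

/-- This is $\frac{d}{dt}|z|^2=2|z|^2\operatorname{Re}(\dot z/z)$ for the edge `k`. -/
theorem errSys_apply_eq (hA : G.IsPreAmbient y E A) (μ : Fin m → ℝ) (k : E) {ε : E → ℝ}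
    (hε : ε ∈ G.redErr y E '' A) :
    G.errSys y E A μ ε k = 2 * ((ε k + ‖G.z y k‖ ^ 2) *
      (G.relVel y μ k (G.head k) (G.lift y E A ε) -
        G.relVel y μ k (G.tail k) (G.lift y E A ε)).re) := by
  have hx := lift_mem hε
  have hxε : G.redErr y E (G.lift y E A ε) = ε := redErr_lift hε
  rw [hA.errSys_lift hε]
  set x := G.lift y E A ε
  have hz := G.toC_z_ne_zero.2 (hA.z_ne_zero k.2 hx)
  have hN : ε k + ‖G.z y k‖ ^ 2 = Complex.normSq (toC (G.z x k)) := by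
    rw [Complex.normSq_eq_norm_sq, toC.norm_map, norm_z_sq (y := y) k x, hxε]
  rw [hN, ← Complex.re_ofReal_mul, Pi.smul_apply, redRigidity_apply, inner_eq_re, smul_eq_mul,
    relVel, relVel, ← sub_div, ← Complex.mul_conj, G.toC_z (G.overall y μ x)]
  congr 2
  field_simp

end IsPreAmbient

/-- Solutions of the error system lift to solutions of the overall system. -/
theorem IsAmbient.exists_solution (hA : G.IsAmbient y E A) (hk : k ∈ E) {u : ℝ → (E → ℝ)}
    (hu : IsSolutionIn (G.errSys y E A μ) (G.redErr y E '' A) u) {x₀ : Config n} (hx₀ : x₀ ∈ A)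
    (hu0 : u 0 = G.redErr y E x₀) :
    ∃ x, IsSolution (G.overall y μ) x ∧ x 0 = x₀ ∧
      ∀ t, 0 ≤ t → x t ∈ A ∧ G.redErr y E (x t) = u t := by
  have hP := hA.isPreAmbient
  set f : Fin n → (E → ℝ) → ℂ := fun i ε => G.relPos k i (G.lift y E A ε) with hf
  set v : Fin n → (E → ℝ) → ℂ := fun i ε => G.relVel y μ k i (G.lift y E A ε) with hv
  have hvc : ∀ i, ContinuousOn (fun t => v i (u t)) (Ici 0) := fun i t ht =>
    ((hP.contDiffAt_relVel_lift μ hk i (hu.2 t ht)).continuousAt.comp_continuousWithinAt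
      (hu.1 t ht).continuousWithinAt)
  -- The edge `k` has to satisfy $\dot d=(v_{\rm head}-v_{\rm tail})\,d$ with a coefficient known
  -- from `u`. `Θ` is the integral of that coefficient, and `d` below is the solution of this scalar
  -- equation.
  obtain ⟨Θ, hΘ0, hΘ⟩ := exists_primitive ((hvc (G.head k)).sub (hvc (G.tail k)))
  set d : ℝ → ℂ := fun t => toC (G.z x₀ k) * Complex.exp (Θ t) with hd
  have hdd : ∀ t, 0 ≤ t →
      HasDerivWithinAt d ((v (G.head k) (u t) - v (G.tail k) (u t)) * d t) (Ici 0) t := by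
    intro t ht
    refine ((hΘ t ht).cexp.const_mul (toC (G.z x₀ k))).congr_deriv ?_
    simp only [hd, Pi.sub_apply]
    ring
  have hdc : ContinuousOn d (Ici 0) := fun t ht => (hdd t ht).continuousWithinAt
  obtain ⟨b, hb0, hb⟩ := exists_primitive ((hvc (G.tail k)).mul hdc)
  -- The tail moves with the integrated velocity `b`; all other points are placed by their positions
  -- relative to the edge `k`.
  set x : ℝ → Config n := fun t i =>
    toC.symm (toC (x₀ (G.tail k)) + b t + f i (u t) * d t) with hx
  have hxC : ∀ t i, toC (x t i) = toC (x₀ (G.tail k)) + b t + f i (u t) * d t := fun t i =>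
    toC.apply_symm_apply _
  have hz₀ := G.toC_z_ne_zero.2 (hP.z_ne_zero hk hx₀)
  have hx0 : x 0 = x₀ := by
    refine config_ext fun i => ?_
    have h1 : f i (u 0) = G.relPos k i x₀ := by
      rw [hu0]
      exact IsPreAmbient.comp_lift_eq (hP.relPos_eq k i) hx₀
    rw [hxC, hb0, h1, hd]
    simp only [hΘ0, Complex.exp_zero, mul_one, relPos]
    field_simp
    ring
  -- the length of the edge `k`
  have hnorm : ∀ t, 0 ≤ t → ‖d t‖ ^ 2 = u t ⟨k, hk⟩ + ‖G.z y k‖ ^ 2 := by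
    intro t ht
    -- The length prescribed by `u` and the length of `d` satisfy the same linear equation for their
    -- squares, so the quotient `q` is a constant of motion up to scale.
    set q : ℝ → ℝ := fun t => (u t ⟨k, hk⟩ + ‖G.z y k‖ ^ 2) * Real.exp (-(2 * (Θ t).re)) with hq
    have hqd : ∀ t, 0 ≤ t → HasDerivWithinAt q 0 (Ici 0) t := by
      intro t ht
      have h1 : HasDerivWithinAt (fun t => u t ⟨k, hk⟩) _ (Ici 0) t :=
        hasDerivWithinAt_pi.1 (hu.1 t ht) ⟨k, hk⟩
      have h2 : HasDerivWithinAt (fun t => (Θ t).re)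
          (v (G.head k) (u t) - v (G.tail k) (u t)).re (Ici 0) t :=
        Complex.reCLM.hasFDerivAt.comp_hasDerivWithinAt t (hΘ t ht)
      refine ((h1.add_const _).mul ((h2.const_mul 2).neg.exp)).congr_deriv ?_
      rw [hP.errSys_apply_eq μ ⟨k, hk⟩ (hu.2 t ht)]
      simp only [hv]
      ring
    have h1 := eq_of_hasDerivWithinAt_zero hqd ht
    simp only [hq, hΘ0, Complex.zero_re, mul_zero, neg_zero, Real.exp_zero, mul_one] at h1
    rw [hu0, ← IsPreAmbient.norm_z_sq (y := y) ⟨k, hk⟩ x₀, Real.exp_neg,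
      mul_inv_eq_iff_eq_mul₀ (Real.exp_ne_zero _)] at h1
    rw [h1, hd]
    simp only [norm_mul, mul_pow, toC.norm_map, Complex.norm_exp, ← Real.exp_nat_mul]
    norm_num
  have hmem : ∀ t, 0 ≤ t → x t ∈ A ∧ G.redErr y E (x t) = u t := by
    intro t ht
    have hL := lift_mem (hu.2 t ht)
    have hzL := G.toC_z_ne_zero.2 (hP.z_ne_zero hk hL)
    have hn : ‖d t‖ = ‖toC (G.z (G.lift y E A (u t)) k)‖ := by
      rw [← sq_eq_sq₀ (norm_nonneg _) (norm_nonneg _), hnorm t ht, toC.norm_map,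
        IsPreAmbient.norm_z_sq (y := y) ⟨k, hk⟩ (G.lift y E A (u t)), redErr_lift (hu.2 t ht)]
    -- The constructed formation is the lift multiplied by the quotient of the two edges and
    -- translated. Equal edge lengths make that quotient a rotation.
    obtain ⟨θ, c, hθ⟩ := exists_eq_rigidMotion (x := G.lift y E A (u t)) (x' := x t)
      (w := d t / toC (G.z (G.lift y E A (u t)) k))
      (b := toC (x₀ (G.tail k)) + b t - toC (G.lift y E A (u t) (G.tail k)) *
        (d t / toC (G.z (G.lift y E A (u t)) k)))
      (by rw [norm_div, hn, div_self (norm_ne_zero_iff.2 hzL)])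
      (fun i => by
        rw [hxC]
        simp only [hf, relPos]
        ring)
    rw [hθ]
    exact ⟨hA.invariant _ _ _ hL, by rw [redErr_rigidMotion, redErr_lift (hu.2 t ht)]⟩
  refine ⟨x, fun t ht => ?_, hx0, hmem⟩
  obtain ⟨hxA, hxu⟩ := hmem t ht
  have hL := lift_mem (hu.2 t ht)
  have hzL := G.toC_z_ne_zero.2 (hP.z_ne_zero hk hL)
  have hzx : toC (G.z (x t) k) = d t := by
    rw [toC_z, hxC, hxC]
    simp only [hf, relPos, ← toC_z, sub_self]
    rw [div_self hzL]
    ring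
  rw [hasDerivWithinAt_config]
  intro i
  have h1 : HasDerivWithinAt (fun t => f i (u t)) _ (Ici 0) t :=
    (((hP.contDiffAt_relPos_lift hk i (hu.2 t ht)).differentiableAt
      (by simp)).hasFDerivAt).comp_hasDerivWithinAt t (hu.1 t ht)
  rw [hP.fderiv_relPos_lift μ hk i (hu.2 t ht)] at h1
  simp only [hxC]
  refine (((hb t ht).const_add _).add (h1.mul (hdd t ht))).congr_deriv ?_
  have h2 : toC (G.overall y μ (x t) i) = v i (u t) * d t := by
    have h3 : G.relVel y μ k i (x t) = v i (u t) := by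
      rw [← hxu]
      exact (IsPreAmbient.comp_lift_eq (hP.relVel_eq μ k i) hxA).symm
    rw [← h3, relVel, hzx, div_mul_cancel₀]
    rw [← hzx]
    exact G.toC_z_ne_zero.2 (hP.z_ne_zero hk hxA)
  rw [h2]
  simp only [hf, hv, Pi.mul_apply]
  ring

/-- Along a solution of the overall system that starts over a solution of the error system, the
reduced error follows the latter. -/
theorem IsAmbient.redErr_eq_of_isSolution (hA : G.IsAmbient y E A) (hk : k ∈ E) {u : ℝ → (E → ℝ)}
    (hu : IsSolutionIn (G.errSys y E A μ) (G.redErr y E '' A) u) {x : ℝ → Config n}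
    (hx : IsSolution (G.overall y μ) x) (hx0 : x 0 ∈ A) (hu0 : u 0 = G.redErr y E (x 0)) {t : ℝ}
    (ht : 0 ≤ t) : x t ∈ A ∧ G.redErr y E (x t) = u t := by
  obtain ⟨x', hx', hx'0, h⟩ := hA.exists_solution hk hu hx0 hu0
  rw [G.isSolution_overall_unique hx hx' hx'0.symm ht]
  exact h t ht

end OrientedGraph

end Formation

/-! ### Rigid spinning and convergence to equilibrium solutions. -/

namespace Formation

open Set Filter Topology Metric
open scoped ComplexConjugate

/-- The integral of `exp (i s τ)` over `0 ≤ τ ≤ t`. -/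
def spinIntegral (s t : ℝ) : ℂ :=
  if s = 0 then t else (Complex.exp (s * t * Complex.I) - 1) / (s * Complex.I)

theorem spinIntegral_zero_left (t : ℝ) : spinIntegral 0 t = t := if_pos rfl

theorem spinIntegral_zero_right (s : ℝ) : spinIntegral s 0 = 0 := by
  unfold spinIntegral
  split_ifs <;> simp

theorem mul_spinIntegral (s t : ℝ) :
    s * Complex.I * spinIntegral s t = Complex.exp (s * t * Complex.I) - 1 := by
  unfold spinIntegral
  split_ifs with h
  · simp [h]
  · exact mul_div_cancel₀ _ (mul_ne_zero (Complex.ofReal_ne_zero.2 h) Complex.I_ne_zero)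

theorem hasDerivAt_exp_spin (s t : ℝ) : HasDerivAt (fun t : ℝ => Complex.exp (s * t * Complex.I))
    (s * Complex.I * Complex.exp (s * t * Complex.I)) t := by
  have h1 : HasDerivAt (fun t : ℝ => (s : ℂ) * t * Complex.I) (s * Complex.I) t := by
    simpa using ((Complex.ofRealCLM.hasDerivAt (x := t)).const_mul (s : ℂ)).mul_const Complex.I
  refine h1.cexp.congr_deriv ?_
  ring

theorem hasDerivAt_spinIntegral (s t : ℝ) :
    HasDerivAt (spinIntegral s) (Complex.exp (s * t * Complex.I)) t := by
  by_cases h : s = 0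
  · subst h
    have h1 : spinIntegral 0 = fun t : ℝ => (t : ℂ) := funext spinIntegral_zero_left
    rw [h1]
    refine (Complex.ofRealCLM.hasDerivAt (x := t)).congr_deriv ?_
    simp
  · have h1 : spinIntegral s =
        fun t : ℝ => (Complex.exp (s * t * Complex.I) - 1) / (s * Complex.I) := by
      funext t
      exact if_neg h
    have h2 : (s : ℂ) * Complex.I ≠ 0 := mul_ne_zero (Complex.ofReal_ne_zero.2 h) Complex.I_ne_zero
    rw [h1]
    refine (((hasDerivAt_exp_spin s t).sub_const 1).div_const _).congr_deriv ?_
    exact mul_div_cancel_left₀ _ h2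

theorem norm_exp_spin (s t : ℝ) : ‖Complex.exp (s * t * Complex.I)‖ = 1 := by
  rw [← Complex.ofReal_mul, norm_exp_mul_I]

variable {n : ℕ}

/-- The motion from `x` with velocities that rotate, from their initial values `v`, with angular
speed `s`. -/
def spinCurve (s : ℝ) (x v : Config n) (t : ℝ) : Config n := fun i =>
  toC.symm (toC (x i) + spinIntegral s t * toC (v i))

theorem toC_spinCurve (s : ℝ) (x v : Config n) (t : ℝ) (i : Fin n) :
    toC (spinCurve s x v t i) = toC (x i) + spinIntegral s t * toC (v i) :=
  toC.apply_symm_apply _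

theorem spinCurve_zero (s : ℝ) (x v : Config n) : spinCurve s x v 0 = x :=
  config_ext fun i => by rw [toC_spinCurve, spinIntegral_zero_right, zero_mul, add_zero]

/-- The velocities `v` of the points `x` belong to an infinitesimal rigid motion with angular
speed `s`. -/
def HasSpin (s : ℝ) (x v : Config n) : Prop :=
  ∀ i j, toC (v i) - toC (v j) = s * Complex.I * (toC (x i) - toC (x j))

theorem HasSpin.sub_spinCurve {s : ℝ} {x v : Config n} (h : HasSpin s x v) (t : ℝ) (i j : Fin n) :
    toC (spinCurve s x v t i) - toC (spinCurve s x v t j) =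
      Complex.exp (s * t * Complex.I) * (toC (x i) - toC (x j)) := by
  rw [toC_spinCurve, toC_spinCurve]
  linear_combination spinIntegral s t * h i j + (toC (x i) - toC (x j)) * mul_spinIntegral s t

theorem HasSpin.isRotating {s : ℝ} {x v : Config n} (h : HasSpin s x v) (hs : s ≠ 0) (i₀ : Fin n)
    {x' : ℝ → Config n} (hx' : ∀ t, 0 ≤ t → x' t = spinCurve s x v t) : IsRotating x' := by
  have hsI : (s : ℂ) * Complex.I ≠ 0 := mul_ne_zero (Complex.ofReal_ne_zero.2 hs) Complex.I_ne_zero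
  have hσ : ∃ σ : ℝ, (σ = 1 ∨ σ = -1) ∧ σ * |s| = s := by
    rcases abs_cases s with ⟨h1, -⟩ | ⟨h1, -⟩
    · exact ⟨1, Or.inl rfl, by rw [h1, one_mul]⟩
    · exact ⟨-1, Or.inr rfl, by rw [h1]; ring⟩
  obtain ⟨σ, hσ1, hσs⟩ := hσ
  -- The center is the point where the velocity field of the rigid motion vanishes.
  refine ⟨|s|, abs_pos.2 hs, σ, hσ1, toC.symm (toC (x i₀) - toC (v i₀) / (s * Complex.I)),
    fun t ht i => toC.injective ?_⟩
  rw [hσs, hx' t ht, hx' 0 le_rfl, spinCurve_zero, map_add, toC_rot, map_sub toC,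
    LinearIsometryEquiv.apply_symm_apply, toC_spinCurve, Complex.ofReal_mul]
  have h1 : toC (v i) =
      s * Complex.I * (toC (x i) - (toC (x i₀) - toC (v i₀) / (s * Complex.I))) := by
    have h2 : (s : ℂ) * Complex.I * (toC (v i₀) / (s * Complex.I)) = toC (v i₀) :=
      mul_div_cancel₀ _ hsI
    linear_combination h i i₀ - h2
  rw [h1]
  linear_combination (toC (x i) - (toC (x i₀) - toC (v i₀) / (s * Complex.I))) *
    mul_spinIntegral s t

namespace OrientedGraph

variable {m : ℕ} {G : OrientedGraph n m} {y : Config n} {E : Finset (Fin m)} {A : Set (Config n)}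
  {μ : Fin m → ℝ} {k : Fin m} {p : E → ℝ}

theorem HasSpin.overall_rigidMotion {s : ℝ} {x : Config n} (h : HasSpin s x (G.overall y μ x))
    (θ : ℝ) (b : Plane) :
    HasSpin s (rigidMotion θ b x) (G.overall y μ (rigidMotion θ b x)) := by
  intro i j
  rw [toC_overall_rigidMotion, toC_overall_rigidMotion, toC_rigidMotion, toC_rigidMotion]
  linear_combination Complex.exp (θ * Complex.I) * h i j

/-- In an equilibrium of the error system the formation moves rigidly. -/
theorem IsAmbient.exists_hasSpin (hn : 3 ≤ n) (hA : G.IsAmbient y E A)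
    (hp : p ∈ G.redErr y E '' A) (h0 : G.errSys y E A μ p = 0) :
    ∃ s : ℝ, ∀ x ∈ A, G.redErr y E x = p → HasSpin s x (G.overall y μ x) := by
  have hP := hA.isPreAmbient
  rw [hP.errSys_lift hp] at h0
  obtain ⟨β, s, hs⟩ := MinInfRigidOn.exists_infMotion G hn (hA.rigid _ (lift_mem hp))
    ((smul_eq_zero.1 h0).resolve_left two_ne_zero)
  refine ⟨s, fun x hx hxp => ?_⟩
  -- The whole fiber over `p` is one congruence class, so equivariance transports the angular speed
  -- found at the lift to all of it.
  obtain ⟨θ, b, rfl⟩ := hA.orbit _ (lift_mem hp) x hx ((redErr_lift hp).trans hxp.symm)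
  refine HasSpin.overall_rigidMotion (fun i j => ?_) θ b
  rw [hs, hs]
  ring

theorem output_apply_mem (k : E) : G.output y E A p k = p k := by
  unfold output
  rw [dif_pos k.2]

/-- At time `t` the curve is a congruent copy of `x` turned by the angle `s * t`. By equivariance
the overall velocity has turned by the same angle, which is exactly the derivative of the spin
integral. -/
theorem IsAmbient.isEquilibriumSolution_spinCurve (hA : G.IsAmbient y E A) {s : ℝ}
    (hs : ∀ x ∈ A, G.redErr y E x = p → HasSpin s x (G.overall y μ x)) {x : Config n} (hx : x ∈ A)
    (hxp : G.redErr y E x = p) (i₀ : Fin n) :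
    G.IsEquilibriumSolution y E A μ p (spinCurve s x (G.overall y μ x)) := by
  have h := hs x hx hxp
  have hrig : ∀ t, ∃ b, spinCurve s x (G.overall y μ x) t = rigidMotion (s * t) b x := by
    intro t
    refine ⟨toC.symm (toC (spinCurve s x (G.overall y μ x) t i₀) -
      Complex.exp (s * t * Complex.I) * toC (x i₀)), config_ext fun i => ?_⟩
    rw [toC_rigidMotion, LinearIsometryEquiv.apply_symm_apply, Complex.ofReal_mul]
    linear_combination h.sub_spinCurve t i i₀
  refine ⟨fun t _ => ?_, fun t _ => ?_⟩
  · rw [hasDerivWithinAt_config]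
    intro i
    simp only [toC_spinCurve]
    obtain ⟨b, hb⟩ := hrig t
    rw [hb, toC_overall_rigidMotion, Complex.ofReal_mul]
    exact (((hasDerivAt_spinIntegral s t).mul_const _).const_add _).hasDerivWithinAt
  · obtain ⟨b, hb⟩ := hrig t
    rw [hb]
    refine ⟨hA.invariant _ _ _ hx, ?_⟩
    rw [err_rigidMotion, ← hxp, hA.isPreAmbient.output_redErr hx]

theorem IsEquilibriumSolution.redErr_eq {x : ℝ → Config n}
    (hx : G.IsEquilibriumSolution y E A μ p x) : G.redErr y E (x 0) = p := by
  funext k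
  rw [redErr, (hx.2 0 le_rfl).2, output_apply_mem]

theorem IsAmbient.eq_spinCurve (hA : G.IsAmbient y E A) {s : ℝ}
    (hs : ∀ x ∈ A, G.redErr y E x = p → HasSpin s x (G.overall y μ x)) (i₀ : Fin n)
    {x : ℝ → Config n} (hx : G.IsEquilibriumSolution y E A μ p x) {t : ℝ} (ht : 0 ≤ t) :
    x t = spinCurve s (x 0) (G.overall y μ (x 0)) t :=
  G.isSolution_overall_unique hx.1
    (hA.isEquilibriumSolution_spinCurve hs (hx.2 0 le_rfl).1 hx.redErr_eq i₀).1
    (spinCurve_zero _ _ _).symm ht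

/-- The relative positions along an equilibrium solution are constant precisely if the angular
speed vanishes. -/
theorem IsAmbient.zConstant_iff (hA : G.IsAmbient y E A) (hk : k ∈ E) {s : ℝ}
    (hs : ∀ x ∈ A, G.redErr y E x = p → HasSpin s x (G.overall y μ x)) {x : ℝ → Config n}
    (hx : G.IsEquilibriumSolution y E A μ p x) : G.ZConstant x ↔ s = 0 := by
  have hx0 := (hx.2 0 le_rfl).1
  have h := hs _ hx0 hx.redErr_eq
  have hz : ∀ t, 0 ≤ t → ∀ l, toC (G.z (x t) l) =
      Complex.exp (s * t * Complex.I) * toC (G.z (x 0) l) := by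
    intro t ht l
    rw [toC_z, hA.eq_spinCurve hs (G.head k) hx ht, h.sub_spinCurve, ← toC_z]
  constructor
  · intro hc
    by_contra hs0
    -- After half a turn the edge `k`, which is not zero, points the opposite way.
    have ht : 0 ≤ Real.pi / |s| := by positivity
    have h1 := hz _ ht k
    rw [hc _ ht] at h1
    have h2 := G.toC_z_ne_zero.2 (hA.isPreAmbient.z_ne_zero hk hx0)
    have h3 : Complex.exp (s * (Real.pi / |s| : ℝ) * Complex.I) = 1 := by
      have : (Complex.exp (s * (Real.pi / |s| : ℝ) * Complex.I) - 1) * toC (G.z (x 0) k) = 0 := by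
        linear_combination -h1
      exact sub_eq_zero.1 ((mul_eq_zero.1 this).resolve_right h2)
    have h4 : Complex.exp (s * (Real.pi / |s| : ℝ) * Complex.I) = -1 := by
      rcases abs_cases s with ⟨h5, -⟩ | ⟨h5, -⟩
      · have h6 : s * (Real.pi / |s|) = Real.pi := by
          rw [h5]
          field_simp
        rw [← Complex.ofReal_mul, h6, Complex.exp_pi_mul_I]
      · have h6 : s * (Real.pi / |s|) = -Real.pi := by
          rw [h5]
          field_simp
        rw [← Complex.ofReal_mul, h6, Complex.ofReal_neg, neg_mul, Complex.exp_neg,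
          Complex.exp_pi_mul_I]
        norm_num
    rw [h3] at h4
    norm_num at h4
  · rintro rfl t ht
    funext l
    apply toC.injective
    rw [hz t ht]
    simp

/-- Solutions of the overall system whose reduced error tends to an equilibrium exponentially fast
converge to an equilibrium solution exponentially fast. -/
theorem IsAmbient.exists_expConverges (hA : G.IsAmbient y E A) (hk : k ∈ E)
    (hp : p ∈ G.redErr y E '' A) {s : ℝ}
    (hs : ∀ x ∈ A, G.redErr y E x = p → HasSpin s x (G.overall y μ x)) {u : ℝ → (E → ℝ)}
    (hu : IsSolutionIn (G.errSys y E A μ) (G.redErr y E '' A) u)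
    (hup : ExpConverges u fun _ => p) {x : ℝ → Config n} (hx : IsSolution (G.overall y μ) x)
    (hxu : ∀ t, 0 ≤ t → x t ∈ A ∧ G.redErr y E (x t) = u t) :
    ∃ x', G.IsEquilibriumSolution y E A μ p x' ∧ ExpConverges x x' := by
  have hP := hA.isPreAmbient
  set f : Fin n → (E → ℝ) → ℂ := fun i ε => G.relPos k i (G.lift y E A ε) with hf
  set v : Fin n → (E → ℝ) → ℂ := fun i ε => G.relVel y μ k i (G.lift y E A ε) with hv
  have hL := lift_mem hp
  have hzL := G.toC_z_ne_zero.2 (hP.z_ne_zero hk hL)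
  have hspin : ∀ i j, v i p - v j p = s * Complex.I * (f i p - f j p) := by
    intro i j
    have h1 := hs _ hL (redErr_lift hp) i j
    simp only [hv, hf, relVel, relPos, ← sub_div]
    rw [h1]
    ring
  have hfhead : ∀ ε ∈ G.redErr y E '' A, f (G.head k) ε = 1 := by
    intro ε hε
    simp only [hf, relPos, ← toC_z]
    exact div_self (G.toC_z_ne_zero.2 (hP.z_ne_zero hk (lift_mem hε)))
  have hftail : ∀ ε, f (G.tail k) ε = 0 := by
    intro ε
    simp only [hf, relPos, sub_self, zero_div]
  have huc := hu.1.continuousOn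
  have hfc : ∀ i, ExpConverges (fun t => f i (u t)) fun _ => f i p := fun i =>
    hup.comp_contDiffAt ((hP.contDiffAt_relPos_lift hk i hp).of_le (by simp)) fun t ht =>
      (hP.contDiffAt_relPos_lift hk i (hu.2 t ht)).continuousAt.comp_continuousWithinAt (huc t ht)
  have hvc : ∀ i, ExpConverges (fun t => v i (u t)) fun _ => v i p := fun i =>
    hup.comp_contDiffAt ((hP.contDiffAt_relVel_lift μ hk i hp).of_le (by simp)) fun t ht =>
      (hP.contDiffAt_relVel_lift μ hk i (hu.2 t ht)).continuousAt.comp_continuousWithinAt (huc t ht)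
  set d : ℝ → ℂ := fun t => toC (G.z (x t) k) with hd
  have hd0 : ∀ t, 0 ≤ t → d t ≠ 0 := fun t ht =>
    G.toC_z_ne_zero.2 (hP.z_ne_zero hk (hxu t ht).1)
  have hpos : ∀ t, 0 ≤ t → ∀ i, toC (x t i) = toC (x t (G.tail k)) + f i (u t) * d t := by
    intro t ht i
    have h1 : f i (u t) = G.relPos k i (x t) := by
      rw [← (hxu t ht).2]
      exact IsPreAmbient.comp_lift_eq (hP.relPos_eq k i) (hxu t ht).1
    rw [h1, relPos, div_mul_cancel₀ _ (hd0 t ht)]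
    ring
  have hvel : ∀ t, 0 ≤ t → ∀ i, toC (G.overall y μ (x t) i) = v i (u t) * d t := by
    intro t ht i
    have h1 : v i (u t) = G.relVel y μ k i (x t) := by
      rw [← (hxu t ht).2]
      exact IsPreAmbient.comp_lift_eq (hP.relVel_eq μ k i) (hxu t ht).1
    rw [h1, relVel, div_mul_cancel₀ _ (hd0 t ht)]
  have hxd : ∀ t, 0 ≤ t → ∀ i,
      HasDerivWithinAt (fun t => toC (x t i)) (v i (u t) * d t) (Ici 0) t := by
    intro t ht i
    rw [← hvel t ht i]
    exact hasDerivWithinAt_config.1 (hx t ht) i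
  -- the edge `k` in a rotating frame
  set D : ℝ → ℂ := fun t => Complex.exp ((-s : ℝ) * t * Complex.I) * d t with hD
  have hexp : ∀ t : ℝ,
      Complex.exp (s * t * Complex.I) * Complex.exp ((-s : ℝ) * t * Complex.I) = 1 := by
    intro t
    rw [← Complex.exp_add]
    push_cast
    ring_nf
    exact Complex.exp_zero
  have hdD : ∀ t, d t = Complex.exp (s * t * Complex.I) * D t := by
    intro t
    simp only [hD]
    rw [← mul_assoc, hexp, one_mul]
  have hnD : ∀ t, ‖D t‖ = ‖d t‖ := by
    intro t
    simp only [hD]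
    rw [norm_mul, norm_exp_spin, one_mul]
  have hnd : ∀ t, 0 ≤ t → ‖d t‖ ^ 2 = u t ⟨k, hk⟩ + ‖G.z y k‖ ^ 2 := by
    intro t ht
    simp only [hd]
    rw [toC.norm_map, IsPreAmbient.norm_z_sq (y := y) ⟨k, hk⟩ (x t), (hxu t ht).2]
  obtain ⟨C, hC⟩ : ∃ C, ∀ t, 0 ≤ t → ‖D t‖ ≤ C := by
    obtain ⟨C, hC⟩ := (hup.apply ⟨k, hk⟩).bounded
    refine ⟨Real.sqrt (C + ‖G.z y k‖ ^ 2), fun t ht => ?_⟩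
    rw [hnD]
    refine Real.le_sqrt_of_sq_le ?_
    rw [hnd t ht]
    have := (le_abs_self _).trans (hC t ht)
    linarith
  have hDd : ∀ t, 0 ≤ t → HasDerivWithinAt D
      ((v (G.head k) (u t) - v (G.tail k) (u t) - s * Complex.I) * D t) (Ici 0) t := by
    intro t ht
    have h1 : HasDerivWithinAt d
        (v (G.head k) (u t) * d t - v (G.tail k) (u t) * d t) (Ici 0) t := by
      have h2 : d = (fun t => toC (x t (G.head k))) - fun t => toC (x t (G.tail k)) :=
        funext fun t => G.toC_z (x t) k
      have h3 := (hxd t ht (G.head k)).sub (hxd t ht (G.tail k))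
      rwa [← h2] at h3
    refine ((hasDerivAt_exp_spin (-s) t).hasDerivWithinAt.mul h1).congr_deriv ?_
    simp only [hD]
    push_cast
    ring
  obtain ⟨D', hD'⟩ : ∃ D', ExpConverges D fun _ => D' := by
    -- At `p` the relative velocity of the ends of the edge is $si$ in units of the edge, so the
    -- coefficient in `hDd` decays exponentially, while `D` is bounded.
    refine exists_expConverges_of_deriv hDd ?_
    have h1 : ExpConverges (fun t => v (G.head k) (u t) - v (G.tail k) (u t) - s * Complex.I)
        (fun _ => 0) := by
      have h2 := hspin (G.head k) (G.tail k)
      rw [hfhead p hp, hftail, sub_zero, mul_one] at h2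
      have h3 : ExpConverges (fun t => -v (G.tail k) (u t)) fun _ => -v (G.tail k) p :=
        (hvc (G.tail k)).of_norm_le (C := 1) fun t _ => by
          rw [one_mul, ← norm_neg]
          exact le_of_eq (congrArg _ (by ring))
      refine ((hvc (G.head k)).add h3).of_norm_le (C := 1) fun t _ => ?_
      rw [one_mul]
      refine le_of_eq (congrArg _ ?_)
      linear_combination h2
    have h4 := h1.mul (ExpConverges.refl D) (C := 0) (by simp) hC
    simpa using h4
  -- The limiting edge must have the length belonging to `p`; only then is the limiting formation
  -- congruent to the lift.
  have hnD' : ‖D'‖ = ‖toC (G.z (G.lift y E A p) k)‖ := by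
    have h1 : Tendsto (fun t => ‖D t‖ ^ 2) atTop (𝓝 (‖D'‖ ^ 2)) := (hD'.tendsto.norm).pow 2
    have h2 : Tendsto (fun t => u t ⟨k, hk⟩ + ‖G.z y k‖ ^ 2) atTop
        (𝓝 (p ⟨k, hk⟩ + ‖G.z y k‖ ^ 2)) := ((hup.apply ⟨k, hk⟩).tendsto).add_const _
    have h3 := tendsto_nhds_unique h1 (h2.congr' ((eventually_ge_atTop 0).mono fun t ht => by
      simp only [hnD, hnd t ht]))
    rw [← sq_eq_sq₀ (norm_nonneg _) (norm_nonneg _), h3, toC.norm_map,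
      IsPreAmbient.norm_z_sq (y := y) ⟨k, hk⟩ (G.lift y E A p), redErr_lift hp]
  have hD'0 : D' ≠ 0 := by
    rw [← norm_ne_zero_iff, hnD']
    exact norm_ne_zero_iff.2 hzL
  -- the tail of the edge `k`, relative to its asymptotic motion
  obtain ⟨c, hc⟩ : ∃ c, ExpConverges
      (fun t => toC (x t (G.tail k)) - spinIntegral s t * (v (G.tail k) p * D')) fun _ => c := by
    refine exists_expConverges_of_deriv (h' := fun t => v (G.tail k) (u t) * d t -
      Complex.exp (s * t * Complex.I) * (v (G.tail k) p * D'))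
      (fun t ht => (hxd t ht _).sub ((hasDerivAt_spinIntegral s t).hasDerivWithinAt.mul_const _)) ?_
    refine ((hvc (G.tail k)).mul hD' (C := ‖v (G.tail k) p‖) (fun _ _ => le_rfl) hC).of_norm_le
      (C := 1) fun t _ => ?_
    have h1 : v (G.tail k) (u t) * d t - Complex.exp (s * t * Complex.I) * (v (G.tail k) p * D') -
        0 = Complex.exp (s * t * Complex.I) * (v (G.tail k) (u t) * D t - v (G.tail k) p * D') := by
      rw [hdD]
      ring
    rw [h1, norm_mul, norm_exp_spin]
  -- the limiting formation
  set w : Config n := fun i => toC.symm (c + f i p * D') with hw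
  have hwC : ∀ i, toC (w i) = c + f i p * D' := fun i => toC.apply_symm_apply _
  obtain ⟨θ, b, hwθ⟩ := exists_eq_rigidMotion (x := G.lift y E A p) (x' := w)
    (w := D' / toC (G.z (G.lift y E A p) k))
    (b := c - toC (G.lift y E A p (G.tail k)) * (D' / toC (G.z (G.lift y E A p) k)))
    (by rw [norm_div, hnD', div_self (norm_ne_zero_iff.2 hzL)])
    (fun i => by
      rw [hwC]
      simp only [hf, relPos]
      ring)
  have hwA : w ∈ A := by
    rw [hwθ]
    exact hA.invariant _ _ _ hL
  have hwp : G.redErr y E w = p := by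
    rw [hwθ, redErr_rigidMotion, redErr_lift hp]
  have hzw : toC (G.z w k) = D' := by
    rw [toC_z, hwC, hwC, hfhead p hp, hftail]
    ring
  have hvw : ∀ i, toC (G.overall y μ w i) = v i p * D' := by
    intro i
    have h1 : v i p = G.relVel y μ k i w := by
      rw [← hwp]
      exact IsPreAmbient.comp_lift_eq (hP.relVel_eq μ k i) hwA
    rw [h1, relVel, hzw, div_mul_cancel₀ _ hD'0]
  refine ⟨_, hA.isEquilibriumSolution_spinCurve hs hwA hwp (G.head k), ExpConverges.pi fun i => ?_⟩
  have h1 : ExpConverges (fun t => Complex.exp (s * t * Complex.I) * (f i (u t) * D t))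
      (fun t => Complex.exp (s * t * Complex.I) * (f i p * D')) := by
    refine ((hfc i).mul hD' (C := ‖f i p‖) (fun _ _ => le_rfl) hC).of_norm_le (C := 1) fun t _ => ?_
    rw [← mul_sub, norm_mul, norm_exp_spin]
  refine (hc.add h1).of_norm_le (C := 1) fun t ht => ?_
  rw [one_mul, ← toC.norm_map, map_sub, toC_spinCurve, hwC, hvw, hpos t ht i, hdD]
  refine le_of_eq (congrArg _ ?_)
  -- Rigidity of the limiting velocities lets the point `i` be described in two ways: tail motion
  -- plus a turning relative position, or its own spin curve from the limiting formation.
  have h2 := hspin i (G.tail k)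
  rw [hftail, sub_zero] at h2
  linear_combination (-spinIntegral s t * D') * h2 + (-f i p * D') * mul_spinIntegral s t

end OrientedGraph

end Formation

/-! ### Torques, the generic case, and drift without rotation. -/

namespace Formation

open Set Filter Topology Metric
open scoped ComplexConjugate

/-- Near a regular point, the zero set of a smooth function is a null set. -/
theorem exists_nhds_volume_zeros_eq_zero {ι : Type*} [Fintype ι] {φ : (ι → ℝ) → ℝ}
    {M : Set (ι → ℝ)} (hM : IsOpen M) {a e : ι → ℝ} (ha : a ∈ M)
    (hφ : ∀ μ ∈ M, ContDiffAt ℝ ∞ φ μ) (hd : fderiv ℝ φ a e ≠ 0) :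
    ∃ M₀ ⊆ M, IsOpen M₀ ∧ a ∈ M₀ ∧ MeasureTheory.volume (M₀ ∩ {μ | φ μ = 0}) = 0 := by
  have hc : ContinuousAt (fun μ => fderiv ℝ φ μ e) a :=
    (((hφ a ha).fderiv_right (m := 0) (by simp)).continuousAt).clm_apply continuousAt_const
  obtain ⟨δ, hδ, hball⟩ := Metric.mem_nhds_iff.1 ((hc.eventually_ne hd).and (hM.mem_nhds ha))
  refine ⟨ball a δ, fun μ hμ => (hball hμ).2, isOpen_ball, mem_ball_self hδ, ?_⟩
  have hcont : ContinuousOn φ (ball a δ) := fun μ hμ =>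
    (hφ μ (hball hμ).2).continuousAt.continuousWithinAt
  have hmeas : MeasurableSet (ball a δ ∩ {μ | φ μ = 0}) := by
    have h1 : ball a δ ∩ {μ | φ μ = 0} = ball a δ \ (ball a δ ∩ φ ⁻¹' {0}ᶜ) := by
      ext μ
      simp only [mem_inter_iff, mem_ofPred_eq, Set.mem_sdiff, mem_preimage, mem_compl_iff,
        mem_singleton_iff]
      tauto
    rw [h1]
    exact isOpen_ball.measurableSet.diff
      (hcont.isOpen_inter_preimage isOpen_ball isOpen_compl_singleton).measurableSet
  -- Fubini in the direction `e`: by Rolle's theorem each line parallel to `e` meets the zero set in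
  -- the ball at most once, since the derivative along `e` does not vanish there.
  have hae := MeasureTheory.ae_mem_of_ae_add_linearMap_mem (LinearMap.toSpanSingleton ℝ (ι → ℝ) e)
    (MeasureTheory.volume : MeasureTheory.Measure ℝ)
    (MeasureTheory.volume : MeasureTheory.Measure (ι → ℝ)) hmeas.compl fun w => by
      have hsub : {t : ℝ | w + t • e ∈ ball a δ ∩ {μ | φ μ = 0}}.Subsingleton := by
        have key : ∀ t₁ t₂ : ℝ, w + t₁ • e ∈ ball a δ ∩ {μ | φ μ = 0} →
            w + t₂ • e ∈ ball a δ ∩ {μ | φ μ = 0} → ¬ t₁ < t₂ := by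
          intro t₁ t₂ h₁ h₂ hlt
          have hseg : ∀ t ∈ Icc t₁ t₂, w + t • e ∈ ball a δ := by
            intro t ht
            have hconv : Convex ℝ {t : ℝ | w + t • e ∈ ball a δ} := by
              have := (convex_ball a δ).affine_preimage
                (AffineMap.lineMap w (w + e) : ℝ →ᵃ[ℝ] (ι → ℝ))
              simpa [preimage, AffineMap.lineMap_apply, add_comm] using this
            exact hconv.ordConnected.out h₁.1 h₂.1 ht
          have hder : ∀ t ∈ Icc t₁ t₂, HasDerivAt (fun t : ℝ => φ (w + t • e))
              (fderiv ℝ φ (w + t • e) e) t := by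
            intro t ht
            have hline : HasDerivAt (fun t : ℝ => w + t • e) e t := by
              simpa using ((hasDerivAt_id t).smul_const e).const_add w
            exact (((hφ _ (hball (hseg t ht)).2).differentiableAt
              (by simp)).hasFDerivAt).comp_hasDerivAt t hline
          obtain ⟨t, ht, h0⟩ := exists_hasDerivAt_eq_zero hlt
            (fun t ht => (hder t ht).continuousAt.continuousWithinAt)
            ((show φ (w + t₁ • e) = 0 from h₁.2).trans (show φ (w + t₂ • e) = 0 from h₂.2).symm)
            fun t ht => hder t (Ioo_subset_Icc_self ht)
          exact (hball (hseg t (Ioo_subset_Icc_self ht))).1 h0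
        exact fun t₁ h₁ t₂ h₂ =>
          le_antisymm (not_lt.1 (key t₂ t₁ h₂ h₁)) (not_lt.1 (key t₁ t₂ h₁ h₂))
      have hnull := hsub.measure_zero (MeasureTheory.volume : MeasureTheory.Measure ℝ)
      rw [MeasureTheory.ae_iff]
      simpa [LinearMap.toSpanSingleton_apply] using hnull
  rw [MeasureTheory.ae_iff] at hae
  simp only [mem_compl_iff, not_not] at hae
  exact hae

variable {n : ℕ}

/-- The centroid of a multi-point. -/
def centroid (x : Config n) : ℂ := (∑ i, toC (x i)) / n

theorem sum_sub_centroid (hn : 0 < n) (x : Config n) : ∑ i, (toC (x i) - centroid x) = 0 := by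
  have : (n : ℂ) ≠ 0 := Nat.cast_ne_zero.2 hn.ne'
  rw [Finset.sum_sub_distrib, Finset.sum_const, Finset.card_univ, Fintype.card_fin, nsmul_eq_mul,
    centroid, mul_div_cancel₀ _ this, sub_self]

theorem centroid_rigidMotion (hn : 0 < n) (θ : ℝ) (b : Plane) (x : Config n) :
    centroid (rigidMotion θ b x) = Complex.exp (θ * Complex.I) * centroid x + toC b := by
  have : (n : ℂ) ≠ 0 := Nat.cast_ne_zero.2 hn.ne'
  simp only [centroid, toC_rigidMotion, Finset.sum_add_distrib, ← Finset.mul_sum, Finset.sum_const,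
    Finset.card_univ, Fintype.card_fin, nsmul_eq_mul]
  rw [add_div, mul_div_assoc, mul_div_cancel_left₀ _ this]

theorem ExpConverges.tendsto_norm_atTop {V : Type*} [NormedAddCommGroup V] {x x' : ℝ → V}
    (h : ExpConverges x x') (hx' : Tendsto (fun t => ‖x' t‖) atTop atTop) :
    Tendsto (fun t => ‖x t‖) atTop atTop := by
  obtain ⟨c, hc, r, hr, hb⟩ := h
  refine tendsto_atTop_mono' _ ((eventually_ge_atTop 0).mono fun t ht => ?_)
    (tendsto_atTop_add_const_right _ (-c) hx')
  have ht' : (0 : ℝ) ≤ t := ht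
  have h1 := hb t ht'
  have h2 : Real.exp (-r * t) ≤ 1 := Real.exp_le_one_iff.2 (by nlinarith)
  have h3 := norm_sub_norm_le (x' t) (x t)
  rw [norm_sub_rev] at h3
  nlinarith

namespace OrientedGraph

variable {m : ℕ} (G : OrientedGraph n m)

/-- The torque about the centroid of the edge vector `k` applied at the tail of the edge. -/
def torque (k : Fin m) (x : Config n) : ℝ :=
  (conj (toC (x (G.tail k)) - centroid x) * toC (G.z x k)).im

theorem torque_rigidMotion (hn : 0 < n) (k : Fin m) (θ : ℝ) (b : Plane) (x : Config n) :
    G.torque k (rigidMotion θ b x) = G.torque k x := by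
  rw [torque, torque, centroid_rigidMotion hn, toC_z_rigidMotion, toC_rigidMotion,
    add_sub_add_right_eq_sub, ← mul_sub, map_mul, ← Complex.exp_conj, map_mul,
    Complex.conj_ofReal, Complex.conj_I]
  have h1 : Complex.exp (θ * -Complex.I) * Complex.exp (θ * Complex.I) = 1 := by
    rw [← Complex.exp_add]
    simp
  congr 1
  linear_combination (conj (toC (x (G.tail k)) - centroid x) * toC (G.z x k)) * h1

theorem contDiff_torque (k : Fin m) : ContDiff ℝ ∞ (G.torque k) := by
  have h1 : ContDiff ℝ ∞ fun x : Config n => centroid x := by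
    unfold centroid
    simp only [div_eq_mul_inv]
    exact (ContDiff.sum fun i _ => contDiff_toC_apply i).mul contDiff_const
  have h2 : ContDiff ℝ ∞ fun x : Config n => conj (toC (x (G.tail k)) - centroid x) :=
    Complex.conjCLE.contDiff.comp ((contDiff_toC_apply _).sub h1)
  exact Complex.imCLM.contDiff.comp (h2.mul (toC.contDiff.comp (G.contDiff_z k)))

variable {G} {y : Config n} {E : Finset (Fin m)} {A : Set (Config n)} {μ : Fin m → ℝ} {p : E → ℝ}

/-- Without rotation, the torques of the mismatch errors balance. -/
theorem sum_mul_torque_eq_zero (hn : 0 < n) {x : Config n}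
    (h : HasSpin 0 x (G.overall y μ x)) : ∑ k, μ k * G.torque k x = 0 := by
  have hconst : ∀ i, toC (G.overall y μ x i) = toC (G.overall y μ x ⟨0, hn⟩) := by
    intro i
    have := h i ⟨0, hn⟩
    rw [Complex.ofReal_zero, zero_mul, zero_mul] at this
    exact sub_eq_zero.1 this
  -- All velocities are equal, and the positions relative to the centroid sum to zero.
  have h1 : ∑ i, conj (toC (x i) - centroid x) * toC (G.overall y μ x i) = 0 := by
    simp only [hconst]
    rw [← Finset.sum_mul, ← map_sum, sum_sub_centroid hn, map_zero, zero_mul]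
  -- Regrouped by edges, the error forces contribute real numbers, so the imaginary part retains
  -- only the mismatch terms.
  have h2 : ∑ i, conj (toC (x i) - centroid x) * toC (G.overall y μ x i) =
      ∑ k, ((-(G.err y x k * Complex.normSq (toC (G.z x k))) : ℝ) +
        μ k * (conj (toC (x (G.tail k)) - centroid x) * toC (G.z x k))) := by
    simp only [toC_overall, Finset.mul_sum]
    rw [Finset.sum_comm]
    refine Finset.sum_congr rfl fun k _ => ?_
    have h3 := G.sum_H_smul k fun i => conj (toC (x i) - centroid x)
    have h4 : ∑ i, G.J k i • conj (toC (x i) - centroid x) =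
        conj (toC (x (G.tail k)) - centroid x) := by
      simp only [J_eq, ite_smul, one_smul, zero_smul, Finset.sum_ite_eq', Finset.mem_univ, if_true]
    rw [← map_sub, sub_sub_sub_cancel_right, ← toC_z] at h3
    simp only [Complex.real_smul] at h3 h4
    have h5 : conj (toC (G.z x k)) * toC (G.z x k) = (Complex.normSq (toC (G.z x k)) : ℂ) := by
      rw [mul_comm, Complex.mul_conj]
    calc ∑ i, conj (toC (x i) - centroid x) *
          (((-(G.H k i * G.err y x k) + G.J k i * μ k : ℝ) : ℂ) * toC (G.z x k)) =
        -(G.err y x k * toC (G.z x k)) * ∑ i, (G.H k i : ℂ) * conj (toC (x i) - centroid x) +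
          μ k * toC (G.z x k) * ∑ i, (G.J k i : ℂ) * conj (toC (x i) - centroid x) := by
          rw [Finset.mul_sum, Finset.mul_sum, ← Finset.sum_add_distrib]
          refine Finset.sum_congr rfl fun i _ => ?_
          push_cast
          ring
      _ = _ := by
          rw [h3, h4]
          push_cast
          linear_combination (-(G.err y x k : ℂ)) * h5
  rw [h2] at h1
  have h6 := congrArg Complex.im h1
  simpa [torque] using h6

/-- In a rigid formation some edge does not point towards the centroid. -/
theorem MinInfRigidOn.exists_torque_ne_zero (hn : 3 ≤ n) {x : Config n}
    (hE : G.MinInfRigidOn E x) : ∃ k, G.torque k x ≠ 0 := by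
  by_contra! hall
  obtain ⟨k₀, hk₀⟩ := MinInfRigidOn.nonempty G hn hE
  have hz := G.toC_z_ne_zero.2 (G.z_ne_zero_of_surjective (G.minInfRigidOn_iff.1 hE).2 hk₀)
  rw [toC_z, sub_ne_zero] at hz
  have hends : ∀ k, (conj (toC (x (G.head k)) - centroid x) * toC (G.z x k)).im = 0 := by
    intro k
    have h1 := hall k
    rw [torque] at h1
    have h2 : conj (toC (x (G.head k)) - centroid x) * toC (G.z x k) =
        conj (toC (x (G.tail k)) - centroid x) * toC (G.z x k) +
          (Complex.normSq (toC (G.z x k)) : ℂ) := by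
      rw [← Complex.mul_conj, toC_z, map_sub, map_sub, map_sub]
      ring
    rw [h2, Complex.add_im, h1, Complex.ofReal_im, add_zero]
  -- rotating one vertex only about the centroid is an infinitesimal flex
  have hflex : ∀ i, toC (x i) ≠ centroid x → ∀ j, j ≠ i → ∀ l, l ≠ i → toC (x j) = toC (x l) := by
    intro i hi j hj l hl
    set v : Config n := Pi.single i (toC.symm (Complex.I * (toC (x i) - centroid x))) with hv
    have hvi : toC (v i) = Complex.I * (toC (x i) - centroid x) := by
      rw [hv, Pi.single_eq_same, LinearIsometryEquiv.apply_symm_apply]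
    have hvj : ∀ j, j ≠ i → toC (v j) = 0 := by
      intro j hj
      rw [hv, Pi.single_eq_of_ne hj, map_zero]
    have hre : ∀ a b : ℂ, (conj b * (Complex.I * a)).re = (conj a * b).im := by
      intro a b
      simp only [Complex.mul_re, Complex.mul_im, Complex.conj_re, Complex.conj_im, Complex.I_re,
        Complex.I_im]
      ring
    have hker : G.redRigidity E x v = 0 := by
      funext k
      rw [redRigidity_apply, inner_eq_re, G.toC_z v, mul_sub, Complex.sub_re, Pi.zero_apply]
      have h1 : ∀ j, (conj (toC (x j) - centroid x) * toC (G.z x k)).im = 0 →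
          (conj (toC (G.z x k)) * toC (v j)).re = 0 := by
        intro j hj
        by_cases hji : j = i
        · rw [hji, hvi, hre, ← hji, hj]
        · rw [hvj j hji, mul_zero, Complex.zero_re]
      rw [h1 _ (hends k), h1 _ (hall k), sub_zero]
    obtain ⟨β, s, hs⟩ := MinInfRigidOn.exists_infMotion G hn hE hker
    have hj' := hs j
    have hl' := hs l
    rw [hvj j hj] at hj'
    rw [hvj l hl] at hl'
    have h2 : (s : ℂ) * Complex.I * (toC (x j) - toC (x l)) = 0 := by
      linear_combination hl' - hj'
    rcases mul_eq_zero.1 h2 with h3 | h3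
    · have hs0 : (s : ℂ) = 0 := (mul_eq_zero.1 h3).resolve_right Complex.I_ne_zero
      rw [hs0] at hj'
      have hβ : β = 0 := by linear_combination -hj'
      have hi' := hs i
      rw [hvi, hβ, hs0, zero_mul, zero_mul, add_zero] at hi'
      exact absurd (sub_eq_zero.1 ((mul_eq_zero.1 hi').resolve_left Complex.I_ne_zero)) hi
    · exact sub_eq_zero.1 h3
  -- If `i` were off the centroid, `hflex` would put all other points at the position of `j`. If
  -- that is the centroid, the centroid condition forces `i` there too; if not, `hflex` at `j` and a
  -- third vertex give `i` and `j` the same position.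
  have key : ∀ i j, toC (x i) ≠ toC (x j) → toC (x i) = centroid x := by
    intro i j hij
    by_contra hi
    have hne : j ≠ i := fun h => hij (by rw [h])
    obtain ⟨l, hl⟩ : ∃ l, l ∉ ({i, j} : Finset (Fin n)) := by
      by_contra! h
      have h1 : Finset.univ ⊆ ({i, j} : Finset (Fin n)) := fun l _ => h l
      have h2 := (Finset.card_le_card h1).trans Finset.card_le_two
      rw [Finset.card_univ, Fintype.card_fin] at h2
      omega
    simp only [Finset.mem_insert, Finset.mem_singleton, not_or] at hl
    have hothers : ∀ l, l ≠ i → toC (x l) = toC (x j) := fun l hl => hflex i hi l hl j hne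
    by_cases hj : toC (x j) = centroid x
    · have h1 := sum_sub_centroid (by omega : 0 < n) x
      rw [Finset.sum_eq_single i (fun l _ hl => by rw [hothers l hl, hj, sub_self])
        (fun h => absurd (Finset.mem_univ i) h)] at h1
      exact hi (sub_eq_zero.1 h1)
    · have h1 := hflex j hj i (Ne.symm hne) l hl.2
      rw [hothers l hl.1] at h1
      exact hij h1
  exact hz ((key _ _ hz).trans (key _ _ hz.symm).symm)

/-- For almost all small mismatch errors the torques do not balance. -/
theorem IsAmbient.exists_torque_nhds (hn : 3 ≤ n) (hA : G.IsAmbient y E A)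
    {M : Set (Fin m → ℝ)} {p : (Fin m → ℝ) → (E → ℝ)} (hM : IsOpen M) (h0 : 0 ∈ M)
    (hp : ContDiffOn ℝ ∞ p M) (hp0 : p 0 = 0) (hpΩ : ∀ μ ∈ M, p μ ∈ G.redErr y E '' A) :
    ∃ M₀ ⊆ M, IsOpen M₀ ∧ 0 ∈ M₀ ∧ ∃ N ⊆ M₀, IsOpen N ∧ M₀ ⊆ closure N ∧
      MeasureTheory.volume (M₀ \ N) = 0 ∧
      ∀ μ ∈ N, ∑ k, μ k * G.torque k (G.lift y E A (p μ)) ≠ 0 := by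
  have hP := hA.isPreAmbient
  have hinv : ∀ k, ∀ x ∈ A, ∀ x' ∈ A, G.redErr y E x = G.redErr y E x' →
      G.torque k x = G.torque k x' := by
    intro k x hx x' hx' h
    obtain ⟨θ, b, rfl⟩ := hP.orbit x hx x' hx' h
    rw [torque_rigidMotion G (by omega)]
  set h : Fin m → (Fin m → ℝ) → ℝ := fun k μ => G.torque k (G.lift y E A (p μ)) with hh
  have hsm : ∀ k, ∀ μ ∈ M, ContDiffAt ℝ ∞ (h k) μ := fun k μ hμ =>
    (hP.contDiffAt_comp_lift (fun _ _ => (G.contDiff_torque k).contDiffAt) (hinv k)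
      (hpΩ μ hμ)).comp μ (hp.contDiffAt (hM.mem_nhds hμ))
  set φ : (Fin m → ℝ) → ℝ := fun μ => ∑ k, μ k * h k μ with hφ
  have hφs : ∀ μ ∈ M, ContDiffAt ℝ ∞ φ μ := fun μ hμ =>
    ContDiffAt.sum fun k _ => (contDiff_apply ℝ ℝ k).contDiffAt.mul (hsm k μ hμ)
  obtain ⟨k, hk⟩ := MinInfRigidOn.exists_torque_ne_zero hn (hA.rigid y hA.mem)
  have hhk : h k 0 = G.torque k y := by
    simp only [hh]
    rw [hp0, ← G.redErr_self y E]
    exact IsPreAmbient.comp_lift_eq (hinv k) hA.mem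
  -- At the origin the factors `μ l` vanish, so the derivatives of the torques do not enter, and
  -- what is left is the torque of the edge `k` in `y`.
  have hφd : fderiv ℝ φ 0 (Pi.single k 1) ≠ 0 := by
    have h1 : ∀ l, HasFDerivAt (fun μ : Fin m → ℝ => μ l * h l μ)
        ((0 : ℝ) • fderiv ℝ (h l) 0 +
          h l 0 • ContinuousLinearMap.proj (R := ℝ) (φ := fun _ : Fin m => ℝ) l) 0 := fun l =>
      (hasFDerivAt_apply l (0 : Fin m → ℝ)).mul
        ((hsm l 0 h0).differentiableAt (by simp)).hasFDerivAt
    have h2 : HasFDerivAt φ _ 0 := HasFDerivAt.fun_sum fun l (_ : l ∈ Finset.univ) => h1 l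
    have h3 : fderiv ℝ φ 0 (Pi.single k 1) = h k 0 := by
      rw [h2.fderiv, sum_apply, Finset.sum_eq_single k]
      · simp
      · intro l _ hl
        simp [hl]
      · exact fun h => absurd (Finset.mem_univ k) h
    rw [h3, hhk]
    exact hk
  obtain ⟨M₀, hsub, hopen, hmem, hnull⟩ := exists_nhds_volume_zeros_eq_zero hM h0 hφs hφd
  have hcont : ContinuousOn φ M₀ := fun μ hμ =>
    (hφs μ (hsub hμ)).continuousAt.continuousWithinAt
  have hdiff : M₀ \ (M₀ ∩ φ ⁻¹' {0}ᶜ) = M₀ ∩ {μ | φ μ = 0} := by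
    ext μ
    simp only [mem_inter_iff, mem_ofPred_eq, Set.mem_sdiff, mem_preimage, mem_compl_iff,
      mem_singleton_iff]
    tauto
  refine ⟨M₀, hsub, hopen, hmem, M₀ ∩ φ ⁻¹' {0}ᶜ, inter_subset_left,
    hcont.isOpen_inter_preimage hopen isOpen_compl_singleton, ?_, by rw [hdiff, hnull],
    fun μ hμ => hμ.2⟩
  intro μ hμ
  rw [_root_.mem_closure_iff]
  intro U hU hμU
  by_contra hempty
  have h1 : U ∩ M₀ ⊆ M₀ ∩ {μ | φ μ = 0} := by
    rw [← hdiff]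
    exact fun ν hν => ⟨hν.2, fun hν' => hempty ⟨ν, hν.1, hν'⟩⟩
  -- Density follows from the null complement, since a nonempty open set has positive measure.
  exact (hU.inter hopen).measure_ne_zero MeasureTheory.volume ⟨μ, hμU, hμ⟩
    (MeasureTheory.measure_mono_null h1 hnull)

/-- Without rotation, equilibrium solutions with a nonvanishing velocity drift off to infinity. -/
theorem tendsto_norm_spinCurve_zero {x v : Config n} {i : Fin n} (hv : v i ≠ 0) :
    Tendsto (fun t => ‖spinCurve 0 x v t i‖) atTop atTop := by
  have h1 : Tendsto (fun t : ℝ => t * ‖v i‖ + -‖x i‖) atTop atTop :=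
    tendsto_atTop_add_const_right _ _ (tendsto_id.atTop_mul_const (norm_pos_iff.2 hv))
  refine tendsto_atTop_mono' _ ((eventually_ge_atTop 0).mono fun t ht => ?_) h1
  have ht' : (0 : ℝ) ≤ t := ht
  show t * ‖v i‖ + -‖x i‖ ≤ ‖spinCurve 0 x v t i‖
  rw [← toC.norm_map (spinCurve 0 x v t i), toC_spinCurve, spinIntegral_zero_left,
    ← toC.norm_map (v i), ← toC.norm_map (x i)]
  have h2 := norm_sub_le (toC (x i) + ↑t * toC (v i)) (toC (x i))
  rw [add_sub_cancel_left, norm_mul, Complex.norm_real, Real.norm_of_nonneg ht'] at h2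
  linarith

/-- In a non-rotating equilibrium, whether the points converge or drift off to infinity is decided
by the mismatch error. -/
theorem IsAmbient.converge_or_drift (hA : G.IsAmbient y E A)
    (hp : p ∈ G.redErr y E '' A)
    (hs : ∀ x ∈ A, G.redErr y E x = p → HasSpin 0 x (G.overall y μ x)) (i₀ : Fin n) :
    (∀ x x', G.IsEquilibriumSolution y E A μ p x' → ExpConverges x x' →
      ∃ c : Config n, ExpConverges x fun _ => c) ∨
    (∀ x x', G.IsEquilibriumSolution y E A μ p x' → ExpConverges x x' →
      ∀ i, Tendsto (fun t => ‖x t i‖) atTop atTop) := by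
  have hrig : ∀ x', G.IsEquilibriumSolution y E A μ p x' →
      ∃ θ b, x' 0 = rigidMotion θ b (G.lift y E A p) := fun x' hx' =>
    hA.orbit _ (lift_mem hp) _ (hx'.2 0 le_rfl).1 ((redErr_lift hp).trans hx'.redErr_eq.symm)
  -- Without spin all points share one velocity, and congruent formations have velocities of equal
  -- length. One vertex of one lift, which depends on `μ` and `p` only, therefore decides for all
  -- solutions.
  by_cases h0 : G.overall y μ (G.lift y E A p) i₀ = 0
  · left
    intro x x' hx' hxx'
    refine ⟨x' 0, hxx'.of_norm_le (C := 1) fun t ht => ?_⟩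
    obtain ⟨θ, b, hθ⟩ := hrig x' hx'
    have h1 : x' t = x' 0 := by
      rw [hA.eq_spinCurve hs i₀ hx' ht]
      refine config_ext fun i => ?_
      have h2 : toC (G.overall y μ (x' 0) i₀) = 0 := by
        rw [hθ, toC_overall_rigidMotion, h0, map_zero, mul_zero]
      have h3 := hs _ (hx'.2 0 le_rfl).1 hx'.redErr_eq i i₀
      rw [h2, Complex.ofReal_zero, zero_mul, zero_mul, sub_zero] at h3
      rw [toC_spinCurve, h3, mul_zero, add_zero]
    rw [h1, one_mul]
  · right
    intro x x' hx' hxx' i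
    obtain ⟨θ, b, hθ⟩ := hrig x' hx'
    refine (hxx'.apply i).tendsto_norm_atTop ?_
    have h1 : G.overall y μ (x' 0) i ≠ 0 := by
      intro h2
      have h3 := hs _ (hx'.2 0 le_rfl).1 hx'.redErr_eq i i₀
      rw [h2, map_zero, Complex.ofReal_zero, zero_mul, zero_mul, zero_sub, neg_eq_zero, hθ,
        toC_overall_rigidMotion] at h3
      exact h0 (toC.toLinearEquiv.map_eq_zero_iff.1
        ((mul_eq_zero.1 h3).resolve_left (Complex.exp_ne_zero _)))
    refine (tendsto_norm_spinCurve_zero (x := x' 0) h1).congr'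
      ((eventually_ge_atTop 0).mono fun t ht => ?_)
    exact congrArg (fun z : Config n => ‖z i‖) (hA.eq_spinCurve hs i₀ hx' ht).symm

end OrientedGraph

end Formation

end

/-! ### Assembly of the main result. -/

theorem theorem4 {n m : ℕ} (hn : 3 ≤ n) (G : Formation.OrientedGraph n m)
    (y : Formation.Config n) (hy : G.IsTarget y)
    (E : Finset (Fin m)) (hE : G.MinInfRigidOn E y) :
    -- ambient sets exist, and the result holds on each of them
    (∃ A : Set (Formation.Config n), G.IsAmbient y E A) ∧
    ∀ A : Set (Formation.Config n), G.IsAmbient y E A →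
      ∃ (M : Set (Fin m → ℝ)) (εeq : (Fin m → ℝ) → (E → ℝ)),
        IsOpen M ∧ 0 ∈ M ∧ ContDiffOn ℝ ∞ εeq M ∧ εeq 0 = 0 ∧
        (∀ μ ∈ M, Formation.IsExpStableEquilibrium (G.errSys y E A μ) (G.redErr y E '' A)
          (εeq μ)) ∧
        (∀ μ ∈ M,
          -- solutions starting in the states considered exist for all time
          (∀ x₀ ∈ A, G.redErr y E x₀ ∈ Formation.domainOfAttraction (G.errSys y E A μ)
              (G.redErr y E '' A) (εeq μ) →
            ∃ x, G.IsAttracted y E A μ (εeq μ) x ∧ x 0 = x₀) ∧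
          -- they stay infinitesimally rigid and converge to an equilibrium solution
          (∀ x, G.IsAttracted y E A μ (εeq μ) x →
            (∀ t : ℝ, 0 ≤ t → G.InfRigid (x t)) ∧
            ∃ x', G.IsEquilibriumSolution y E A μ (εeq μ) x' ∧ Formation.ExpConverges x x') ∧
          -- constant relative positions; which alternative holds depends on `μ` only
          ((∀ x x', G.IsAttracted y E A μ (εeq μ) x →
              G.IsEquilibriumSolution y E A μ (εeq μ) x' → Formation.ExpConverges x x' →
              G.ZConstant x' →
              ∃ c : Formation.Config n, Formation.ExpConverges x (fun _ => c)) ∨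
            (∀ x x', G.IsAttracted y E A μ (εeq μ) x →
              G.IsEquilibriumSolution y E A μ (εeq μ) x' → Formation.ExpConverges x x' →
              G.ZConstant x' →
              ∀ i, Filter.Tendsto (fun t => ‖x t i‖) Filter.atTop Filter.atTop)) ∧
          -- nonconstant relative positions
          (∀ x x', G.IsAttracted y E A μ (εeq μ) x →
            G.IsEquilibriumSolution y E A μ (εeq μ) x' → Formation.ExpConverges x x' →
            ¬ G.ZConstant x' → Formation.IsRotating x')) ∧
        -- the generic case
        (Formation.Unaligned y →
          ∃ M₀ ⊆ M, IsOpen M₀ ∧ 0 ∈ M₀ ∧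
            ∃ N ⊆ M₀, IsOpen N ∧ M₀ ⊆ closure N ∧ MeasureTheory.volume (M₀ \ N) = 0 ∧
              ∀ μ ∈ N, ∀ x, G.IsAttracted y E A μ (εeq μ) x →
                ∃ x', G.IsEquilibriumSolution y E A μ (εeq μ) x' ∧
                  Formation.ExpConverges x x' ∧ ¬ G.ZConstant x' ∧
                  Formation.IsRotating x') := by
  refine ⟨G.exists_isAmbient hn hE, fun A hA => ?_⟩
  obtain ⟨M, p, hMo, h0M, hp, hp0, hM⟩ := hA.isPreAmbient.exists_equilibria hA.mem
  obtain ⟨k, hk⟩ := Formation.OrientedGraph.MinInfRigidOn.nonempty G hn hE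
  have hspin : ∀ μ ∈ M, ∃ s : ℝ, ∀ x ∈ A, G.redErr y E x = p μ →
      Formation.HasSpin s x (G.overall y μ x) := fun μ hμ =>
    hA.exists_hasSpin hn (hM μ hμ).1 (hM μ hμ).2.1
  have hconv : ∀ μ ∈ M, ∀ x, G.IsAttracted y E A μ (p μ) x →
      (∀ t : ℝ, 0 ≤ t → G.InfRigid (x t)) ∧
      ∃ x', G.IsEquilibriumSolution y E A μ (p μ) x' ∧ Formation.ExpConverges x x' := by
    rintro μ hμ x ⟨hx, hx0, u, hu, hu0, hup⟩
    obtain ⟨s, hs⟩ := hspin μ hμ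
    have hxu : ∀ t, 0 ≤ t → x t ∈ A ∧ G.redErr y E (x t) = u t := fun t ht =>
      hA.redErr_eq_of_isSolution hk hu hx hx0 hu0 ht
    exact ⟨fun t ht => Formation.OrientedGraph.MinInfRigidOn.infRigid G hn
        (hA.rigid _ (hxu t ht).1),
      hA.exists_expConverges hk (hM μ hμ).1 hs hu ((hM μ hμ).expConverges hu hup) hx hxu⟩
  refine ⟨M, p, hMo, h0M, hp, hp0, hM, fun μ hμ => ⟨?_, hconv μ hμ, ?_, ?_⟩, fun _ => ?_⟩
  · rintro x₀ hx₀ ⟨u, hu, hu0, hup⟩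
    obtain ⟨x, hx, hx0, -⟩ := hA.exists_solution hk hu hx₀ hu0
    exact ⟨x, ⟨hx, hx0.symm ▸ hx₀, u, hu, hx0.symm ▸ hu0, hup⟩, hx0⟩
  · obtain ⟨s, hs⟩ := hspin μ hμ
    by_cases h : s = 0
    · subst h
      exact (hA.converge_or_drift (hM μ hμ).1 hs (G.head k)).imp
        (fun h x x' _ hx' hxx' _ => h x x' hx' hxx') fun h x x' _ hx' hxx' _ => h x x' hx' hxx'
    -- With nonzero spin no equilibrium solution has constant relative positions, so the alternative
    -- holds vacuously.
    · exact Or.inl fun x x' _ hx' _ hz => absurd ((hA.zConstant_iff hk hs hx').1 hz) h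
  · intro x x' _ hx' _ hz
    obtain ⟨s, hs⟩ := hspin μ hμ
    exact (hs _ (hx'.2 0 le_rfl).1 hx'.redErr_eq).isRotating
      (fun h => hz ((hA.zConstant_iff hk hs hx').2 h)) (G.head k)
      fun t ht => hA.eq_spinCurve hs (G.head k) hx' ht
  · obtain ⟨M₀, hsub, hopen, hmem, N, hN, hNo, hdense, hnull, htorque⟩ :=
      hA.exists_torque_nhds hn hMo h0M hp hp0 fun μ hμ => (hM μ hμ).1
    refine ⟨M₀, hsub, hopen, hmem, N, hN, hNo, hdense, hnull, fun μ hμN x hx => ?_⟩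
    have hμ := hsub (hN hμN)
    obtain ⟨s, hs⟩ := hspin μ hμ
    -- Zero spin would balance the torques at the lift, which is excluded on `N`.
    have hs0 : s ≠ 0 := by
      rintro rfl
      have hL := Formation.OrientedGraph.lift_mem (hM μ hμ).1
      exact htorque μ hμN (Formation.OrientedGraph.sum_mul_torque_eq_zero (by omega)
        (hs _ hL (Formation.OrientedGraph.redErr_lift (hM μ hμ).1)))
    obtain ⟨x', hx', hxx'⟩ := (hconv μ hμ x hx).2
    exact ⟨x', hx', hxx', fun hz => hs0 ((hA.zConstant_iff hk hs hx').1 hz),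
      (hs _ (hx'.2 0 le_rfl).1 hx'.redErr_eq).isRotating hs0 (G.head k)
        fun t ht => hA.eq_spinCurve hs (G.head k) hx' ht⟩
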